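/- **Coefficients.** For $n\in\mathbb Z$ put $\{n\}=\frac{q^{2n}-1}{q^2-1}$. For $x\in\mathbb Q$ with continued fraction expansion $[a_1,\dots,a_{2m}]$ of even length ($a_1\in\mathbb Z$, $a_i\ge 1$ for $i\ge2$), let $$\{x\}=\{a_1\}+\cfrac{q^{2a_1}}{\{a_2\}_{q^{-2}}+\cfrac{q^{-2a_2}}{\{a_3\}+\cfrac{q^{2a_3}}{\ddots+\cfrac{q^{2a_{2m-1}}}{\{a_{2m}\}_{q^{-2}}}}}}\in\mathbb Q(q),\qquad \{a\}_{q^{-2}}=\frac{q^{-2a}-1}{q^{-2}-1},$$ $\binom{x}{k}_q=\frac{\{x\}\{x-1\}\cdots\{x-k+1\}}{\{k\}\cdots\{1\}}$ and $\delta_x=\{x\}-\{x-1\}$. Let $K$ be a commutative $\mathbb Q(q)$-algebra with an element $\nu_x$ such that $\nu_x^2=\delta_x^{-1}$ (for instance $K=\mathbb Q(q)[\nu_x]$). **Webs.** Objects are finite words of upward and downward arrows with labels in $\mathbb N^*$. Webs are oriented planar trivalent graphs with cups and caps, generated by the merge vertices $\uparrow_k\uparrow_l\to\uparrow_{k+l}$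 and the split vertices $\uparrow_{k+l}\to\uparrow_k\uparrow_l$; edges labelled $0$ are erased, and webs with a negative label are zero. For a commutative ring $R$ with a unit $q$ such that $q^2-1$ is a unit, consider $R$-linear braided strict monoidal categories generated by webs, taken up to isotopy (straightening of cups and caps; rotation of vertices), subject to * the *upward relations*: associativity of merges and of splits; digon removal: a split $\uparrow_{k+l}\to\uparrow_k\uparrow_l$ followed by the merge is $q^{-kl}\binom{k+l}{k}_q$ times the identity; on uprights $k,l$, (a $1$-rung to the right, then a $1$-rung to the left) $-$ (a $1$-rung to the left, then a $1$-rung to the right) $=q^{1-k+l}\{k-l\}\,\mathrm{id}$; and, on three uprights, with $E_i^{(b)}$ (resp. $F_i^{(b)}$) the rung moving $b$ from upright $i+1$ to upright $i$ (resp. from $i$ to $i+1$), $E_i^{(2)}E_j-E_iE_jE_i+E_jE_i^{(2)}=0$ and $F_i^{(2)}F_j-F_iF_jF_i+F_jF_i^{(2)}=0$ for $\{i,j\}=\{1,2\}$; * the braiding of $\uparrow_k$ over $\uparrow_l$ is $(-q)^{kl}\sum_{b-a=k-l}(-q)^{b-k}$ times ($b$-rung to the right, then $a$-rung to the left), and the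 crossing $\uparrow_k\uparrow_l\to\uparrow_l\uparrow_k$ with $\uparrow_l$ over is $(-q)^{-kl}\sum_{b-a=l-k}(-q)^{l-b}$ times ($b$-rung to the left, then $a$-rung to the right). The universal web category $\infty\mathbf{Web}$ is the category so generated over $\mathbb Z[q^{\pm1},a^{\pm1}][(q-q^{-1})^{-1}]$ with the additional relations: both $1$-labelled circles equal $\frac{a-a^{-1}}{q-q^{-1}}$; a $1$-labelled upward strand with a $1$-labelled loop attached on its right, or on its left (through a $2$-labelled edge), equals $\frac{aq^{-1}-a^{-1}q}{q-q^{-1}}\,\mathrm{id}$; the mixed square on $\uparrow_1\downarrow_1$ (two horizontal oppositely oriented $2$-labelled edges joined by $1$-labelled edges) equals $\mathrm{id}+\frac{aq^{-2}-a^{-1}q^2}{q-q^{-1}}\,(\text{cap followed by cup})$, together with its mirror image on $\downarrow_1\uparrow_1$. The category $x\mathbf{Web}$ is the $K$-linear category obtained from $\infty\mathbf{Web}$ by extension of scalars along $q\mapsto q$, $a\mapsto q\nu_x\delta_x$. **Proposition.** The category $x\mathbf{Web}$ is the braided $K$-linear category whose objects are the words of upward and downward arrows with labels in $\mathbb N^*$,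 whose morphisms are generated by webs up to isotopy, whose braiding is given by the formulas above, with the following relations: * the upward relations, which do not depend on $x$; * circle evaluation: both $k$-labelled circles equal $u_k:=q^{k(k-1)}\nu_x^k\binom{x}{k}_q$; * sideway digon removal: a $k$-labelled upward strand with an $l$-labelled loop attached on its right, or on its left (through a $(k+l)$-labelled edge), equals $q^{-kl}\binom{k+l}{k}_q\frac{u_{k+l}}{u_k}$ times the identity, where $\frac{u_{k+l}}{u_k}$ stands for $q^{l(2k+l-1)}\nu_x^l\prod_{j=0}^{l-1}\frac{\{x-k-j\}}{\{k+j+1\}}$ (also when $u_k=0$); * mixed square removal: the mixed square on $\uparrow_1\downarrow_1$ equals $\mathrm{id}+q^2\nu_x\{x-2\}\,(\text{cap followed by cup})$, together with its mirror image. That is, there is an isomorphism of $K$-linear braided monoidal categories between $x\mathbf{Web}$ and the category with this presentation which is the identity on objects and sends merges, splits, cups, caps and the braiding to themselves; and every morphism is a linear combination of webs without crossings. -/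

import Mathlib

open CategoryTheory MonoidalCategory TensorProduct

noncomputable section

namespace Web

universe u v w

/-! ### Boundary words -/

/-- An upward (`up = true`) or downward arrow labelled by a positive integer. -/
structure Arrow where
  up : Bool
  label : ℕ+

/-- A sequence of labelled upward and downward arrows on a horizontal line. -/
abbrev Word := List Arrow

/-- The upward arrow labelled `k`; an arrow labelled `0` is erased. -/
def up : ℕ → Word
  | 0 => []
  | n + 1 => [⟨true, n.succPNat⟩]

/-- The downward arrow labelled `k`; an arrow labelled `0` is erased. -/
def dn : ℕ → Word
  | 0 => []
  | n + 1 => [⟨false, n.succPNat⟩]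

/-! ### Formal diagrams

Expressions for morphisms from the bottom word to the top word, built from identities (of equal
words), vertical and horizontal composition, linear combinations, crossings, trivalent vertices,
cups and caps. `comp f g` puts `g` on top of `f`. -/

inductive Diag (R : Type u) : Word → Word → Type u
  | eqHom {X Y : Word} (h : X = Y) : Diag R X Y
  | comp {X Y Z : Word} (f : Diag R X Y) (g : Diag R Y Z) : Diag R X Z
  | tensor {X Y X' Y' : Word} (f : Diag R X Y) (g : Diag R X' Y') : Diag R (X ++ X') (Y ++ Y')
  | zero {X Y : Word} : Diag R X Y
  | add {X Y : Word} (f g : Diag R X Y) : Diag R X Y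
  | smul {X Y : Word} (r : R) (f : Diag R X Y) : Diag R X Y
  /-- the strands of `X` pass over those of `Y` -/
  | braid (X Y : Word) : Diag R (X ++ Y) (Y ++ X)
  | braidInv (X Y : Word) : Diag R (Y ++ X) (X ++ Y)
  | merge (k l : ℕ) : Diag R (up k ++ up l) (up (k + l))
  | split (k l : ℕ) : Diag R (up (k + l)) (up k ++ up l)
  /-- `∅ ⟶ ↑ ↓` -/
  | cupR (k : ℕ) : Diag R [] (up k ++ dn k)
  /-- `↓ ↑ ⟶ ∅` -/
  | capR (k : ℕ) : Diag R (dn k ++ up k) []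
  /-- `∅ ⟶ ↓ ↑` -/
  | cupL (k : ℕ) : Diag R [] (dn k ++ up k)
  /-- `↑ ↓ ⟶ ∅` -/
  | capL (k : ℕ) : Diag R (up k ++ dn k) []

namespace Diag

variable {R : Type u}

/-- The identity diagram. -/
def idd (X : Word) : Diag R X X := eqHom rfl

/-- Vertical composition where the middle words agree up to re-bracketing. -/
def seq {X Y Y' Z : Word} (f : Diag R X Y) (g : Diag R Y' Z)
    (h : Y = Y' := by simp [up, dn]) : Diag R X Z :=
  comp f (comp (eqHom h) g)

/-- Change the bottom and top words of a diagram along equalities. -/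
def cast {X Y X' Y' : Word} (f : Diag R X Y)
    (hX : X' = X := by simp [up, dn]) (hY : Y = Y' := by simp [up, dn]) : Diag R X' Y' :=
  comp (eqHom hX) (comp f (eqHom hY))

/-- The diagram `f` with vertical strands `A` to its left and `B` to its right. -/
def whisk (A : Word) {X Y : Word} (f : Diag R X Y) (B : Word) :
    Diag R (A ++ X ++ B) (A ++ Y ++ B) :=
  tensor (tensor (idd A) f) (idd B)

/-- `f 0 + ⋯ + f (n - 1)`. -/
def sum {X Y : Word} : ℕ → (ℕ → Diag R X Y) → Diag R X Y
  | 0, _ => zero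
  | n + 1, f => add (sum n f) (f n)

/-- The diagram is a linear combination of webs: it involves no crossings. -/
def IsWeb : ∀ {X Y : Word}, Diag R X Y → Prop
  | _, _, comp f g => f.IsWeb ∧ g.IsWeb
  | _, _, tensor f g => f.IsWeb ∧ g.IsWeb
  | _, _, add f g => f.IsWeb ∧ g.IsWeb
  | _, _, smul _ f => f.IsWeb
  | _, _, braid _ _ => False
  | _, _, braidInv _ _ => False
  | _, _, _ => True

/-! #### Rotations of the trivalent vertices -/

/-- The vertex `f : ↑k ↑l ⟶ ↑m` rotated by half a turn, one way. -/
def mergeRotR {k l m : ℕ} (f : Diag R (up k ++ up l) (up m)) : Diag R (dn m) (dn l ++ dn k) :=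
  cast <|
    ((whisk (dn m) (cupR k) []).seq (whisk (dn m ++ up k) (cupR l) (dn k))).seq
      ((whisk (dn m) f (dn l ++ dn k)).seq (whisk [] (capR m) (dn l ++ dn k)))

/-- The vertex `f : ↑k ↑l ⟶ ↑m` rotated by half a turn, the other way. -/
def mergeRotL {k l m : ℕ} (f : Diag R (up k ++ up l) (up m)) : Diag R (dn m) (dn l ++ dn k) :=
  cast <|
    ((whisk [] (cupL l) (dn m)).seq (whisk (dn l) (cupL k) (up l ++ dn m))).seq
      ((whisk (dn l ++ dn k) f (dn m)).seq (whisk (dn l ++ dn k) (capL m) []))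

/-- The vertex `f : ↑m ⟶ ↑k ↑l` rotated by half a turn, one way. -/
def splitRotR {k l m : ℕ} (f : Diag R (up m) (up k ++ up l)) : Diag R (dn l ++ dn k) (dn m) :=
  cast <|
    ((whisk (dn l ++ dn k) (cupR m) []).seq (whisk (dn l ++ dn k) f (dn m))).seq
      ((whisk (dn l) (capR k) (up l ++ dn m)).seq (whisk [] (capR l) (dn m)))

/-- The vertex `f : ↑m ⟶ ↑k ↑l` rotated by half a turn, the other way. -/
def splitRotL {k l m : ℕ} (f : Diag R (up m) (up k ++ up l)) : Diag R (dn l ++ dn k) (dn m) :=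
  cast <|
    ((whisk [] (cupL m) (dn l ++ dn k)).seq (whisk (dn m) f (dn l ++ dn k))).seq
      ((whisk (dn m ++ up k) (capL l) (dn k)).seq (whisk (dn m) (capL k) []))

/-! #### Ladders

A rung with a prescribed top row; it is zero unless the top row is the one that results from
moving `b`, in particular if a label would become negative. -/

/-- From `↑k ↑l` to `↑k' ↑l'`, a rung moves `b` from the right upright to the left one. -/
def rungL (b k l k' l' : ℕ) : Diag R (up k ++ up l) (up k' ++ up l') :=
  if h : k' = k + b ∧ l = b + l' then
    (tensor (idd (up k)) (comp (eqHom (congrArg up h.2)) (split b l'))).seq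
      (tensor (comp (merge k b) (eqHom (congrArg up h.1.symm))) (idd (up l')))
  else zero

/-- From `↑k ↑l` to `↑k' ↑l'`, a rung moves `b` from the left upright to the right one. -/
def rungR (b k l k' l' : ℕ) : Diag R (up k ++ up l) (up k' ++ up l') :=
  if h : k = k' + b ∧ l' = b + l then
    (tensor (comp (eqHom (congrArg up h.1)) (split k' b)) (idd (up l))).seq
      (tensor (idd (up k')) (comp (merge b l) (eqHom (congrArg up h.2.symm))))
  else zero

/-- Three upright strands. -/
abbrev up3 (k l r : ℕ) : Word := up k ++ up l ++ up r

/-- A rung from the second upright to the first of three. -/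
def rungL12 (b k l r k' l' : ℕ) : Diag R (up3 k l r) (up3 k' l' r) :=
  tensor (rungL b k l k' l') (idd (up r))

/-- A rung from the third upright to the second of three. -/
def rungL23 (b k l r l' r' : ℕ) : Diag R (up3 k l r) (up3 k l' r') :=
  cast (tensor (idd (up k)) (rungL b l r l' r'))

/-- A rung from the first upright to the second of three. -/
def rungR12 (b k l r k' l' : ℕ) : Diag R (up3 k l r) (up3 k' l' r) :=
  tensor (rungR b k l k' l') (idd (up r))

/-- A rung from the second upright to the third of three. -/
def rungR23 (b k l r l' r' : ℕ) : Diag R (up3 k l r) (up3 k l' r') :=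
  cast (tensor (idd (up k)) (rungR b l r l' r'))

/-! #### Closed diagrams and mixed diagrams -/

/-- The clockwise circle labelled `k`. -/
def circleR (k : ℕ) : Diag R [] [] := comp (cupR k) (capL k)

/-- The counterclockwise circle labelled `k`. -/
def circleL (k : ℕ) : Diag R [] [] := comp (cupL k) (capR k)

/-- An upward strand labelled `k` to which a loop labelled `l` is attached on the right. -/
def digonR (k l : ℕ) : Diag R (up k) (up k) :=
  cast <|
    ((whisk (up k) (cupR l) []).seq (whisk [] (merge k l) (dn l))).seq
      ((whisk [] (split k l) (dn l)).seq (whisk (up k) (capL l) []))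

/-- An upward strand labelled `k` to which a loop labelled `l` is attached on the left. -/
def digonL (k l : ℕ) : Diag R (up k) (up k) :=
  cast <|
    ((whisk [] (cupL l) (up k)).seq (whisk (dn l) (merge l k) [])).seq
      ((whisk (dn l) (split l k) []).seq (whisk [] (capR l) (up k)))

/-- Two `1`-labelled strands merged and split again. -/
def dumbbell : Diag R (up 1 ++ up 1) (up 1 ++ up 1) := comp (merge 1 1) (split 1 1)

/-- The dumbbell turned on its side, its `2`-labelled edge pointing to the right. -/
def sideR : Diag R (up 1 ++ dn 1) (dn 1 ++ up 1) :=
  cast <|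
    (whisk [] (cupL 1) (up 1 ++ dn 1)).seq
      ((whisk (dn 1) dumbbell (dn 1)).seq (whisk (dn 1 ++ up 1) (capL 1) []))

/-- The dumbbell turned on its side, its `2`-labelled edge pointing to the left. -/
def sideL : Diag R (dn 1 ++ up 1) (up 1 ++ dn 1) :=
  cast <|
    (whisk (dn 1 ++ up 1) (cupR 1) []).seq
      ((whisk (dn 1) dumbbell (dn 1)).seq (whisk [] (capR 1) (up 1 ++ dn 1)))

end Diag

open Diag

/-! ### Coefficients -/

section Coefficients

variable {R : Type u} [CommRing R]

/-- `{m} = (q ^ (2m) - 1) / (q ^ 2 - 1)` for an integer `m`; used where `q ^ 2 - 1` is a unit. -/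
def qInt (q : Rˣ) (m : ℤ) : R := (((q ^ (2 * m) : Rˣ) : R) - 1) * Ring.inverse ((q : R) ^ 2 - 1)

/-- The `q`-binomial coefficient `{n choose k}` for natural numbers, a polynomial in `q ^ 2`,
through the `q`-Pascal rule. -/
def qBinom (q : Rˣ) : ℕ → ℕ → R
  | _, 0 => 1
  | 0, _ + 1 => 0
  | n + 1, k + 1 => qBinom q n k + (q : R) ^ (2 * (k + 1)) * qBinom q n (k + 1)

/-- `{1} {2} ⋯ {n}`. -/
def qFact (q : Rˣ) (n : ℕ) : R := ∏ j ∈ Finset.range n, qInt q (j + 1)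

theorem qInt_add (q : Rˣ) (m n : ℤ) :
    qInt q (m + n) = qInt q m + ((q ^ (2 * m) : Rˣ) : R) * qInt q n := by
  simp only [qInt, mul_add, zpow_add, Units.val_mul]
  ring

theorem qBinom_eq_zero (q : Rˣ) : ∀ n k : ℕ, n < k → qBinom q n k = 0
  | _, 0, h => absurd h (Nat.not_lt_zero _)
  | 0, _ + 1, _ => by rw [qBinom]
  | n + 1, k + 1, h => by
      rw [qBinom, qBinom_eq_zero q n k (by omega), qBinom_eq_zero q n (k + 1) (by omega)]
      simp

theorem qBinom_mul_qFact (q : Rˣ) :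
    ∀ k l : ℕ, qBinom q (k + l) k * qFact q k * qFact q l = qFact q (k + l)
  | 0, l => by simp [qBinom, qFact]
  | k + 1, 0 => by
      have h := qBinom_mul_qFact q k 0
      simp only [Nat.add_zero] at h ⊢
      rw [qBinom, qBinom_eq_zero q k (k + 1) (by omega), qFact, Finset.prod_range_succ, ← qFact]
      simp only [qFact, Finset.prod_range_zero, mul_one, mul_zero, add_zero] at h ⊢
      rw [← mul_assoc, h]
  | k + 1, l + 1 => by
      have h₁ := qBinom_mul_qFact q k (l + 1)
      have h₂ := qBinom_mul_qFact q (k + 1) l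
      have e : k + 1 + l = k + (l + 1) := by omega
      have e' : k + 1 + (l + 1) = (k + (l + 1)) + 1 := by omega
      have s : ∀ n : ℕ, qFact q (n + 1) = qFact q n * qInt q (n + 1) := fun n => by
        rw [qFact, Finset.prod_range_succ, ← qFact]
      rw [e] at h₂
      rw [e', qBinom, s (k + (l + 1)), s k, s l]
      rw [s l] at h₁
      rw [s k] at h₂
      have a := qInt_add q ((k : ℤ) + 1) ((l : ℤ) + 1)
      have c : ((k + (l + 1) : ℕ) : ℤ) + 1 = ((k : ℤ) + 1) + ((l : ℤ) + 1) := by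
        push_cast; ring
      have p : ((q ^ (2 * ((k : ℤ) + 1)) : Rˣ) : R) = (q : R) ^ (2 * (k + 1)) := by
        have : (2 * ((k : ℤ) + 1)) = ((2 * (k + 1) : ℕ) : ℤ) := by push_cast; ring
        rw [this, zpow_natCast, Units.val_pow_eq_pow_val]
      rw [c, a, p]
      linear_combination (qInt q ((k : ℤ) + 1)) * h₁ +
        ((q : R) ^ (2 * (k + 1)) * qInt q ((l : ℤ) + 1)) * h₂

/-- `(a q ^ (-r) - a⁻¹ q ^ r) / (q - q⁻¹)`; used where `q - q⁻¹` is a unit. -/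
def aInt (q a : Rˣ) (r : ℤ) : R :=
  (((a * q ^ (-r) : Rˣ) : R) - ((a⁻¹ * q ^ r : Rˣ) : R)) *
    Ring.inverse ((q : R) - ((q⁻¹ : Rˣ) : R))

end Coefficients

/-! ### Relations -/

/-- The crossing `↑k ↑l ⟶ ↑l ↑k` in which the strand from the bottom left passes over: the sum of
`(-q) ^ (k l) (-q) ^ (b - k)` times a rung moving `b` to the right followed by a rung moving `a` to
the left, over all `a, b ≥ 0` with `b - a = k - l`. Only `b ≤ k` contributes, and the summands
with `b + l < k` are zero. -/
def crossingSum {R : Type u} [CommRing R] (q : Rˣ) (k l : ℕ) :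
    Diag R (up k ++ up l) (up l ++ up k) :=
  smul (((-q) ^ (k * l) : Rˣ) : R)
    (sum (k + 1) fun b => smul (((-q) ^ ((b : ℤ) - k) : Rˣ) : R)
      (comp (rungR b k l (k - b) (l + b)) (rungL (b + l - k) (k - b) (l + b) l k)))

/-- The crossing `↑k ↑l ⟶ ↑l ↑k` in which the strand from the bottom right passes over: the sum of
`(-q) ^ (-k l) (-q) ^ (l - b)` times a rung moving `b` to the left followed by a rung moving `a` to
the right, over all `a, b ≥ 0` with `b - a = l - k`. Only `b ≤ l` contributes, and the summands
with `b + k < l` are zero. -/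
def crossingInvSum {R : Type u} [CommRing R] (q : Rˣ) (k l : ℕ) :
    Diag R (up k ++ up l) (up l ++ up k) :=
  smul (((-q) ^ (-((k : ℤ) * l)) : Rˣ) : R)
    (sum (l + 1) fun b => smul (((-q) ^ ((l : ℤ) - b) : Rˣ) : R)
      (comp (rungL b k l (k + b) (l - b)) (rungR (b + k - l) (k + b) (l - b) l k)))

/-- A family of relations between diagrams. -/
abbrev Relations (R : Type u) := ∀ X Y : Word, Diag R X Y → Diag R X Y → Prop

/-- Relations common to all web categories: erasure of edges labelled `0`, planar isotopy,
the relations between upward webs, and the formulas for the upward crossings. -/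
inductive BasicRel {R : Type u} [CommRing R] (q : Rˣ) : Relations R
  -- edges labelled `0` are erased
  | merge_zero_left (l : ℕ) :
      BasicRel q _ _ (merge 0 l) (eqHom (by simp [up]))
  | merge_zero_right (k : ℕ) :
      BasicRel q _ _ (merge k 0) (eqHom (by simp [up]))
  | split_zero_left (l : ℕ) :
      BasicRel q _ _ (split 0 l) (eqHom (by simp [up]))
  | split_zero_right (k : ℕ) :
      BasicRel q _ _ (split k 0) (eqHom (by simp [up]))
  | cupR_zero : BasicRel q _ _ (cupR 0) (idd [])
  | capR_zero : BasicRel q _ _ (capR 0) (idd [])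
  | cupL_zero : BasicRel q _ _ (cupL 0) (idd [])
  | capL_zero : BasicRel q _ _ (capL 0) (idd [])
  -- straightening of cups and caps
  | zigzag_up_R (k : ℕ) : BasicRel q _ _
      (cast ((whisk [] (cupR k) (up k)).seq (whisk (up k) (capR k) []))) (idd (up k))
  | zigzag_dn_R (k : ℕ) : BasicRel q _ _
      (cast ((whisk (dn k) (cupR k) []).seq (whisk [] (capR k) (dn k)))) (idd (dn k))
  | zigzag_up_L (k : ℕ) : BasicRel q _ _
      (cast ((whisk (up k) (cupL k) []).seq (whisk [] (capL k) (up k)))) (idd (up k))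
  | zigzag_dn_L (k : ℕ) : BasicRel q _ _
      (cast ((whisk [] (cupL k) (dn k)).seq (whisk (dn k) (capL k) []))) (idd (dn k))
  -- rotation of vertices
  | merge_rot (k l : ℕ) : BasicRel q _ _ (mergeRotR (merge k l)) (mergeRotL (merge k l))
  | split_rot (k l : ℕ) : BasicRel q _ _ (splitRotR (split k l)) (splitRotL (split k l))
  -- associativity of vertices
  | merge_assoc (k l r : ℕ) : BasicRel q _ _
      ((tensor (merge k l) (idd (up r))).seq (merge (k + l) r))
      (cast ((tensor (idd (up k)) (merge l r)).seq (merge k (l + r)))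
        (by simp) (by rw [Nat.add_assoc]))
  | split_assoc (k l r : ℕ) : BasicRel q _ _
      ((split (k + l) r).seq (tensor (split k l) (idd (up r))))
      (cast ((split k (l + r)).seq (tensor (idd (up k)) (split l r)))
        (by rw [Nat.add_assoc]) (by simp))
  -- digon removal
  | digon (k l : ℕ) : BasicRel q _ _
      (comp (split k l) (merge k l))
      (smul (((q ^ (-((k : ℤ) * l)) : Rˣ) : R) * qBinom q (k + l) k) (idd (up (k + l))))
  -- square switch
  | square_switch (k l : ℕ) : BasicRel q _ _
      (add (comp (rungR 1 k l (k - 1) (l + 1)) (rungL 1 (k - 1) (l + 1) k l))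
        (smul (-1) (comp (rungL 1 k l (k + 1) (l - 1)) (rungR 1 (k + 1) (l - 1) k l))))
      (smul (((q ^ (1 - (k : ℤ) + l) : Rˣ) : R) * qInt q ((k : ℤ) - l)) (idd (up k ++ up l)))
  -- the four cubic relations
  | serre₁ (k l r : ℕ) : BasicRel q _ _
      (add
        (comp (rungL23 1 k l r (l + 1) (r - 1)) (rungL12 2 k (l + 1) (r - 1) (k + 2) (l - 1)))
        (add
          (smul (-1) (comp (rungL12 1 k l r (k + 1) (l - 1))
            (comp (rungL23 1 (k + 1) (l - 1) r l (r - 1))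
              (rungL12 1 (k + 1) l (r - 1) (k + 2) (l - 1)))))
          (comp (rungL12 2 k l r (k + 2) (l - 2))
            (rungL23 1 (k + 2) (l - 2) r (l - 1) (r - 1)))))
      zero
  | serre₂ (k l r : ℕ) : BasicRel q _ _
      (add
        (comp (rungL12 1 k l r (k + 1) (l - 1)) (rungL23 2 (k + 1) (l - 1) r (l + 1) (r - 2)))
        (add
          (smul (-1) (comp (rungL23 1 k l r (l + 1) (r - 1))
            (comp (rungL12 1 k (l + 1) (r - 1) (k + 1) l)
              (rungL23 1 (k + 1) l (r - 1) (l + 1) (r - 2)))))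
          (comp (rungL23 2 k l r (l + 2) (r - 2))
            (rungL12 1 k (l + 2) (r - 2) (k + 1) (l + 1)))))
      zero
  | serre₃ (k l r : ℕ) : BasicRel q _ _
      (add
        (comp (rungR23 1 k l r (l - 1) (r + 1)) (rungR12 2 k (l - 1) (r + 1) (k - 2) (l + 1)))
        (add
          (smul (-1) (comp (rungR12 1 k l r (k - 1) (l + 1))
            (comp (rungR23 1 (k - 1) (l + 1) r l (r + 1))
              (rungR12 1 (k - 1) l (r + 1) (k - 2) (l + 1)))))
          (comp (rungR12 2 k l r (k - 2) (l + 2))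
            (rungR23 1 (k - 2) (l + 2) r (l + 1) (r + 1)))))
      zero
  | serre₄ (k l r : ℕ) : BasicRel q _ _
      (add
        (comp (rungR12 1 k l r (k - 1) (l + 1)) (rungR23 2 (k - 1) (l + 1) r (l - 1) (r + 2)))
        (add
          (smul (-1) (comp (rungR23 1 k l r (l - 1) (r + 1))
            (comp (rungR12 1 k (l - 1) (r + 1) (k - 1) l)
              (rungR23 1 (k - 1) l (r + 1) (l - 1) (r + 2)))))
          (comp (rungR23 2 k l r (l - 2) (r + 2))
            (rungR12 1 k (l - 2) (r + 2) (k - 1) (l - 1)))))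
      zero
  -- the crossings of upward strands
  | crossing (k l : ℕ) : BasicRel q _ _
      (braid (up k) (up l)) (crossingSum q k l)
  | crossing_inv (k l : ℕ) : BasicRel q _ _
      (braidInv (up l) (up k)) (crossingInvSum q k l)

/-- The additional relations of the universal web category. -/
inductive UniversalRel {R : Type u} [CommRing R] (q a : Rˣ) : Relations R
  | circleR : UniversalRel q a _ _ (circleR 1) (smul (aInt q a 0) (idd []))
  | circleL : UniversalRel q a _ _ (circleL 1) (smul (aInt q a 0) (idd []))
  | digonR : UniversalRel q a _ _ (digonR 1 1) (smul (aInt q a 1) (idd (up 1)))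
  | digonL : UniversalRel q a _ _ (digonL 1 1) (smul (aInt q a 1) (idd (up 1)))
  | square : UniversalRel q a _ _ (comp sideR sideL)
      (add (idd (up 1 ++ dn 1)) (smul (aInt q a 2) (comp (capL 1) (cupR 1))))
  | square_mirror : UniversalRel q a _ _ (comp sideL sideR)
      (add (idd (dn 1 ++ up 1)) (smul (aInt q a 2) (comp (capR 1) (cupL 1))))

/-- The additional relations with circle values `c k`, sideway digon values `d k l` (strand
labelled `k`, loop labelled `l`) and mixed square value `s`. -/
inductive MixedRel {R : Type u} [CommRing R] (c : ℕ → R) (d : ℕ → ℕ → R) (s : R) : Relations R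
  | circleR (k : ℕ) : MixedRel c d s _ _ (circleR k) (smul (c k) (idd []))
  | circleL (k : ℕ) : MixedRel c d s _ _ (circleL k) (smul (c k) (idd []))
  | digonR (k l : ℕ) : MixedRel c d s _ _ (digonR k l) (smul (d k l) (idd (up k)))
  | digonL (k l : ℕ) : MixedRel c d s _ _ (digonL k l) (smul (d k l) (idd (up k)))
  | square : MixedRel c d s _ _ (comp sideR sideL)
      (add (idd (up 1 ++ dn 1)) (smul s (comp (capL 1) (cupR 1))))
  | square_mirror : MixedRel c d s _ _ (comp sideL sideR)
      (add (idd (dn 1 ++ up 1)) (smul s (comp (capR 1) (cupL 1))))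

/-! ### The linear braided strict monoidal category presented by relations -/

/-- The congruence on diagrams generated by the relations `S` and the axioms of an `R`-linear,
strict monoidal, braided category. -/
inductive Equivalent {R : Type u} [CommRing R] (S : Relations R) :
    ∀ {X Y : Word}, Diag R X Y → Diag R X Y → Prop
  | of {X Y : Word} {f g : Diag R X Y} : S X Y f g → Equivalent S f g
  | refl {X Y : Word} (f : Diag R X Y) : Equivalent S f f
  | symm {X Y : Word} {f g : Diag R X Y} : Equivalent S f g → Equivalent S g f
  | trans {X Y : Word} {f g h : Diag R X Y} :
      Equivalent S f g → Equivalent S g h → Equivalent S f h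
  | comp_congr {X Y Z : Word} {f f' : Diag R X Y} {g g' : Diag R Y Z} :
      Equivalent S f f' → Equivalent S g g' → Equivalent S (comp f g) (comp f' g')
  | tensor_congr {X Y Z W : Word} {f f' : Diag R X Y} {g g' : Diag R Z W} :
      Equivalent S f f' → Equivalent S g g' → Equivalent S (tensor f g) (tensor f' g')
  | add_congr {X Y : Word} {f f' g g' : Diag R X Y} :
      Equivalent S f f' → Equivalent S g g' → Equivalent S (add f g) (add f' g')
  | smul_congr {X Y : Word} (r : R) {f f' : Diag R X Y} :
      Equivalent S f f' → Equivalent S (smul r f) (smul r f')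
  -- module structure
  | add_assoc {X Y : Word} (f g h : Diag R X Y) :
      Equivalent S (add (add f g) h) (add f (add g h))
  | add_comm {X Y : Word} (f g : Diag R X Y) : Equivalent S (add f g) (add g f)
  | zero_add {X Y : Word} (f : Diag R X Y) : Equivalent S (add zero f) f
  | one_smul {X Y : Word} (f : Diag R X Y) : Equivalent S (smul 1 f) f
  | zero_smul {X Y : Word} (f : Diag R X Y) : Equivalent S (smul 0 f) zero
  | mul_smul {X Y : Word} (r s : R) (f : Diag R X Y) :
      Equivalent S (smul (r * s) f) (smul r (smul s f))
  | add_smul {X Y : Word} (r s : R) (f : Diag R X Y) :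
      Equivalent S (smul (r + s) f) (add (smul r f) (smul s f))
  | smul_add {X Y : Word} (r : R) (f g : Diag R X Y) :
      Equivalent S (smul r (add f g)) (add (smul r f) (smul r g))
  -- category structure
  | id_comp {X Y : Word} (f : Diag R X Y) : Equivalent S (comp (idd X) f) f
  | comp_id {X Y : Word} (f : Diag R X Y) : Equivalent S (comp f (idd Y)) f
  | comp_assoc {X Y Z W : Word} (f : Diag R X Y) (g : Diag R Y Z) (h : Diag R Z W) :
      Equivalent S (comp (comp f g) h) (comp f (comp g h))
  -- strict monoidal structure
  | tensor_id (X Y : Word) : Equivalent S (tensor (idd X) (idd Y)) (idd (X ++ Y))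
  | tensor_comp {X Y Z X' Y' Z' : Word} (f : Diag R X Y) (g : Diag R Y Z)
      (f' : Diag R X' Y') (g' : Diag R Y' Z') :
      Equivalent S (comp (tensor f f') (tensor g g')) (tensor (comp f g) (comp f' g'))
  | tensor_assoc {X Y X' Y' X'' Y'' : Word} (f : Diag R X Y) (g : Diag R X' Y')
      (h : Diag R X'' Y'') :
      Equivalent S
        (comp (tensor (tensor f g) h) (eqHom (List.append_assoc Y Y' Y'')))
        (comp (eqHom (List.append_assoc X X' X'')) (tensor f (tensor g h)))
  | unit_tensor {X Y : Word} (f : Diag R X Y) : Equivalent S (tensor (idd []) f) f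
  | tensor_unit {X Y : Word} (f : Diag R X Y) :
      Equivalent S (comp (tensor f (idd [])) (eqHom (List.append_nil Y)))
        (comp (eqHom (List.append_nil X)) f)
  -- bilinearity of both compositions
  | add_comp {X Y Z : Word} (f f' : Diag R X Y) (g : Diag R Y Z) :
      Equivalent S (comp (add f f') g) (add (comp f g) (comp f' g))
  | comp_add {X Y Z : Word} (f : Diag R X Y) (g g' : Diag R Y Z) :
      Equivalent S (comp f (add g g')) (add (comp f g) (comp f g'))
  | smul_comp {X Y Z : Word} (r : R) (f : Diag R X Y) (g : Diag R Y Z) :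
      Equivalent S (comp (smul r f) g) (smul r (comp f g))
  | comp_smul {X Y Z : Word} (r : R) (f : Diag R X Y) (g : Diag R Y Z) :
      Equivalent S (comp f (smul r g)) (smul r (comp f g))
  | add_tensor {X Y Z W : Word} (f f' : Diag R X Y) (g : Diag R Z W) :
      Equivalent S (tensor (add f f') g) (add (tensor f g) (tensor f' g))
  | tensor_add {X Y Z W : Word} (f : Diag R X Y) (g g' : Diag R Z W) :
      Equivalent S (tensor f (add g g')) (add (tensor f g) (tensor f g'))
  | smul_tensor {X Y Z W : Word} (r : R) (f : Diag R X Y) (g : Diag R Z W) :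
      Equivalent S (tensor (smul r f) g) (smul r (tensor f g))
  | tensor_smul {X Y Z W : Word} (r : R) (f : Diag R X Y) (g : Diag R Z W) :
      Equivalent S (tensor f (smul r g)) (smul r (tensor f g))
  -- braiding
  | braid_braidInv (X Y : Word) :
      Equivalent S (comp (braid X Y) (braidInv X Y)) (idd (X ++ Y))
  | braidInv_braid (X Y : Word) :
      Equivalent S (comp (braidInv X Y) (braid X Y)) (idd (Y ++ X))
  | braid_naturality {X Y X' Y' : Word} (f : Diag R X Y) (g : Diag R X' Y') :
      Equivalent S (comp (tensor f g) (braid Y Y')) (comp (braid X X') (tensor g f))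
  | hexagon_forward (X Y Z : Word) :
      Equivalent S
        (comp (eqHom (List.append_assoc X Y Z))
          (comp (braid X (Y ++ Z)) (eqHom (List.append_assoc Y Z X))))
        (comp (tensor (braid X Y) (idd Z))
          (comp (eqHom (List.append_assoc Y X Z)) (tensor (idd Y) (braid X Z))))
  | hexagon_reverse (X Y Z : Word) :
      Equivalent S
        (comp (eqHom (List.append_assoc X Y Z).symm)
          (comp (braid (X ++ Y) Z) (eqHom (List.append_assoc Z X Y).symm)))
        (comp (tensor (idd X) (braid Y Z))
          (comp (eqHom (List.append_assoc X Z Y).symm) (tensor (braid X Z) (idd Y))))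

/-- The objects of the category presented by `S`: words of labelled arrows. -/
@[ext]
structure Presented {R : Type u} (S : Relations R) where
  word : Word

namespace Presented

variable {R : Type u} [CommRing R] {S : Relations R}

/-- Equality of diagrams in the presented category. -/
def setoid (S : Relations R) (X Y : Word) : Setoid (Diag R X Y) where
  r := Equivalent S
  iseqv := ⟨Equivalent.refl, Equivalent.symm, Equivalent.trans⟩

/-- Morphisms of the presented category: diagrams modulo the relations. -/
def Hom (S : Relations R) (X Y : Word) : Type u := Quotient (setoid S X Y)

/-- The morphism represented by a diagram. -/
def cls (S : Relations R) {X Y : Word} (f : Diag R X Y) : Hom S X Y := Quotient.mk (setoid S X Y) f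

theorem sound {X Y : Word} {f g : Diag R X Y} (h : Equivalent S f g) : cls S f = cls S g :=
  Quotient.sound (s := setoid S X Y) h

theorem cls_surj {X Y : Word} (f : Hom S X Y) : ∃ f₀, cls S f₀ = f := Quotient.exists_rep f

instance (X Y : Word) : Add (Hom S X Y) :=
  ⟨Quotient.map₂ add fun _ _ h _ _ h' => Equivalent.add_congr h h'⟩

instance (X Y : Word) : Zero (Hom S X Y) := ⟨cls S zero⟩

instance (X Y : Word) : SMul R (Hom S X Y) :=
  ⟨fun r => Quotient.map (smul r) fun _ _ h => Equivalent.smul_congr r h⟩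

instance (X Y : Word) : Neg (Hom S X Y) := ⟨fun f => (-1 : R) • f⟩

/-- Vertical composition. -/
def hcomp {X Y Z : Word} : Hom S X Y → Hom S Y Z → Hom S X Z :=
  Quotient.map₂ comp fun _ _ h _ _ h' => Equivalent.comp_congr h h'

/-- Horizontal composition. -/
def htensor {X Y Z W : Word} : Hom S X Y → Hom S Z W → Hom S (X ++ Z) (Y ++ W) :=
  Quotient.map₂ tensor fun _ _ h _ _ h' => Equivalent.tensor_congr h h'

theorem cls_add {X Y : Word} (f g : Diag R X Y) : cls S (add f g) = cls S f + cls S g := rfl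
theorem cls_zero {X Y : Word} : cls S (zero : Diag R X Y) = 0 := rfl
theorem cls_smul {X Y : Word} (r : R) (f : Diag R X Y) : cls S (smul r f) = r • cls S f := rfl
theorem cls_comp {X Y Z : Word} (f : Diag R X Y) (g : Diag R Y Z) :
    cls S (comp f g) = hcomp (cls S f) (cls S g) := rfl
theorem cls_tensor {X Y Z W : Word} (f : Diag R X Y) (g : Diag R Z W) :
    cls S (tensor f g) = htensor (cls S f) (cls S g) := rfl

instance (X Y : Word) : AddCommGroup (Hom S X Y) where
  add_assoc f g h := by
    obtain ⟨f, rfl⟩ := cls_surj f; obtain ⟨g, rfl⟩ := cls_surj g; obtain ⟨h, rfl⟩ := cls_surj h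
    exact sound (.add_assoc f g h)
  add_comm f g := by
    obtain ⟨f, rfl⟩ := cls_surj f; obtain ⟨g, rfl⟩ := cls_surj g
    exact sound (.add_comm f g)
  zero_add f := by
    obtain ⟨f, rfl⟩ := cls_surj f
    exact sound (.zero_add f)
  add_zero f := by
    obtain ⟨f, rfl⟩ := cls_surj f
    exact sound ((Equivalent.add_comm f zero).trans (.zero_add f))
  neg_add_cancel f := by
    obtain ⟨f, rfl⟩ := cls_surj f
    refine sound (f := add (smul (-1) f) f) (g := zero) ?_
    refine ((Equivalent.refl _).add_congr (Equivalent.one_smul f).symm).trans ?_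
    refine (Equivalent.add_smul (-1) 1 f).symm.trans ?_
    rw [neg_add_cancel]
    exact .zero_smul f
  nsmul := nsmulRec
  zsmul := zsmulRec

instance (X Y : Word) : Module R (Hom S X Y) where
  one_smul f := by
    obtain ⟨f, rfl⟩ := cls_surj f
    exact sound (.one_smul f)
  zero_smul f := by
    obtain ⟨f, rfl⟩ := cls_surj f
    exact sound (.zero_smul f)
  mul_smul r s f := by
    obtain ⟨f, rfl⟩ := cls_surj f
    exact sound (.mul_smul r s f)
  add_smul r s f := by
    obtain ⟨f, rfl⟩ := cls_surj f
    exact sound (.add_smul r s f)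
  smul_add r f g := by
    obtain ⟨f, rfl⟩ := cls_surj f; obtain ⟨g, rfl⟩ := cls_surj g
    exact sound (.smul_add r f g)
  smul_zero r := by
    refine sound (f := smul r zero) (g := zero) ?_
    refine (Equivalent.smul_congr r (Equivalent.zero_smul zero).symm).trans ?_
    refine (Equivalent.mul_smul r 0 zero).symm.trans ?_
    rw [mul_zero]
    exact .zero_smul zero

instance : Category (Presented S) where
  Hom X Y := Hom S X.word Y.word
  id X := cls S (idd X.word)
  comp f g := hcomp f g
  id_comp f := by
    obtain ⟨f, rfl⟩ := cls_surj f
    exact sound (.id_comp f)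
  comp_id f := by
    obtain ⟨f, rfl⟩ := cls_surj f
    exact sound (.comp_id f)
  assoc f g h := by
    obtain ⟨f, rfl⟩ := cls_surj f; obtain ⟨g, rfl⟩ := cls_surj g; obtain ⟨h, rfl⟩ := cls_surj h
    exact sound (.comp_assoc f g h)

/-- The morphism represented by a diagram, as a morphism of the category. -/
def homMk (S : Relations R) {X Y : Word} (f : Diag R X Y) :
    (⟨X⟩ : Presented S) ⟶ (⟨Y⟩ : Presented S) := cls S f

instance : Preadditive (Presented S) where
  homGroup X Y := inferInstanceAs (AddCommGroup (Hom S X.word Y.word))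
  add_comp _ _ _ f f' g := by
    obtain ⟨f, rfl⟩ := cls_surj f; obtain ⟨f', rfl⟩ := cls_surj f'; obtain ⟨g, rfl⟩ := cls_surj g
    exact sound (.add_comp f f' g)
  comp_add _ _ _ f g g' := by
    obtain ⟨f, rfl⟩ := cls_surj f; obtain ⟨g, rfl⟩ := cls_surj g; obtain ⟨g', rfl⟩ := cls_surj g'
    exact sound (.comp_add f g g')

instance : Linear R (Presented S) where
  homModule X Y := inferInstanceAs (Module R (Hom S X.word Y.word))
  smul_comp _ _ _ r f g := by
    obtain ⟨f, rfl⟩ := cls_surj f; obtain ⟨g, rfl⟩ := cls_surj g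
    exact sound (.smul_comp r f g)
  comp_smul _ _ _ f r g := by
    obtain ⟨f, rfl⟩ := cls_surj f; obtain ⟨g, rfl⟩ := cls_surj g
    exact sound (.comp_smul r f g)

/-- The isomorphism between equal words. -/
def isoOfEq (S : Relations R) {X Y : Word} (h : X = Y) :
    (⟨X⟩ : Presented S) ≅ (⟨Y⟩ : Presented S) where
  hom := homMk S (eqHom h)
  inv := homMk S (eqHom h.symm)
  hom_inv_id := by subst h; exact Category.id_comp (𝟙 (⟨X⟩ : Presented S))
  inv_hom_id := by subst h; exact Category.id_comp (𝟙 (⟨X⟩ : Presented S))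

instance : MonoidalCategoryStruct (Presented S) where
  tensorObj X Y := ⟨X.word ++ Y.word⟩
  tensorUnit := ⟨[]⟩
  whiskerLeft X _ _ f := htensor (cls S (idd X.word)) f
  whiskerRight f Y := htensor f (cls S (idd Y.word))
  tensorHom f g := htensor f g
  associator X Y Z := isoOfEq S (List.append_assoc X.word Y.word Z.word)
  leftUnitor X := isoOfEq S (List.nil_append X.word)
  rightUnitor X := isoOfEq S (List.append_nil X.word)

theorem eqHom_comp {X Y Z : Word} (h : X = Y) (h' : Y = Z) :
    Equivalent S (comp (eqHom h) (eqHom h')) (eqHom (h.trans h')) := by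
  subst h; subst h'; exact .id_comp _

theorem eqHom_tensor {X Y Z W : Word} (h : X = Y) (h' : Z = W) :
    Equivalent S (tensor (eqHom h) (eqHom h')) (eqHom (by rw [h, h'])) := by
  subst h; subst h'; exact .tensor_id _ _

instance : MonoidalCategory (Presented S) :=
  MonoidalCategory.ofTensorHom
    (id_tensorHom_id := fun X Y => sound (.tensor_id X.word Y.word))
    (id_tensorHom := fun _ _ _ _ => rfl)
    (tensorHom_id := fun _ _ => rfl)
    (tensorHom_comp_tensorHom := fun f f' g g' => by
      obtain ⟨f, rfl⟩ := cls_surj f; obtain ⟨g, rfl⟩ := cls_surj g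
      obtain ⟨f', rfl⟩ := cls_surj f'; obtain ⟨g', rfl⟩ := cls_surj g'
      exact sound (.tensor_comp f g f' g'))
    (associator_naturality := fun f g h => by
      obtain ⟨f, rfl⟩ := cls_surj f; obtain ⟨g, rfl⟩ := cls_surj g; obtain ⟨h, rfl⟩ := cls_surj h
      exact sound (.tensor_assoc f g h))
    (leftUnitor_naturality := fun {X Y} f => by
      obtain ⟨f, rfl⟩ := cls_surj f
      refine sound (f := comp (tensor (idd []) f) (idd Y.word)) (g := comp (idd X.word) f) ?_
      exact (((Equivalent.comp_id _).trans (.unit_tensor f))).trans (Equivalent.id_comp f).symm)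
    (rightUnitor_naturality := fun f => by
      obtain ⟨f, rfl⟩ := cls_surj f
      exact sound (.tensor_unit f))
    (pentagon := fun X Y Z W => by
      refine sound (X := ((X.word ++ Y.word) ++ Z.word) ++ W.word)
        (Y := X.word ++ (Y.word ++ (Z.word ++ W.word)))
        (f := comp (tensor (eqHom (List.append_assoc _ _ _)) (idd W.word))
          (comp (eqHom (List.append_assoc _ _ _))
            (tensor (idd X.word) (eqHom (List.append_assoc _ _ _)))))
        (g := comp (eqHom (List.append_assoc _ _ _)) (eqHom (List.append_assoc _ _ _))) ?_
      refine (Equivalent.comp_congr (eqHom_tensor _ _)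
        ((Equivalent.comp_congr (.refl _) (eqHom_tensor _ _)).trans (eqHom_comp _ _))).trans ?_
      exact (eqHom_comp _ _).trans (eqHom_comp _ _).symm)
    (triangle := fun X Y => by
      refine sound (X := (X.word ++ []) ++ Y.word) (Y := X.word ++ Y.word)
        (f := comp (eqHom (List.append_assoc _ _ _))
          (tensor (idd X.word) (eqHom (List.nil_append Y.word))))
        (g := tensor (eqHom (List.append_nil X.word)) (idd Y.word)) ?_
      refine (Equivalent.comp_congr (.refl _) (eqHom_tensor _ _)).trans ?_
      exact (eqHom_comp _ _).trans (eqHom_tensor _ _).symm)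

instance : MonoidalPreadditive (Presented S) where
  whiskerLeft_zero {X Y Z} := by
    refine sound (f := tensor (idd X.word) zero) (g := zero) ?_
    refine (Equivalent.tensor_congr (.refl _) (Equivalent.zero_smul zero).symm).trans ?_
    exact (Equivalent.tensor_smul 0 _ _).trans (.zero_smul _)
  zero_whiskerRight {X Y Z} := by
    refine sound (f := tensor zero (idd X.word)) (g := zero) ?_
    refine (Equivalent.tensor_congr (Equivalent.zero_smul zero).symm (.refl _)).trans ?_
    exact (Equivalent.smul_tensor 0 _ _).trans (.zero_smul _)
  whiskerLeft_add f g := by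
    obtain ⟨f, rfl⟩ := cls_surj f; obtain ⟨g, rfl⟩ := cls_surj g
    exact sound (.tensor_add _ f g)
  add_whiskerRight f g := by
    obtain ⟨f, rfl⟩ := cls_surj f; obtain ⟨g, rfl⟩ := cls_surj g
    exact sound (.add_tensor f g _)

instance : MonoidalLinear R (Presented S) where
  whiskerLeft_smul _ _ _ r f := by
    obtain ⟨f, rfl⟩ := cls_surj f
    exact sound (.tensor_smul r _ f)
  smul_whiskerRight r _ _ f _ := by
    obtain ⟨f, rfl⟩ := cls_surj f
    exact sound (.smul_tensor r f _)

instance : BraidedCategory (Presented S) where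
  braiding X Y :=
    { hom := homMk S (braid X.word Y.word)
      inv := homMk S (braidInv X.word Y.word)
      hom_inv_id := sound (.braid_braidInv X.word Y.word)
      inv_hom_id := sound (.braidInv_braid X.word Y.word) }
  braiding_naturality_right X _ _ f := by
    obtain ⟨f, rfl⟩ := cls_surj f
    exact sound (.braid_naturality (idd X.word) f)
  braiding_naturality_left f Z := by
    obtain ⟨f, rfl⟩ := cls_surj f
    exact sound (.braid_naturality f (idd Z.word))
  hexagon_forward X Y Z := sound (.hexagon_forward X.word Y.word Z.word)
  hexagon_reverse X Y Z := sound (.hexagon_reverse X.word Y.word Z.word)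

end Presented

/-! ### Extension of scalars of a linear braided monoidal category -/

/-- The objects of the category obtained from the `R`-linear category `C` by extending the scalars
from `R` to the `R`-algebra `K`. -/
@[ext]
structure BaseChange (R : Type u) (K : Type v) [CommRing R] [CommRing K] [Algebra R K]
    (C : Type w) where
  obj : C

namespace BaseChange

universe v₁

variable {R : Type u} {K : Type v} [CommRing R] [CommRing K] [Algebra R K]
variable {C : Type w} [Category.{v₁} C] [Preadditive C] [Linear R C]

/-- Morphisms are `K ⊗[R] (X ⟶ Y)`. -/
def Hom (K : Type v) [CommRing K] [Algebra R K] (X Y : C) : Type max v v₁ := K ⊗[R] (X ⟶ Y)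

instance (X Y : C) : AddCommGroup (Hom (R := R) K X Y) :=
  inferInstanceAs (AddCommGroup (K ⊗[R] (X ⟶ Y)))

instance (X Y : C) : Module K (Hom (R := R) K X Y) :=
  inferInstanceAs (Module K (K ⊗[R] (X ⟶ Y)))

/-- Composition, `(s ⊗ f) ≫ (t ⊗ g) = (s * t) ⊗ (f ≫ g)`. -/
def bcomp (X Y Z : C) : K ⊗[R] (X ⟶ Y) →ₗ[R] K ⊗[R] (Y ⟶ Z) →ₗ[R] K ⊗[R] (X ⟶ Z) :=
  TensorProduct.map₂ (LinearMap.mul R K) (Linear.comp (S := R) X Y Z)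

@[simp]
theorem bcomp_tmul (X Y Z : C) (s t : K) (f : X ⟶ Y) (g : Y ⟶ Z) :
    bcomp X Y Z (s ⊗ₜ[R] f) (t ⊗ₜ[R] g) = (s * t) ⊗ₜ[R] (f ≫ g) := rfl

theorem bcomp_smul_left (X Y Z : C) (r : K) (f : K ⊗[R] (X ⟶ Y)) (g : K ⊗[R] (Y ⟶ Z)) :
    bcomp X Y Z (r • f) g = r • bcomp X Y Z f g := by
  induction f using TensorProduct.induction_on with
  | zero => simp
  | add f f' h h' => simp [h, h']
  | tmul s f =>
    induction g using TensorProduct.induction_on with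
    | zero => simp
    | add g g' h h' => simp [h, h']
    | tmul t g => simp [TensorProduct.smul_tmul', mul_assoc]

theorem bcomp_smul_right (X Y Z : C) (r : K) (f : K ⊗[R] (X ⟶ Y)) (g : K ⊗[R] (Y ⟶ Z)) :
    bcomp X Y Z f (r • g) = r • bcomp X Y Z f g := by
  induction f using TensorProduct.induction_on with
  | zero => simp
  | add f f' h h' => simp [h, h']
  | tmul s f =>
    induction g using TensorProduct.induction_on with
    | zero => simp
    | add g g' h h' => simp only [smul_add, map_add, h, h']
    | tmul t g => simp [TensorProduct.smul_tmul', mul_left_comm]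

instance : Category (BaseChange R K C) where
  Hom X Y := Hom (R := R) K X.obj Y.obj
  id X := (1 : K) ⊗ₜ[R] 𝟙 X.obj
  comp f g := bcomp _ _ _ f g
  id_comp {X Y} (f : K ⊗[R] _) := by
    change bcomp _ _ _ _ f = f
    induction f using TensorProduct.induction_on with
    | zero => simp
    | add f f' h h' => simp [h, h']
    | tmul s f => simp
  comp_id {X Y} (f : K ⊗[R] _) := by
    change bcomp _ _ _ f _ = f
    induction f using TensorProduct.induction_on with
    | zero => simp
    | add f f' h h' => simp [h, h']
    | tmul s f => simp
  assoc {X Y Z W} (f : K ⊗[R] _) (g : K ⊗[R] _) (h : K ⊗[R] _) := by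
    change bcomp _ _ _ (bcomp _ _ _ f g) h = bcomp _ _ _ f (bcomp _ _ _ g h)
    induction f using TensorProduct.induction_on with
    | zero => simp
    | add f f' i i' => simp [i, i']
    | tmul s f =>
      induction g using TensorProduct.induction_on with
      | zero => simp
      | add g g' i i' => simp [i, i']
      | tmul t g =>
        induction h using TensorProduct.induction_on with
        | zero => simp
        | add h h' i i' => simp only [map_add, i, i']
        | tmul u h => simp [mul_assoc]

/-- The morphism `1 ⊗ f`. -/
def ofHom (K : Type v) [CommRing K] [Algebra R K] {X Y : C} (f : X ⟶ Y) :
    (⟨X⟩ : BaseChange R K C) ⟶ ⟨Y⟩ := (1 : K) ⊗ₜ[R] f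

instance : Preadditive (BaseChange R K C) where
  homGroup X Y := inferInstanceAs (AddCommGroup (Hom (R := R) K X.obj Y.obj))
  add_comp X Y Z f f' g := LinearMap.map_add₂ (bcomp X.obj Y.obj Z.obj) f f' g
  comp_add X Y Z f g g' := (bcomp X.obj Y.obj Z.obj f).map_add g g'

instance : Linear K (BaseChange R K C) where
  homModule X Y := inferInstanceAs (Module K (Hom (R := R) K X.obj Y.obj))
  smul_comp _ _ _ r f g := bcomp_smul_left _ _ _ r f g
  comp_smul _ _ _ f r g := bcomp_smul_right _ _ _ r f g

/-- The image of an isomorphism of `C`. -/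
def ofIso (R : Type u) (K : Type v) [CommRing R] [CommRing K] [Algebra R K] [Linear R C]
    {X Y : C} (e : X ≅ Y) : (⟨X⟩ : BaseChange R K C) ≅ ⟨Y⟩ where
  hom := ofHom K e.hom
  inv := ofHom K e.inv
  hom_inv_id := by
    change bcomp _ _ _ (_ ⊗ₜ _) (_ ⊗ₜ _) = _ ⊗ₜ _
    simp
  inv_hom_id := by
    change bcomp _ _ _ (_ ⊗ₜ _) (_ ⊗ₜ _) = _ ⊗ₜ _
    simp

variable [MonoidalCategory C] [MonoidalPreadditive C] [MonoidalLinear R C]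

/-- The tensor product of morphisms of `C` as a bilinear map. -/
def tensorBilin (X Y X' Y' : C) : (X ⟶ Y) →ₗ[R] (X' ⟶ Y') →ₗ[R] (X ⊗ X' ⟶ Y ⊗ Y') :=
  LinearMap.mk₂ R (fun f g => f ⊗ₘ g)
    (fun f f' g => by simp [MonoidalCategory.tensorHom_def])
    (fun r f g => by simp [MonoidalCategory.tensorHom_def])
    (fun f g g' => by simp [MonoidalCategory.tensorHom_def])
    (fun r f g => by simp [MonoidalCategory.tensorHom_def])

/-- The tensor product of morphisms, `(s ⊗ f) ⊗ (t ⊗ g) = (s * t) ⊗ (f ⊗ g)`. -/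
def btensor (X Y X' Y' : C) :
    K ⊗[R] (X ⟶ Y) →ₗ[R] K ⊗[R] (X' ⟶ Y') →ₗ[R] K ⊗[R] (X ⊗ X' ⟶ Y ⊗ Y') :=
  TensorProduct.map₂ (LinearMap.mul R K) (tensorBilin X Y X' Y')

@[simp]
theorem btensor_tmul (X Y X' Y' : C) (s t : K) (f : X ⟶ Y) (g : X' ⟶ Y') :
    btensor X Y X' Y' (s ⊗ₜ[R] f) (t ⊗ₜ[R] g) = (s * t) ⊗ₜ[R] (f ⊗ₘ g) := rfl

theorem btensor_smul_left (X Y X' Y' : C) (r : K) (f : K ⊗[R] (X ⟶ Y)) (g : K ⊗[R] (X' ⟶ Y')) :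
    btensor X Y X' Y' (r • f) g = r • btensor X Y X' Y' f g := by
  induction f using TensorProduct.induction_on with
  | zero => simp
  | add f f' h h' => simp [h, h']
  | tmul s f =>
    induction g using TensorProduct.induction_on with
    | zero => simp
    | add g g' h h' => simp [h, h']
    | tmul t g => simp [TensorProduct.smul_tmul', mul_assoc]

theorem btensor_smul_right (X Y X' Y' : C) (r : K) (f : K ⊗[R] (X ⟶ Y)) (g : K ⊗[R] (X' ⟶ Y')) :
    btensor X Y X' Y' f (r • g) = r • btensor X Y X' Y' f g := by
  induction f using TensorProduct.induction_on with
  | zero => simp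
  | add f f' h h' => simp [h, h']
  | tmul s f =>
    induction g using TensorProduct.induction_on with
    | zero => simp
    | add g g' h h' => simp only [smul_add, map_add, h, h']
    | tmul t g => simp [TensorProduct.smul_tmul', mul_left_comm]

instance : MonoidalCategoryStruct (BaseChange R K C) where
  tensorObj X Y := ⟨X.obj ⊗ Y.obj⟩
  tensorUnit := ⟨𝟙_ C⟩
  whiskerLeft X _ _ f := btensor _ _ _ _ ((1 : K) ⊗ₜ[R] 𝟙 X.obj) f
  whiskerRight f Y := btensor _ _ _ _ f ((1 : K) ⊗ₜ[R] 𝟙 Y.obj)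
  tensorHom f g := btensor _ _ _ _ f g
  associator X Y Z := ofIso R K (α_ X.obj Y.obj Z.obj)
  leftUnitor X := ofIso R K (λ_ X.obj)
  rightUnitor X := ofIso R K (ρ_ X.obj)

instance : MonoidalCategory (BaseChange R K C) :=
  MonoidalCategory.ofTensorHom
    (id_tensorHom_id := fun X Y => by
      change btensor _ _ _ _ (_ ⊗ₜ _) (_ ⊗ₜ _) = _ ⊗ₜ _
      simp only [btensor_tmul, mul_one]
      exact congrArg (TensorProduct.tmul R (1 : K)) (id_tensorHom_id X.obj Y.obj))
    (id_tensorHom := fun _ _ _ _ => rfl)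
    (tensorHom_id := fun _ _ => rfl)
    (tensorHom_comp_tensorHom := fun {X Y Z X' Y' Z'} (f : K ⊗[R] _) (f' : K ⊗[R] _)
        (g : K ⊗[R] _) (g' : K ⊗[R] _) => by
      change bcomp _ _ _ (btensor _ _ _ _ f f') (btensor _ _ _ _ g g') =
        btensor _ _ _ _ (bcomp _ _ _ f g) (bcomp _ _ _ f' g')
      induction f using TensorProduct.induction_on with
      | zero => simp
      | add f₁ f₂ i i' => simp [i, i']
      | tmul s f =>
        induction g using TensorProduct.induction_on with
        | zero => simp
        | add g₁ g₂ i i' => simp [i, i']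
        | tmul t g =>
          induction f' using TensorProduct.induction_on with
          | zero => simp
          | add f₁ f₂ i i' => simp [i, i']
          | tmul s' f' =>
            induction g' using TensorProduct.induction_on with
            | zero => simp
            | add g₁ g₂ i i' => simp only [map_add, i, i']
            | tmul t' g' => simp [mul_mul_mul_comm])
    (associator_naturality := fun {X X' X'' Y Y' Y''} (f : K ⊗[R] _) (g : K ⊗[R] _)
        (h : K ⊗[R] _) => by
      change bcomp _ _ _ (btensor _ _ _ _ (btensor _ _ _ _ f g) h) ((1 : K) ⊗ₜ[R] (α_ _ _ _).hom) =
        bcomp _ _ _ ((1 : K) ⊗ₜ[R] (α_ _ _ _).hom) (btensor _ _ _ _ f (btensor _ _ _ _ g h))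
      induction f using TensorProduct.induction_on with
      | zero => simp
      | add f₁ f₂ i i' => simp [i, i']
      | tmul s f =>
        induction g using TensorProduct.induction_on with
        | zero => simp
        | add g₁ g₂ i i' => simp [i, i']
        | tmul t g =>
          induction h using TensorProduct.induction_on with
          | zero => simp
          | add h₁ h₂ i i' => simp only [map_add, LinearMap.add_apply, i, i']
          | tmul u h => simp [mul_assoc])
    (leftUnitor_naturality := fun {X Y} (f : K ⊗[R] _) => by
      change bcomp _ _ _ (btensor _ _ _ _ ((1 : K) ⊗ₜ[R] 𝟙 _) f) ((1 : K) ⊗ₜ[R] (λ_ _).hom) =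
        bcomp _ _ _ ((1 : K) ⊗ₜ[R] (λ_ _).hom) f
      induction f using TensorProduct.induction_on with
      | zero => simp
      | add f₁ f₂ i i' => simp only [map_add, LinearMap.add_apply, i, i']
      | tmul s f => simp)
    (rightUnitor_naturality := fun {X Y} (f : K ⊗[R] _) => by
      change bcomp _ _ _ (btensor _ _ _ _ f ((1 : K) ⊗ₜ[R] 𝟙 _)) ((1 : K) ⊗ₜ[R] (ρ_ _).hom) =
        bcomp _ _ _ ((1 : K) ⊗ₜ[R] (ρ_ _).hom) f
      induction f using TensorProduct.induction_on with
      | zero => simp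
      | add f₁ f₂ i i' => simp only [map_add, LinearMap.add_apply, i, i']
      | tmul s f => simp)
    (pentagon := fun W X Y Z => by
      change bcomp _ _ _ (btensor _ _ _ _ (_ ⊗ₜ _) (_ ⊗ₜ _))
        (bcomp _ _ _ (_ ⊗ₜ _) (btensor _ _ _ _ (_ ⊗ₜ _) (_ ⊗ₜ _))) =
        bcomp _ _ _ (_ ⊗ₜ _) (_ ⊗ₜ _)
      simp only [btensor_tmul, bcomp_tmul, mul_one, tensorHom_id, id_tensorHom]
      exact congrArg (TensorProduct.tmul R (1 : K))
        (MonoidalCategory.pentagon W.obj X.obj Y.obj Z.obj))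
    (triangle := fun X Y => by
      change bcomp _ _ _ (_ ⊗ₜ _) (btensor _ _ _ _ (_ ⊗ₜ _) (_ ⊗ₜ _)) =
        btensor _ _ _ _ (_ ⊗ₜ _) (_ ⊗ₜ _)
      simp only [btensor_tmul, bcomp_tmul, mul_one, tensorHom_id, id_tensorHom]
      exact congrArg (TensorProduct.tmul R (1 : K)) (MonoidalCategory.triangle X.obj Y.obj))

instance [BraidedCategory C] : BraidedCategory (BaseChange R K C) where
  braiding X Y := ofIso R K (β_ X.obj Y.obj)
  braiding_naturality_right X {Y Z} (f : K ⊗[R] _) := by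
    change bcomp _ _ _ (btensor _ _ _ _ ((1 : K) ⊗ₜ[R] 𝟙 _) f) ((1 : K) ⊗ₜ[R] (β_ _ _).hom) =
      bcomp _ _ _ ((1 : K) ⊗ₜ[R] (β_ _ _).hom) (btensor _ _ _ _ f ((1 : K) ⊗ₜ[R] 𝟙 _))
    induction f using TensorProduct.induction_on with
    | zero => simp
    | add f₁ f₂ i i' => simp only [map_add, LinearMap.add_apply, i, i']
    | tmul s f => simp
  braiding_naturality_left {X Y} (f : K ⊗[R] _) Z := by
    change bcomp _ _ _ (btensor _ _ _ _ f ((1 : K) ⊗ₜ[R] 𝟙 _)) ((1 : K) ⊗ₜ[R] (β_ _ _).hom) =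
      bcomp _ _ _ ((1 : K) ⊗ₜ[R] (β_ _ _).hom) (btensor _ _ _ _ ((1 : K) ⊗ₜ[R] 𝟙 _) f)
    induction f using TensorProduct.induction_on with
    | zero => simp
    | add f₁ f₂ i i' => simp only [map_add, LinearMap.add_apply, i, i']
    | tmul s f => simp
  hexagon_forward X Y Z := by
    change bcomp _ _ _ (_ ⊗ₜ _) (bcomp _ _ _ (_ ⊗ₜ _) (_ ⊗ₜ _)) =
      bcomp _ _ _ (btensor _ _ _ _ (_ ⊗ₜ _) (_ ⊗ₜ _))
        (bcomp _ _ _ (_ ⊗ₜ _) (btensor _ _ _ _ (_ ⊗ₜ _) (_ ⊗ₜ _)))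
    simp only [btensor_tmul, bcomp_tmul, mul_one, tensorHom_id, id_tensorHom]
    exact congrArg (TensorProduct.tmul R (1 : K))
      (BraidedCategory.hexagon_forward X.obj Y.obj Z.obj)
  hexagon_reverse X Y Z := by
    change bcomp _ _ _ (_ ⊗ₜ _) (bcomp _ _ _ (_ ⊗ₜ _) (_ ⊗ₜ _)) =
      bcomp _ _ _ (btensor _ _ _ _ (_ ⊗ₜ _) (_ ⊗ₜ _))
        (bcomp _ _ _ (_ ⊗ₜ _) (btensor _ _ _ _ (_ ⊗ₜ _) (_ ⊗ₜ _)))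
    simp only [btensor_tmul, bcomp_tmul, mul_one, tensorHom_id, id_tensorHom]
    exact congrArg (TensorProduct.tmul R (1 : K))
      (BraidedCategory.hexagon_reverse X.obj Y.obj Z.obj)

end BaseChange

/-! ### `q`-rational numbers -/

/-- The denominators decrease along the even continued fraction algorithm. -/
theorem den_next_lt (x : ℚ) (h : ¬ (x - (⌈x⌉ - 1 : ℤ))⁻¹ = ⌊(x - (⌈x⌉ - 1 : ℤ))⁻¹⌋) :
    ((x - (⌈x⌉ - 1 : ℤ))⁻¹ - ⌊(x - (⌈x⌉ - 1 : ℤ))⁻¹⌋)⁻¹.den < x.den := by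
  set z : ℚ := x - (⌈x⌉ - 1 : ℤ) with hz
  have hz0 : 0 < z := by
    have := Int.ceil_lt_add_one x
    rw [hz]; push_cast; linarith
  have hz1 : z ≤ 1 := by
    have := Int.le_ceil x
    rw [hz]; push_cast; linarith
  have hzden : z.den = x.den := by rw [hz, Rat.sub_intCast_den]
  set w : ℚ := z⁻¹ - ⌊z⁻¹⌋ with hw
  have hw0 : 0 < w := by
    have h₁ := Int.floor_le z⁻¹
    have h₂ : (⌊z⁻¹⌋ : ℚ) ≠ z⁻¹ := fun e => h e.symm
    have := lt_of_le_of_ne h₁ h₂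
    rw [hw]; linarith
  have hw1 : w < 1 := by
    have := Int.lt_floor_add_one z⁻¹
    rw [hw]; linarith
  have hwden : w.den = z⁻¹.den := by rw [hw, Rat.sub_intCast_den]
  have key : ∀ y : ℚ, 0 < y → (y⁻¹.den : ℤ) = y.num := fun y hy => by
    rw [Rat.den_inv_of_ne_zero hy.ne']
    exact Int.natAbs_of_nonneg (Rat.num_nonneg.2 hy.le)
  have h₁ : (w⁻¹.den : ℤ) = w.num := key w hw0
  have h₂ : (z⁻¹.den : ℤ) = z.num := key z hz0
  have h₃ : w.num < w.den := by
    have := (Rat.lt_iff w 1).1 hw1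
    simpa using this
  have h₄ : z.num ≤ z.den := by
    have := (Rat.le_iff z 1).1 hz1
    simpa using this
  omega

/-- The continued fraction expansion `[a₁, a₂, …, a₂ₘ]` of even length of a rational number, with
`a₂, …, a₂ₘ` positive, as the list of the pairs `(a₁, a₂), (a₃, a₄), …`. -/
def evenCF (x : ℚ) : List (ℤ × ℤ) :=
  if _h : (x - (⌈x⌉ - 1 : ℤ))⁻¹ = ⌊(x - (⌈x⌉ - 1 : ℤ))⁻¹⌋ then
    [(⌈x⌉ - 1, ⌊(x - (⌈x⌉ - 1 : ℤ))⁻¹⌋)]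
  else
    (⌈x⌉ - 1, ⌊(x - (⌈x⌉ - 1 : ℤ))⁻¹⌋) ::
      evenCF ((x - (⌈x⌉ - 1 : ℤ))⁻¹ - ⌊(x - (⌈x⌉ - 1 : ℤ))⁻¹⌋)⁻¹
termination_by x.den
decreasing_by exact den_next_lt x _h

open RatFunc in
/-- `{a} = (q ^ (2a) - 1) / (q ^ 2 - 1)` in `ℚ(q)`, for an integer `a`. -/
def qNum (a : ℤ) : RatFunc ℚ := ((X : RatFunc ℚ) ^ (2 * a) - 1) / ((X : RatFunc ℚ) ^ 2 - 1)

open RatFunc in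
/-- `{a}` with `q` replaced by `q⁻¹`. -/
def qNumInv (a : ℤ) : RatFunc ℚ :=
  ((X : RatFunc ℚ) ^ (-2 * a) - 1) / ((X : RatFunc ℚ) ^ (-2 : ℤ) - 1)

open RatFunc in
/-- The `q`-deformed continued fraction of even length with entries `(a₁, a₂), (a₃, a₄), …`. -/
def qCF : List (ℤ × ℤ) → RatFunc ℚ
  | [] => 0
  | [(a, b)] => qNum a + (X : RatFunc ℚ) ^ (2 * a) / qNumInv b
  | (a, b) :: t =>
      qNum a + (X : RatFunc ℚ) ^ (2 * a) / (qNumInv b + (X : RatFunc ℚ) ^ (-2 * b) / qCF t)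

/-- The `q`-rational `{x}`. -/
def qRat (x : ℚ) : RatFunc ℚ := qCF (evenCF x)

/-- `δ_x = {x} - {x - 1}`. -/
def qDelta (x : ℚ) : RatFunc ℚ := qRat x - qRat (x - 1)

/-- The `q`-binomial coefficient `{x choose k}` for rational `x`. -/
def qRatBinom (x : ℚ) (k : ℕ) : RatFunc ℚ :=
  (∏ j ∈ Finset.range k, qRat (x - j)) / ∏ j ∈ Finset.range k, qNum (j + 1)

/-! ### The universal web category -/

section Universal

open MvPolynomial in
/-- The ring `ℤ[q^{±1}, a^{±1}][(q - q⁻¹)⁻¹]`: the polynomial ring in `q` and `a` over the integers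
with `q`, `a` and `q ^ 2 - 1` inverted. -/
abbrev UnivRing : Type :=
  Localization.Away (X 0 * X 1 * (X 0 ^ 2 - 1) : MvPolynomial (Fin 2) ℤ)

theorem isUnit_univ : IsUnit (algebraMap (MvPolynomial (Fin 2) ℤ) UnivRing
    (MvPolynomial.X 0 * MvPolynomial.X 1 * (MvPolynomial.X 0 ^ 2 - 1))) :=
  IsLocalization.Away.algebraMap_isUnit _

theorem isUnit_univ_q :
    IsUnit (algebraMap (MvPolynomial (Fin 2) ℤ) UnivRing (MvPolynomial.X 0)) := by
  have h := isUnit_univ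
  rw [map_mul, map_mul] at h
  exact isUnit_of_mul_isUnit_left (isUnit_of_mul_isUnit_left h)

theorem isUnit_univ_a :
    IsUnit (algebraMap (MvPolynomial (Fin 2) ℤ) UnivRing (MvPolynomial.X 1)) := by
  have h := isUnit_univ
  rw [map_mul, map_mul] at h
  exact isUnit_of_mul_isUnit_right (isUnit_of_mul_isUnit_left h)

/-- The unit `q`. -/
def univQ : UnivRingˣ := isUnit_univ_q.unit

/-- The unit `a`. -/
def univA : UnivRingˣ := isUnit_univ_a.unit

/-- The universal web category `∞Web`: the `UnivRing`-linear braided pivotal category generated by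
webs, subject to the upward web relations and the circle, sideway digon and square relations. -/
abbrev InfWeb : Type :=
  Presented (R := UnivRing) fun X Y f g =>
    BasicRel univQ X Y f g ∨ UniversalRel univQ univA X Y f g

end Universal

/-! ### Specialization -/

section Specialization

variable {K : Type v} [CommRing K] [Algebra (RatFunc ℚ) K]

/-- The unit `q` of a `ℚ(q)`-algebra. -/
def qUnit (K : Type v) [CommRing K] [Algebra (RatFunc ℚ) K] : Kˣ :=
  Units.map (algebraMap (RatFunc ℚ) K).toMonoidHom (Units.mk0 RatFunc.X RatFunc.X_ne_zero)

/-- The unit `q ν δ_x`, where `ν ^ 2 δ_x = 1`. -/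
def aUnit (x : ℚ) (ν : K) (hν : ν ^ 2 * algebraMap (RatFunc ℚ) K (qDelta x) = 1) : Kˣ where
  val := (qUnit K : K) * ν * algebraMap (RatFunc ℚ) K (qDelta x)
  inv := ((qUnit K)⁻¹ : Kˣ) * ν
  val_inv := by
    linear_combination ((qUnit K : K) * ((qUnit K)⁻¹ : Kˣ)) * hν + (qUnit K).mul_inv
  inv_val := by
    linear_combination ((qUnit K : K) * ((qUnit K)⁻¹ : Kˣ)) * hν + (qUnit K).mul_inv

theorem isUnit_qUnit_sq_sub_one (K : Type v) [CommRing K] [Algebra (RatFunc ℚ) K] :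
    IsUnit ((qUnit K : K) ^ 2 - 1) := by
  have h : (RatFunc.X : RatFunc ℚ) ^ 2 - 1 ≠ 0 := by
    have h₀ : (RatFunc.X : RatFunc ℚ) ^ 2 - 1 =
        algebraMap (Polynomial ℚ) (RatFunc ℚ) (Polynomial.X ^ 2 - 1) := by
      simp [RatFunc.algebraMap_X]
    rw [h₀]
    refine RatFunc.algebraMap_ne_zero ?_
    intro h₁
    have := congrArg (Polynomial.eval 0) h₁
    simp at this
  have := (IsUnit.mk0 _ h).map (algebraMap (RatFunc ℚ) K)
  simpa [qUnit] using this

/-- The ring homomorphism `UnivRing → K` with `q ↦ q` and `a ↦ q ν δ_x`. -/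
def specialize (x : ℚ) (ν : K) (hν : ν ^ 2 * algebraMap (RatFunc ℚ) K (qDelta x) = 1) :
    UnivRing →+* K :=
  IsLocalization.Away.lift
    (MvPolynomial.X 0 * MvPolynomial.X 1 * (MvPolynomial.X 0 ^ 2 - 1) : MvPolynomial (Fin 2) ℤ)
    (g := MvPolynomial.eval₂Hom (Int.castRingHom K) ![(qUnit K : K), (aUnit x ν hν : K)])
    (by
      simp only [map_mul, map_sub, map_pow, map_one, MvPolynomial.eval₂Hom_X']
      exact ((qUnit K).isUnit.mul (aUnit x ν hν).isUnit).mul (isUnit_qUnit_sq_sub_one K))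

theorem specialize_q (x : ℚ) (ν : K) (hν : ν ^ 2 * algebraMap (RatFunc ℚ) K (qDelta x) = 1) :
    specialize x ν hν univQ = algebraMap (RatFunc ℚ) K RatFunc.X := by
  change specialize x ν hν (algebraMap _ _ _) = _
  rw [specialize, IsLocalization.Away.lift_eq]
  simp [qUnit]

theorem specialize_a (x : ℚ) (ν : K) (hν : ν ^ 2 * algebraMap (RatFunc ℚ) K (qDelta x) = 1) :
    specialize x ν hν univA =
      algebraMap (RatFunc ℚ) K RatFunc.X * ν * algebraMap (RatFunc ℚ) K (qDelta x) := by
  change specialize x ν hν (algebraMap _ _ _) = _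
  rw [specialize, IsLocalization.Away.lift_eq]
  simp [qUnit, aUnit]

/-- `K` as an algebra over the universal coefficient ring, with `a` acting as `q ν δ_x`. -/
abbrev specAlgebra (x : ℚ) (ν : K) (hν : ν ^ 2 * algebraMap (RatFunc ℚ) K (qDelta x) = 1) :
    Algebra UnivRing K := (specialize x ν hν).toAlgebra

/-- The category `xWeb`: the specialization of `∞Web` at `a = q ν δ_x`. -/
abbrev XWeb (x : ℚ) (ν : K) (hν : ν ^ 2 * algebraMap (RatFunc ℚ) K (qDelta x) = 1) : Type :=
  @BaseChange UnivRing K _ _ (specAlgebra x ν hν) InfWeb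

/-- A word as an object of `xWeb`. -/
abbrev XWeb.of (x : ℚ) (ν : K) (hν : ν ^ 2 * algebraMap (RatFunc ℚ) K (qDelta x) = 1)
    (X : Word) : XWeb x ν hν :=
  letI := specAlgebra x ν hν
  BaseChange.mk (Presented.mk X)

/-- The morphism of `xWeb` represented by a diagram over the universal coefficient ring. -/
def XWeb.ofDiag (x : ℚ) (ν : K) (hν : ν ^ 2 * algebraMap (RatFunc ℚ) K (qDelta x) = 1)
    {X Y : Word} (f : Diag UnivRing X Y) : XWeb.of x ν hν X ⟶ XWeb.of x ν hν Y :=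
  letI := specAlgebra x ν hν
  BaseChange.ofHom K (Presented.homMk _ f)

/-! ### The presentation -/

/-- The value `u_k = q ^ (k (k - 1)) ν ^ k {x choose k}` of the circle labelled `k`. -/
def circleValue (x : ℚ) (ν : K) (k : ℕ) : K :=
  (qUnit K : K) ^ (k * (k - 1)) * ν ^ k * algebraMap (RatFunc ℚ) K (qRatBinom x k)

/-- The quotient `u_(k + l) / u_k`, with the common factors `{x}, …, {x - k + 1}` cancelled, so that
it makes sense when they vanish. -/
def circleRatio (x : ℚ) (ν : K) (k l : ℕ) : K :=
  (qUnit K : K) ^ (l * (2 * k + l - 1)) * ν ^ l *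
    algebraMap (RatFunc ℚ) K
      ((∏ j ∈ Finset.range l, qRat (x - (k + j : ℕ))) / ∏ j ∈ Finset.range l, qNum ((k + j : ℕ) + 1))

theorem circleRatio_mul_circleValue (x : ℚ) (ν : K) (k l : ℕ) :
    circleRatio x ν k l * circleValue x ν k = circleValue x ν (k + l) := by
  have h : qRatBinom x (k + l) =
      ((∏ j ∈ Finset.range l, qRat (x - (k + j : ℕ))) /
        ∏ j ∈ Finset.range l, qNum ((k + j : ℕ) + 1)) * qRatBinom x k := by
    rw [qRatBinom, qRatBinom, Finset.prod_range_add, Finset.prod_range_add, mul_comm, div_mul_div_comm]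
    congr 1
    rw [mul_comm]
  have e : (k + l) * (k + l - 1) = l * (2 * k + l - 1) + k * (k - 1) := by
    rcases k with _ | k
    · simp
    · rcases l with _ | l
      · simp
      · have h₁ : k + 1 + (l + 1) - 1 = k + l + 1 := by omega
        have h₂ : 2 * (k + 1) + (l + 1) - 1 = 2 * k + l + 2 := by omega
        have h₃ : k + 1 - 1 = k := by omega
        rw [h₁, h₂, h₃]; ring
  rw [circleRatio, circleValue, circleValue, h, e, map_mul, pow_add, pow_add]
  ring

/-- The coefficient `q ^ (-k l) {k + l choose k} u_(k + l) / u_k` of the sideway digon with strand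
labelled `k` and loop labelled `l`. -/
def digonValue (x : ℚ) (ν : K) (k l : ℕ) : K :=
  ((qUnit K ^ (-((k : ℤ) * l)) : Kˣ) : K) * qBinom (qUnit K) (k + l) k * circleRatio x ν k l

/-- The coefficient `q ^ 2 ν {x - 2}` of the mixed square. -/
def squareValue (x : ℚ) (ν : K) : K :=
  (qUnit K : K) ^ 2 * ν * algebraMap (RatFunc ℚ) K (qRat (x - 2))

/-- The `K`-linear braided category of webs presented by the upward web relations, circle
evaluation, sideway digon removal and mixed square removal. -/
abbrev XWebPresented (x : ℚ) (ν : K) : Type :=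
  Presented (R := K) fun X Y f g =>
    BasicRel (qUnit K) X Y f g ∨
      MixedRel (circleValue x ν) (digonValue x ν) (squareValue x ν) X Y f g

/-- A word as an object of the presented category. -/
abbrev XWebPresented.of (x : ℚ) (ν : K) (X : Word) : XWebPresented x ν := Presented.mk X

/-- The morphism of the presented category represented by a diagram. -/
def XWebPresented.ofDiag (x : ℚ) (ν : K) {X Y : Word} (f : Diag K X Y) :
    XWebPresented.of x ν X ⟶ XWebPresented.of x ν Y := Presented.homMk _ f

end Specialization

end Web

end

/-!
Extension of scalars turns a presentation into the presentation with the specialized relations, so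
the point is that, over the upward relations, the universal relations with labels `1` and `2`
specialized at `a = q ν δ` are equivalent to the relations with arbitrary labels. The square switch
relation evaluates a loop labelled `1` on a strand labelled `k` by induction on `k`. Associativity
and cyclicity of the partial trace show that a loop labelled `l + 1` is, up to the factor `{l + 1}`,
a loop labelled `l` on the thicker strand nested with a loop labelled `1`; since `{l + 1}` is
invertible over `ℚ(q)`, this determines all sideway digons, and circles are the digons on the empty
strand. The coefficients agree because `{x} = 1 + q² {x - 1}`, which is what ties `a` to `{x}`.

Crossings between upward strands are webs by definition. Rotating them by cups and caps expresses
the crossings involving downward strands, hence the whole braiding, by webs.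
-/

noncomputable section

namespace Web

universe u u' v w

/-! ### Calculus of arrows in a strict monoidal category -/

/-- The arrows of a strict monoidal category, the product of `M` being the tensor product. Objects
are encoded by their identity arrows, and `comp f g` (first `f`, then `g`) is a total operation
of which only the values on composable arrows matter. -/
class MonoidalArrows (M : Type u) [Monoid M] where
  dom : M → M
  cod : M → M
  comp : M → M → M
  dom_dom (f : M) : dom (dom f) = dom f
  cod_dom (f : M) : cod (dom f) = dom f
  dom_cod (f : M) : dom (cod f) = cod f
  dom_one : dom 1 = 1
  dom_mul (f g : M) : dom (f * g) = dom f * dom g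
  cod_mul (f g : M) : cod (f * g) = cod f * cod g
  dom_comp (f g : M) : dom (comp f g) = dom f
  cod_comp (f g : M) : cod (comp f g) = cod g
  comp_assoc (f g h : M) : comp (comp f g) h = comp f (comp g h)
  dom_comp_self (f : M) : comp (dom f) f = f
  comp_cod_self (f : M) : comp f (cod f) = f
  mul_comp_mul (f f' g g' : M) (h : cod f = dom g) (h' : cod f' = dom g') :
    comp (f * f') (g * g') = comp f g * comp f' g'

namespace MonoidalArrows

attribute [simp] dom_dom cod_dom dom_cod dom_mul cod_mul dom_comp cod_comp

end MonoidalArrows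

open MonoidalArrows

infixr:67 "⊚" => MonoidalArrows.comp

/-- The arrow `X` is the identity of an object. -/
class IsObject {M : Type u} [Monoid M] [MonoidalArrows M] (X : M) : Prop where
  dom_eq_self : dom X = X

section Monoidal

variable {M : Type u} [Monoid M] [MonoidalArrows M]

@[simp] theorem dom_object (X : M) [h : IsObject X] : dom X = X := h.dom_eq_self

@[simp] theorem cod_object (X : M) [IsObject X] : cod X = X := by
  rw [← dom_object X, cod_dom]

instance : IsObject (1 : M) := ⟨dom_one⟩

instance (X Y : M) [IsObject X] [IsObject Y] : IsObject (X * Y) := ⟨by simp⟩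

theorem id_comp {X f : M} (h : dom f = X) : X ⊚ f = f := by rw [← h, dom_comp_self]

theorem comp_id {X f : M} (h : cod f = X) : f ⊚ X = f := by rw [← h, comp_cod_self]

theorem mul_comp (X : M) [IsObject X] {f g : M} (h : cod f = dom g) :
    X * (f ⊚ g) = (X * f) ⊚ (X * g) := by
  rw [mul_comp_mul _ _ _ _ (by simp) h, comp_id (cod_object X)]

theorem comp_mul (X : M) [IsObject X] {f g : M} (h : cod f = dom g) :
    (f ⊚ g) * X = (f * X) ⊚ (g * X) := by
  rw [mul_comp_mul _ _ _ _ h (by simp), comp_id (cod_object X)]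

theorem exchange {f g X Y X' Y' : M} (hX : dom f = X) (hY : cod f = Y) (hX' : dom g = X')
    (hY' : cod g = Y') : (f * X') ⊚ (Y * g) = (X * g) ⊚ (f * Y') := by
  subst hX hY hX' hY'
  rw [mul_comp_mul _ _ _ _ (by simp) (by simp), mul_comp_mul _ _ _ _ (by simp) (by simp),
    dom_comp_self, dom_comp_self, comp_cod_self, comp_cod_self]

theorem comp_comp_eq_of_comp_eq {f g k : M} (e : f ⊚ g = k) (h : M) : f ⊚ g ⊚ h = k ⊚ h := by
  rw [← comp_assoc, e]

theorem comp_eq_comp {f g f' g' : M} (e : f ⊚ g = f' ⊚ g') (h : M) :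
    f ⊚ g ⊚ h = f' ⊚ g' ⊚ h := by
  rw [← comp_assoc, e, comp_assoc]

open MulOpposite

/-- The mirror image in a vertical axis, which reverses the tensor product only. -/
instance : MonoidalArrows Mᵐᵒᵖ where
  dom f := op (dom f.unop)
  cod f := op (cod f.unop)
  comp f g := op (f.unop ⊚ g.unop)
  dom_dom f := by simp
  cod_dom f := by simp
  dom_cod f := by simp
  dom_one := by simp
  dom_mul f g := by simp
  cod_mul f g := by simp
  dom_comp f g := by simp
  cod_comp f g := by simp
  comp_assoc f g h := by simp [comp_assoc]
  dom_comp_self f := by simp [dom_comp_self]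
  comp_cod_self f := by simp [comp_cod_self]
  mul_comp_mul f f' g g' h h' :=
    congrArg op (mul_comp_mul _ _ _ _ (congrArg unop h') (congrArg unop h))

@[simp] theorem dom_op (f : M) : dom (op f) = op (dom f) := rfl

@[simp] theorem cod_op (f : M) : cod (op f) = op (cod f) := rfl

theorem op_comp (f g : M) : op (f ⊚ g) = op f ⊚ op g := rfl

instance (X : M) [IsObject X] : IsObject (op X) := ⟨by simp⟩

end Monoidal

/-- The arrows of an `R`-linear strict monoidal category; only sums of parallel arrows matter. -/
class LinearArrows (R : Type v) (M : Type u) [CommRing R] [Monoid M] [MonoidalArrows M] [Add M]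
    [MulAction R M] : Prop where
  dom_smul (r : R) (f : M) : dom (r • f) = dom f
  cod_smul (r : R) (f : M) : cod (r • f) = cod f
  smul_mul (r : R) (f g : M) : (r • f) * g = r • (f * g)
  mul_smul (r : R) (f g : M) : f * (r • g) = r • (f * g)
  smul_comp (r : R) (f g : M) : (r • f) ⊚ g = r • (f ⊚ g)
  comp_smul (r : R) (f g : M) : f ⊚ (r • g) = r • (f ⊚ g)
  add_smul (r s : R) (f : M) : (r + s) • f = r • f + s • f
  add_mul (f f' g : M) (hd : dom f = dom f') (hc : cod f = cod f') :
    (f + f') * g = f * g + f' * g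
  mul_add (f g g' : M) (hd : dom g = dom g') (hc : cod g = cod g') :
    f * (g + g') = f * g + f * g'
  add_comp (f f' g : M) (hd : dom f = dom f') (hc : cod f = cod f') (h : cod f = dom g) :
    (f + f') ⊚ g = f ⊚ g + f' ⊚ g
  comp_add (f g g' : M) (hd : dom g = dom g') (hc : cod g = cod g') (h : cod f = dom g) :
    f ⊚ (g + g') = f ⊚ g + f ⊚ g'

section Linear

variable {R : Type v} {M : Type u} [CommRing R] [Monoid M] [MonoidalArrows M] [Add M]
  [MulAction R M] [LinearArrows R M]

@[simp] theorem dom_smul (r : R) (f : M) : dom (r • f) = dom f := LinearArrows.dom_smul r f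

@[simp] theorem cod_smul (r : R) (f : M) : cod (r • f) = cod f := LinearArrows.cod_smul r f

open MulOpposite

instance : LinearArrows R Mᵐᵒᵖ where
  dom_smul r f := congrArg op (dom_smul r f.unop)
  cod_smul r f := congrArg op (cod_smul r f.unop)
  smul_mul r f g := congrArg op (LinearArrows.mul_smul r g.unop f.unop)
  mul_smul r f g := congrArg op (LinearArrows.smul_mul r g.unop f.unop)
  smul_comp r f g := congrArg op (LinearArrows.smul_comp r f.unop g.unop)
  comp_smul r f g := congrArg op (LinearArrows.comp_smul r f.unop g.unop)
  add_smul r s f := congrArg op (LinearArrows.add_smul r s f.unop)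
  add_mul f f' g hd hc :=
    congrArg op (LinearArrows.mul_add R g.unop f.unop f'.unop (op_injective hd) (op_injective hc))
  mul_add f g g' hd hc :=
    congrArg op (LinearArrows.add_mul R g.unop g'.unop f.unop (op_injective hd) (op_injective hc))
  add_comp f f' g hd hc h := congrArg op (LinearArrows.add_comp R f.unop f'.unop g.unop
    (op_injective hd) (op_injective hc) (op_injective h))
  comp_add f g g' hd hc h := congrArg op (LinearArrows.comp_add R f.unop g.unop g'.unop
    (op_injective hd) (op_injective hc) (op_injective h))

end Linear

/-! ### Duality, mates and partial traces -/

/-- Two-sided duality data for the object `left`, whose dual is `right`. -/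
@[ext]
structure Duality (M : Type u) [Monoid M] [MonoidalArrows M] where
  left : M
  right : M
  /-- `1 ⟶ left * right` -/
  cupR : M
  /-- `right * left ⟶ 1` -/
  capR : M
  /-- `1 ⟶ right * left` -/
  cupL : M
  /-- `left * right ⟶ 1` -/
  capL : M
  isObject_left : IsObject left
  isObject_right : IsObject right
  dom_cupR : dom cupR = 1
  cod_cupR : cod cupR = left * right
  dom_capR : dom capR = right * left
  cod_capR : cod capR = 1
  dom_cupL : dom cupL = 1
  cod_cupL : cod cupL = right * left
  dom_capL : dom capL = left * right
  cod_capL : cod capL = 1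
  zigzag_left_R : (cupR * left) ⊚ (left * capR) = left
  zigzag_right_R : (right * cupR) ⊚ (capR * right) = right
  zigzag_left_L : (left * cupL) ⊚ (capL * left) = left
  zigzag_right_L : (cupL * right) ⊚ (right * capL) = right

namespace Duality

variable {M : Type u} [Monoid M] [MonoidalArrows M]

attribute [instance] isObject_left isObject_right
attribute [simp] dom_cupR cod_cupR dom_capR cod_capR dom_cupL cod_cupL dom_capL cod_capL

open MulOpposite

/-- The mirror image of a duality. -/
@[simps left right cupR capR cupL capL]
def mirror (P : Duality M) : Duality Mᵐᵒᵖ where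
  left := op P.left
  right := op P.right
  cupR := op P.cupL
  capR := op P.capL
  cupL := op P.cupR
  capL := op P.capR
  isObject_left := inferInstance
  isObject_right := inferInstance
  dom_cupR := by simp
  cod_cupR := by simp
  dom_capR := by simp
  cod_capR := by simp
  dom_cupL := by simp
  cod_cupL := by simp
  dom_capL := by simp
  cod_capL := by simp
  zigzag_left_R := congrArg op P.zigzag_left_L
  zigzag_right_R := congrArg op P.zigzag_right_L
  zigzag_left_L := congrArg op P.zigzag_left_R
  zigzag_right_L := congrArg op P.zigzag_right_R

theorem zigzag_nested {A A' B B' cA eA cB eB : M} [IsObject A] [IsObject A'] [IsObject B]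
    [IsObject B'] (hcA : dom cA = 1) (hcA' : cod cA = A' * A) (heA : dom eA = A * A')
    (hcB' : cod cB = B' * B) (heB : dom eB = B * B') (heB' : cod eB = 1)
    (zA : (A * cA) ⊚ (eA * A) = A) (zB : (B * cB) ⊚ (eB * B) = B) :
    (A * B * (cB ⊚ (B' * cA * B))) ⊚ (((A * eB * A') ⊚ eA) * (A * B)) = A * B := by
  have swap : (A * B * (B' * cA * B)) ⊚ (A * eB * A' * (A * B)) =
      (A * eB * B) ⊚ (A * cA * B) := by
    have h : (B * B' * cA) ⊚ (eB * (A' * A)) = eB ⊚ cA := by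
      simpa using (exchange heB heB' hcA hcA').symm
    rw [← comp_mul _ (by simp [*]), ← mul_comp _ (by simp [*]), ← h, mul_comp _ (by simp [*]),
      comp_mul _ (by simp [*])]
    simp only [mul_assoc]
  have straightenB : (A * B * cB) ⊚ (A * eB * B) = A * B := by
    rw [mul_assoc, mul_assoc, ← mul_comp _ (by simp [*, mul_assoc]), zB]
  have straightenA : (A * cA * B) ⊚ (eA * (A * B)) = A * B := by
    rw [← mul_assoc, ← comp_mul _ (by simp [*, mul_assoc]), zA]
  rw [mul_comp _ (by simp [*, mul_assoc]), comp_mul _ (by simp [*, mul_assoc]), comp_assoc,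
    comp_eq_comp swap, comp_comp_eq_of_comp_eq straightenB, straightenA, id_comp (by simp)]

theorem zigzag_nested' {A A' B B' cA eA cB eB : M} [IsObject A] [IsObject A'] [IsObject B]
    [IsObject B'] (hcA' : cod cA = A * A') (heA : dom eA = A' * A) (heA' : cod eA = 1)
    (hcB : dom cB = 1) (hcB' : cod cB = B * B') (heB : dom eB = B' * B)
    (zA : (cA * A) ⊚ (A * eA) = A) (zB : (cB * B) ⊚ (B * eB) = B) :
    ((cA ⊚ (A * cB * A')) * (A * B)) ⊚ (A * B * ((B' * eA * B) ⊚ eB)) = A * B := by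
  have h := zigzag_nested (M := Mᵐᵒᵖ) (A := op B) (A' := op B') (B := op A) (B' := op A')
    (cA := op cB) (eA := op eB) (cB := op cA) (eB := op eA)
    (congrArg op hcB) (congrArg op hcB') (congrArg op heB) (congrArg op hcA') (congrArg op heA)
    (congrArg op heA') (congrArg op zB) (congrArg op zA)
  simpa only [← op_mul, ← op_comp, op_inj, mul_assoc] using h

/-- The dual of a tensor product, with nested cups and caps. -/
@[simps left right cupR capR cupL capL]
def tensor (P Q : Duality M) : Duality M where
  left := P.left * Q.left
  right := Q.right * P.right
  cupR := P.cupR ⊚ (P.left * Q.cupR * P.right)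
  capR := (Q.right * P.capR * Q.left) ⊚ Q.capR
  cupL := Q.cupL ⊚ (Q.right * P.cupL * Q.left)
  capL := (P.left * Q.capL * P.right) ⊚ P.capL
  isObject_left := inferInstance
  isObject_right := inferInstance
  dom_cupR := by simp
  cod_cupR := by simp [mul_assoc]
  dom_capR := by simp [mul_assoc]
  cod_capR := by simp
  dom_cupL := by simp
  cod_cupL := by simp [mul_assoc]
  dom_capL := by simp [mul_assoc]
  cod_capL := by simp
  zigzag_left_R := zigzag_nested' (by simp) (by simp) (by simp) (by simp) (by simp) (by simp)
    P.zigzag_left_R Q.zigzag_left_R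
  zigzag_right_R := zigzag_nested (by simp) (by simp) (by simp) (by simp) (by simp) (by simp)
    Q.zigzag_right_R P.zigzag_right_R
  zigzag_left_L := zigzag_nested (by simp) (by simp) (by simp) (by simp) (by simp) (by simp)
    P.zigzag_left_L Q.zigzag_left_L
  zigzag_right_L := zigzag_nested' (by simp) (by simp) (by simp) (by simp) (by simp) (by simp)
    Q.zigzag_right_L P.zigzag_right_L

theorem mirror_tensor (P Q : Duality M) : (P.tensor Q).mirror = Q.mirror.tensor P.mirror := by
  ext <;> simp only [mirror_left, mirror_right, mirror_cupR, mirror_capR, mirror_cupL,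
    mirror_capL, tensor_left, tensor_right, tensor_cupR, tensor_capR, tensor_cupL, tensor_capL,
    op_mul, op_comp, mul_assoc]

/-- The mate `Q.right ⟶ P.right` of `t : P.left ⟶ Q.left`, rotated through `cupR` and `capR`. -/
def mateR (P Q : Duality M) (t : M) : M :=
  (Q.right * P.cupR) ⊚ (Q.right * t * P.right) ⊚ (Q.capR * P.right)

/-- The mate `Q.right ⟶ P.right` of `t : P.left ⟶ Q.left`, rotated through `cupL` and `capL`. -/
def mateL (P Q : Duality M) (t : M) : M :=
  (P.cupL * Q.right) ⊚ (P.right * t * Q.right) ⊚ (P.right * Q.capL)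

theorem op_mateL (P Q : Duality M) (t : M) :
    op (mateL P Q t) = mateR P.mirror Q.mirror (op t) := by
  simp only [mateL, mateR, op_comp, op_mul, mirror_right, mirror_cupR, mirror_capR, mul_assoc]

theorem op_mateR (P Q : Duality M) (t : M) :
    op (mateR P Q t) = mateL P.mirror Q.mirror (op t) := by
  simp only [mateL, mateR, op_comp, op_mul, mirror_right, mirror_cupL, mirror_capL, mul_assoc]

variable {P Q : Duality M} {t : M}

theorem cupR_comp_mateR (hd : dom t = P.left) (hc : cod t = Q.left) :
    Q.cupR ⊚ (Q.left * mateR P Q t) = P.cupR ⊚ (t * P.right) := by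
  rw [mateR, mul_comp _ (by simp [*, mul_assoc]), mul_comp _ (by simp [*, mul_assoc])]
  simp only [← mul_assoc]
  have slide_cup : Q.cupR ⊚ (Q.left * Q.right * P.cupR) =
      P.cupR ⊚ (Q.cupR * (P.left * P.right)) := by
    simpa using exchange Q.dom_cupR Q.cod_cupR P.dom_cupR P.cod_cupR
  have slide_arrow : (Q.cupR * (P.left * P.right)) ⊚ (Q.left * Q.right * t * P.right) =
      (t * P.right) ⊚ (Q.cupR * (Q.left * P.right)) := by
    simpa [mul_assoc] using exchange (g := t * P.right) (X' := P.left * P.right)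
      (Y' := Q.left * P.right) Q.dom_cupR Q.cod_cupR (by simp [hd]) (by simp [hc])
  have straighten : (Q.cupR * (Q.left * P.right)) ⊚ (Q.left * Q.capR * P.right) =
      Q.left * P.right := by
    rw [← mul_assoc, ← comp_mul _ (by simp [mul_assoc]), Q.zigzag_left_R]
  rw [comp_eq_comp slide_cup, comp_eq_comp slide_arrow, straighten,
    comp_id (f := t * P.right) (by simp [hc])]

theorem mateL_comp_capL (hd : dom t = P.left) (hc : cod t = Q.left) :
    (P.left * mateL P Q t) ⊚ P.capL = (t * Q.right) ⊚ Q.capL := by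
  rw [mateL, mul_comp _ (by simp [*, mul_assoc]), mul_comp _ (by simp [*, mul_assoc])]
  simp only [← mul_assoc, comp_assoc]
  have slide_cap : (P.left * P.right * Q.capL) ⊚ P.capL =
      (P.capL * (Q.left * Q.right)) ⊚ Q.capL := by
    simpa using (exchange P.dom_capL P.cod_capL Q.dom_capL Q.cod_capL).symm
  have slide_arrow : (P.left * P.right * t * Q.right) ⊚ (P.capL * (Q.left * Q.right)) =
      (P.capL * (P.left * Q.right)) ⊚ (t * Q.right) := by
    simpa [mul_assoc] using (exchange (g := t * Q.right) (X' := P.left * Q.right)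
      (Y' := Q.left * Q.right) P.dom_capL P.cod_capL (by simp [hd]) (by simp [hc])).symm
  have straighten : (P.left * P.cupL * Q.right) ⊚ (P.capL * (P.left * Q.right)) =
      P.left * Q.right := by
    rw [← mul_assoc, ← comp_mul _ (by simp [mul_assoc]), P.zigzag_left_L]
  rw [slide_cap, comp_eq_comp slide_arrow, comp_comp_eq_of_comp_eq straighten,
    id_comp (by simp [hd])]

/-- The closure on the right of the strand `P.left` in `f : X * P.left ⟶ Y * P.left`. -/
def ptrace (P : Duality M) (X Y f : M) : M := (X * P.cupR) ⊚ (f * P.right) ⊚ (Y * P.capL)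

theorem ptrace_comp {X Y X' Y' s f t : M} (hsd : dom s = X) (hsc : cod s = X')
    (hfd : dom f = X' * P.left) (hfc : cod f = Y' * P.left) (htd : dom t = Y') (htc : cod t = Y) :
    P.ptrace X Y ((s * P.left) ⊚ f ⊚ (t * P.left)) = s ⊚ P.ptrace X' Y' f ⊚ t := by
  have slide_cup : (X * P.cupR) ⊚ (s * (P.left * P.right)) = s ⊚ (X' * P.cupR) := by
    simpa using (exchange hsd hsc P.dom_cupR P.cod_cupR).symm
  have slide_cap : (t * (P.left * P.right)) ⊚ (Y * P.capL) = (Y' * P.capL) ⊚ t := by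
    simpa using exchange htd htc P.dom_capL P.cod_capL
  rw [ptrace, comp_mul _ (by simp [*]), comp_mul _ (by simp [*]), mul_assoc, mul_assoc,
    comp_assoc, comp_assoc, slide_cap, comp_eq_comp slide_cup]
  simp only [ptrace, comp_assoc]

variable {X Y : M} [IsObject X] [IsObject Y]

theorem ptrace_cyclic (hd : dom t = P.left) (hc : cod t = Q.left)
    (mate : mateR P Q t = mateL P Q t) {g : M} (hgd : dom g = X * Q.left)
    (hgc : cod g = Y * P.left) :
    Q.ptrace X Y (g ⊚ (Y * t)) = P.ptrace X Y ((X * t) ⊚ g) := by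
  have hrd : dom (mateR P Q t) = Q.right := by simp [mateR]
  have hrc : cod (mateR P Q t) = P.right := by simp [mateR]
  have cup := cupR_comp_mateR hd hc
  have cap : (P.left * mateR P Q t) ⊚ P.capL = (t * Q.right) ⊚ Q.capL := by
    rw [mate, mateL_comp_capL hd hc]
  clear mate
  calc Q.ptrace X Y (g ⊚ (Y * t))
      = (X * Q.cupR) ⊚ (g * Q.right) ⊚ (Y * ((t * Q.right) ⊚ Q.capL)) := by
        rw [ptrace, comp_mul _ (by simp [*]), comp_assoc, mul_comp _ (by simp [*]), mul_assoc Y]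
    _ = (X * Q.cupR) ⊚ (g * Q.right) ⊚ (Y * P.left * mateR P Q t) ⊚ (Y * P.capL) := by
        rw [← cap, mul_comp _ (by simp [*]), ← mul_assoc Y]
    _ = (X * (Q.cupR ⊚ (Q.left * mateR P Q t))) ⊚ (g * P.right) ⊚ (Y * P.capL) := by
        rw [comp_eq_comp (exchange hgd hgc hrd hrc), mul_comp _ (by simp [*]), comp_assoc,
          mul_assoc X]
    _ = P.ptrace X Y ((X * t) ⊚ g) := by
        rw [cup, ptrace, mul_comp _ (by simp [*]), comp_mul _ (by simp [*]), comp_assoc,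
          comp_assoc, mul_assoc X]

theorem ptrace_mul {f : M} (Z : M) [IsObject Z] (hfd : dom f = X * P.left)
    (hfc : cod f = Y * P.left) : P.ptrace (Z * X) (Z * Y) (Z * f) = Z * P.ptrace X Y f := by
  rw [ptrace, ptrace, mul_comp _ (by simp [*, mul_assoc]), mul_comp _ (by simp [*, mul_assoc])]
  simp only [mul_assoc]

theorem ptrace_tensor {f : M} (hfd : dom f = X * (P.left * Q.left))
    (hfc : cod f = Y * (P.left * Q.left)) :
    (P.tensor Q).ptrace X Y f = P.ptrace X Y (Q.ptrace (X * P.left) (Y * P.left) f) := by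
  rw [ptrace, ptrace, ptrace, comp_mul _ (by simp [*, mul_assoc]),
    comp_mul _ (by simp [*, mul_assoc]), tensor_cupR, tensor_capL, mul_comp _ (by simp [mul_assoc]),
    mul_comp _ (by simp [mul_assoc])]
  simp only [tensor_right, comp_assoc, mul_assoc]

section Linear

variable {R : Type v} [CommRing R] [Add M] [MulAction R M] [LinearArrows R M]

theorem ptrace_add_smul (r : R) {f g : M} (hfd : dom f = X * P.left) (hfc : cod f = Y * P.left)
    (hgd : dom g = X * P.left) (hgc : cod g = Y * P.left) :
    P.ptrace X Y (f + r • g) = P.ptrace X Y f + r • P.ptrace X Y g := by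
  rw [ptrace, LinearArrows.add_mul R _ _ _ (by simp [*]) (by simp [*]),
    LinearArrows.add_comp R _ _ _ (by simp [*]) (by simp [*]) (by simp [*, mul_assoc]),
    LinearArrows.comp_add R _ _ _ (by simp [*]) (by simp [*]) (by simp [*, mul_assoc]),
    LinearArrows.smul_mul, LinearArrows.smul_comp, LinearArrows.comp_smul, ← ptrace, ← ptrace]

theorem ptrace_id {γ : R} (h : P.cupR ⊚ P.capL = γ • 1) :
    P.ptrace X X (X * P.left) = γ • X := by
  rw [ptrace, mul_assoc, id_comp (f := X * P.capL) (by simp), ← mul_comp _ (by simp), h,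
    LinearArrows.mul_smul, mul_one]

end Linear

end Duality

namespace Duality

variable {M : Type u} [Monoid M] [MonoidalArrows M]

/-- The duality of the unit object with itself. -/
@[simps left right cupR capR cupL capL]
def unit (M : Type u) [Monoid M] [MonoidalArrows M] : Duality M where
  left := 1
  right := 1
  cupR := 1
  capR := 1
  cupL := 1
  capL := 1
  isObject_left := inferInstance
  isObject_right := inferInstance
  dom_cupR := by simp
  cod_cupR := by simp
  dom_capR := by simp
  cod_capR := by simp
  dom_cupL := by simp
  cod_cupL := by simp
  dom_capL := by simp
  cod_capL := by simp
  zigzag_left_R := by simp [id_comp]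
  zigzag_right_R := by simp [id_comp]
  zigzag_left_L := by simp [id_comp]
  zigzag_right_L := by simp [id_comp]

end Duality

/-! ### Sideway digons -/

/-- Upward strands with merges and splits subject to the part of the upward relations that
involves a strand labelled `1`. -/
structure WebCalculus {R : Type v} [CommRing R] (q : Rˣ) (M : Type u) [Monoid M]
    [MonoidalArrows M] [Add M] [MulAction R M] where
  dual : ℕ → Duality M
  merge : ℕ → ℕ → M
  split : ℕ → ℕ → M
  dual_zero : dual 0 = Duality.unit M
  dom_merge (k l : ℕ) : dom (merge k l) = (dual k).left * (dual l).left
  cod_merge (k l : ℕ) : cod (merge k l) = (dual (k + l)).left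
  dom_split (k l : ℕ) : dom (split k l) = (dual (k + l)).left
  cod_split (k l : ℕ) : cod (split k l) = (dual k).left * (dual l).left
  merge_zero_left (l : ℕ) : merge 0 l = (dual l).left
  merge_zero_right (k : ℕ) : merge k 0 = (dual k).left
  split_zero_left (l : ℕ) : split 0 l = (dual l).left
  split_zero_right (k : ℕ) : split k 0 = (dual k).left
  merge_rot (k l : ℕ) :
    Duality.mateR ((dual k).tensor (dual l)) (dual (k + l)) (merge k l) =
      Duality.mateL ((dual k).tensor (dual l)) (dual (k + l)) (merge k l)
  merge_assoc (k l r : ℕ) :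
    (merge k l * (dual r).left) ⊚ merge (k + l) r = ((dual k).left * merge l r) ⊚ merge k (l + r)
  split_assoc (k l r : ℕ) :
    split (k + l) r ⊚ (split k l * (dual r).left) = split k (l + r) ⊚ ((dual k).left * split l r)
  split_comp_merge_one_right (m : ℕ) :
    split m 1 ⊚ merge m 1 = (((q ^ (-m : ℤ) : Rˣ) : R) * qInt q (m + 1)) • (dual (m + 1)).left
  split_comp_merge_one_left (m : ℕ) :
    split 1 m ⊚ merge 1 m = (((q ^ (-m : ℤ) : Rˣ) : R) * qInt q (m + 1)) • (dual (m + 1)).left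
  merge_comp_split_one_right (m : ℕ) :
    merge (m + 1) 1 ⊚ split (m + 1) 1 =
      (split m 1 * (dual 1).left) ⊚ ((dual m).left * (merge 1 1 ⊚ split 1 1)) ⊚
          (merge m 1 * (dual 1).left) +
        (-(((q ^ (1 - m : ℤ) : Rˣ) : R) * qInt q m)) • ((dual (m + 1)).left * (dual 1).left)
  merge_comp_split_one_left (m : ℕ) :
    merge 1 (m + 1) ⊚ split 1 (m + 1) =
      ((dual 1).left * split 1 m) ⊚ ((merge 1 1 ⊚ split 1 1) * (dual m).left) ⊚
          ((dual 1).left * merge 1 m) +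
        (-(((q ^ (1 - m : ℤ) : Rˣ) : R) * qInt q m)) • ((dual 1).left * (dual (m + 1)).left)

namespace WebCalculus

variable {R : Type v} [CommRing R] {q : Rˣ} {M : Type u} [Monoid M] [MonoidalArrows M] [Add M]
  [MulAction R M] (W : WebCalculus q M)

attribute [simp] dom_merge cod_merge dom_split cod_split

/-- The upward strand labelled `k`. -/
abbrev up (k : ℕ) : M := (W.dual k).left

theorem up_zero : W.up 0 = 1 := by rw [up, W.dual_zero, Duality.unit_left]

open MulOpposite

/-- The mirror image of a web calculus. -/
@[simps dual merge split]
def mirror : WebCalculus q Mᵐᵒᵖ where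
  dual k := (W.dual k).mirror
  merge k l := op (W.merge l k)
  split k l := op (W.split l k)
  dual_zero := by rw [W.dual_zero]; rfl
  dom_merge k l := by simp
  cod_merge k l := by simp [add_comm l k]
  dom_split k l := by simp [add_comm l k]
  cod_split k l := by simp
  merge_zero_left l := congrArg op (W.merge_zero_right l)
  merge_zero_right k := congrArg op (W.merge_zero_left k)
  split_zero_left l := congrArg op (W.split_zero_right l)
  split_zero_right k := congrArg op (W.split_zero_left k)
  merge_rot k l := by
    rw [← Duality.mirror_tensor, ← Duality.op_mateL, ← Duality.op_mateR, add_comm k l,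
      W.merge_rot]
  merge_assoc k l r := by
    rw [add_comm k l, add_comm l r]
    exact congrArg op (W.merge_assoc r l k).symm
  split_assoc k l r := by
    rw [add_comm k l, add_comm l r]
    exact congrArg op (W.split_assoc r l k).symm
  split_comp_merge_one_right m := congrArg op (W.split_comp_merge_one_left m)
  split_comp_merge_one_left m := congrArg op (W.split_comp_merge_one_right m)
  merge_comp_split_one_right m := congrArg op (W.merge_comp_split_one_left m)
  merge_comp_split_one_left m := congrArg op (W.merge_comp_split_one_right m)

/-- The upward strand labelled `k` with a loop labelled `l` attached on its right. -/
def digonR (k l : ℕ) : M := (W.dual l).ptrace (W.up k) (W.up k) (W.merge k l ⊚ W.split k l)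

/-- The upward strand labelled `k` with a loop labelled `l` attached on its left. -/
def digonL (k l : ℕ) : M :=
  ((W.dual l).cupL * W.up k) ⊚ ((W.dual l).right * (W.merge l k ⊚ W.split l k)) ⊚
    ((W.dual l).capR * W.up k)

theorem mirror_digonR (k l : ℕ) : W.mirror.digonR k l = op (W.digonL k l) := rfl

theorem digonR_zero_left (l : ℕ) : W.digonR 0 l = (W.dual l).cupR ⊚ (W.dual l).capL := by
  rw [digonR, Duality.ptrace, W.merge_zero_left, W.split_zero_left, W.up_zero, one_mul, one_mul,
    id_comp (dom_object (W.up l)), id_comp (X := W.up l * (W.dual l).right) (by simp)]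

theorem digonL_zero_left (l : ℕ) : W.digonL 0 l = (W.dual l).cupL ⊚ (W.dual l).capR :=
  op_injective (W.mirror.digonR_zero_left l)

theorem digonR_zero_right (k : ℕ) : W.digonR k 0 = W.up k := by
  simp only [digonR, Duality.ptrace, W.merge_zero_right, W.split_zero_right, W.dual_zero,
    Duality.unit_cupR, Duality.unit_capL, Duality.unit_right, mul_one, comp_id, cod_object]

variable [LinearArrows R M]

theorem digonR_succ_one {α γ : R} (hα : W.digonR 1 1 = α • W.up 1) (hγ : W.digonR 0 1 = γ • 1)
    (m : ℕ) :
    W.digonR (m + 1) 1 =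
      (α * (((q ^ (-m : ℤ) : Rˣ) : R) * qInt q (m + 1)) -
        ((q ^ (1 - m : ℤ) : Rˣ) : R) * qInt q m * γ) • W.up (m + 1) := by
  rw [digonR_zero_left] at hγ
  have inner : (W.dual 1).ptrace (W.up m * W.up 1) (W.up m * W.up 1)
      (W.up m * (W.merge 1 1 ⊚ W.split 1 1)) = α • (W.up m * W.up 1) := by
    rw [Duality.ptrace_mul _ (by simp) (by simp), ← digonR, hα, LinearArrows.mul_smul]
  rw [digonR, W.merge_comp_split_one_right, Duality.ptrace_add_smul _ (by simp) (by simp)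
    (by simp) (by simp), Duality.ptrace_id hγ,
    Duality.ptrace_comp (X' := W.up m * W.up 1) (Y' := W.up m * W.up 1) (by simp) (by simp)
      (by simp [mul_assoc]) (by simp [mul_assoc]) (by simp) (by simp),
    inner, LinearArrows.smul_comp, LinearArrows.comp_smul, id_comp (f := W.merge m 1) (by simp),
    W.split_comp_merge_one_right, smul_smul, smul_smul, ← LinearArrows.add_smul, neg_mul,
    ← sub_eq_add_neg]

theorem smul_digonR_succ {β : R} (k l : ℕ) (hβ : W.digonR (k + l) 1 = β • W.up (k + l)) :
    (((q ^ (-l : ℤ) : Rˣ) : R) * qInt q (l + 1)) • W.digonR k (l + 1) = β • W.digonR k l := by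
  set g := W.merge k (l + 1) ⊚ W.split k (l + 1) ⊚ (W.up k * W.split l 1) with hg
  have bubble : g ⊚ (W.up k * W.merge l 1) =
      (((q ^ (-l : ℤ) : Rˣ) : R) * qInt q (l + 1)) •
        (W.merge k (l + 1) ⊚ W.split k (l + 1)) := by
    rw [hg, comp_assoc, comp_assoc, ← mul_comp _ (by simp), W.split_comp_merge_one_right,
      LinearArrows.mul_smul, LinearArrows.comp_smul, LinearArrows.comp_smul,
      comp_id (f := W.split k (l + 1)) (by simp)]
  have reassociate : (W.up k * W.merge l 1) ⊚ g = (W.merge k l * W.up 1) ⊚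
      (W.merge (k + l) 1 ⊚ W.split (k + l) 1) ⊚ (W.split k l * W.up 1) := by
    rw [hg, ← comp_assoc, ← W.merge_assoc, ← W.split_assoc]
    simp only [comp_assoc]
  have removeInner : (W.dual 1).ptrace (W.up k * W.up l) (W.up k * W.up l)
      ((W.up k * W.merge l 1) ⊚ g) = β • (W.merge k l ⊚ W.split k l) := by
    rw [reassociate, Duality.ptrace_comp (X' := W.up (k + l)) (Y' := W.up (k + l)) (by simp)
      (by simp) (by simp) (by simp) (by simp) (by simp), ← digonR, hβ, LinearArrows.smul_comp,
      LinearArrows.comp_smul, id_comp (f := W.split k l) (by simp)]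
  calc (((q ^ (-l : ℤ) : Rˣ) : R) * qInt q (l + 1)) • W.digonR k (l + 1)
      = (W.dual (l + 1)).ptrace (W.up k) (W.up k) (g ⊚ (W.up k * W.merge l 1)) := by
        rw [bubble, digonR, Duality.ptrace, Duality.ptrace, LinearArrows.smul_mul,
          LinearArrows.smul_comp, LinearArrows.comp_smul]
    _ = ((W.dual l).tensor (W.dual 1)).ptrace (W.up k) (W.up k) ((W.up k * W.merge l 1) ⊚ g) :=
        Duality.ptrace_cyclic (by simp) (by simp) (W.merge_rot l 1) (by simp [hg]) (by simp [hg])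
    _ = (W.dual l).ptrace (W.up k) (W.up k) (β • (W.merge k l ⊚ W.split k l)) := by
        rw [Duality.ptrace_tensor (by simp) (by simp [hg]), removeInner]
    _ = β • W.digonR k l := by
        rw [digonR, Duality.ptrace, Duality.ptrace, LinearArrows.smul_mul,
          LinearArrows.smul_comp, LinearArrows.comp_smul]

theorem digonR_eq_smul {β : ℕ → R} {d : ℕ → ℕ → R} (hβ : ∀ k, W.digonR k 1 = β k • W.up k)
    (hunit : ∀ l : ℕ, IsUnit (qInt q (l + 1))) (hd_zero : ∀ k, d k 0 = 1)
    (hd_succ : ∀ k l : ℕ,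
      ((q ^ (-l : ℤ) : Rˣ) : R) * qInt q (l + 1) * d k (l + 1) = β (k + l) * d k l)
    (k l : ℕ) : W.digonR k l = d k l • W.up k := by
  induction l with
  | zero => rw [W.digonR_zero_right, hd_zero, one_smul]
  | succ l ih =>
    refine ((q ^ (-l : ℤ)).isUnit.mul (hunit l)).smul_left_cancel.1 ?_
    rw [W.smul_digonR_succ k l (hβ _), ih, smul_smul, smul_smul, hd_succ]

end WebCalculus

/-! ### Quantum integers -/

section QuantumIntegers

variable {R : Type u} [CommRing R] (q a : Rˣ)

theorem qInt_mul_sq_sub_one (h : IsUnit ((q : R) ^ 2 - 1)) (m : ℤ) :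
    qInt q m * ((q : R) ^ 2 - 1) = ((q ^ (2 * m) : Rˣ) : R) - 1 := by
  rw [qInt, mul_assoc, Ring.inverse_mul_cancel _ h, mul_one]

theorem qInt_one (h : IsUnit ((q : R) ^ 2 - 1)) : qInt q 1 = 1 := by
  rw [qInt, mul_one, zpow_ofNat, Units.val_pow_eq_pow_val, Ring.mul_inverse_cancel _ h]

theorem zpow_mul_qInt_neg (m : ℤ) :
    ((q ^ (1 + m) : Rˣ) : R) * qInt q (-m) = -(((q ^ (1 - m) : Rˣ) : R) * qInt q m) := by
  have hneg : ((q ^ (1 + m) : Rˣ) : R) * ((q ^ (2 * -m) : Rˣ) : R) = ((q ^ (1 - m) : Rˣ) : R) := by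
    rw [← Units.val_mul, ← zpow_add]
    ring_nf
  have hpos : ((q ^ (1 - m) : Rˣ) : R) * ((q ^ (2 * m) : Rˣ) : R) = ((q ^ (1 + m) : Rˣ) : R) := by
    rw [← Units.val_mul, ← zpow_add]
    ring_nf
  rw [qInt, qInt]
  linear_combination Ring.inverse ((q : R) ^ 2 - 1) * (hneg + hpos)

theorem qBinom_self (n : ℕ) : qBinom q n n = 1 := by
  induction n with
  | zero => rw [qBinom]
  | succ n ih => rw [qBinom, ih, qBinom_eq_zero q n (n + 1) n.lt_succ_self, mul_zero, add_zero]

theorem qBinom_succ_self (h : IsUnit ((q : R) ^ 2 - 1)) (n : ℕ) :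
    qBinom q (n + 1) n = qInt q (n + 1) := by
  induction n with
  | zero => rw [qBinom, Nat.cast_zero, zero_add, qInt_one q h]
  | succ n ih =>
    rw [qBinom, ih, qBinom_self]
    push_cast
    rw [qInt_add q ((n : ℤ) + 1) 1, qInt_one q h]
    norm_cast

theorem qBinom_succ_one (h : IsUnit ((q : R) ^ 2 - 1)) (n : ℕ) :
    qBinom q (n + 1) 1 = qInt q (n + 1) := by
  induction n with
  | zero => simp [qBinom, qInt_one q h]
  | succ n ih =>
    rw [qBinom, ih, qBinom]
    push_cast
    rw [add_comm ((n : ℤ) + 1) 1, qInt_add q 1, qInt_one q h]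
    norm_cast

theorem qFact_succ (n : ℕ) : qFact q (n + 1) = qFact q n * qInt q (n + 1) :=
  Finset.prod_range_succ ..

theorem isUnit_qFact (hq : ∀ n : ℕ, IsUnit (qInt q (n + 1))) (n : ℕ) : IsUnit (qFact q n) :=
  IsUnit.prod_iff.2 fun j _ => hq j

theorem qBinom_succ_mul (hq : ∀ n : ℕ, IsUnit (qInt q (n + 1))) (k l : ℕ) :
    qBinom q (k + (l + 1)) k * qInt q (l + 1) = qBinom q (k + l) k * qInt q ((k + l : ℕ) + 1) := by
  refine ((isUnit_qFact q hq k).mul (isUnit_qFact q hq l)).mul_right_cancel ?_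
  have h := qBinom_mul_qFact q k (l + 1)
  rw [← add_assoc, qFact_succ, qFact_succ, ← qBinom_mul_qFact q k l] at h
  rw [← add_assoc]
  linear_combination h

theorem inverse_sub_inv :
    Ring.inverse ((q : R) - ((q⁻¹ : Rˣ) : R)) = q * Ring.inverse ((q : R) ^ 2 - 1) := by
  have hfactor : (q : R) - ((q⁻¹ : Rˣ) : R) = ((q⁻¹ : Rˣ) : R) * ((q : R) ^ 2 - 1) := by
    linear_combination (-(q : R)) * q.inv_mul
  rw [hfactor, Ring.mul_inverse_rev' (Commute.all _ _), mul_comm, Ring.inverse_unit, inv_inv]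

theorem aInt_mul_sq_sub_one (h : IsUnit ((q : R) ^ 2 - 1)) (r : ℤ) :
    aInt q a r * ((q : R) ^ 2 - 1) =
      q * (((a * q ^ (-r) : Rˣ) : R) - ((a⁻¹ * q ^ r : Rˣ) : R)) := by
  rw [aInt, inverse_sub_inv q]
  linear_combination (((a * q ^ (-r) : Rˣ) : R) - ((a⁻¹ * q ^ r : Rˣ) : R)) * q *
    Ring.inverse_mul_cancel _ h

theorem aInt_succ (h : IsUnit ((q : R) ^ 2 - 1)) (m : ℕ) :
    aInt q a (m + 1) =
      aInt q a 1 * (((q ^ (-(m : ℤ)) : Rˣ) : R) * qInt q (m + 1)) -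
        ((q ^ (1 - (m : ℤ)) : Rˣ) : R) * qInt q m * aInt q a 0 := by
  have hi := Ring.inverse_mul_cancel _ h
  have ht : ((q ^ m : Rˣ) : R) * (((q ^ m)⁻¹ : Rˣ) : R) = 1 := (q ^ m).mul_inv
  have hq : (q : R) * ((q⁻¹ : Rˣ) : R) = 1 := q.mul_inv
  have hsq (n : ℕ) : q ^ (2 * (n : ℤ)) = (q ^ n) ^ 2 := by
    rw [← pow_mul, mul_comm n, ← zpow_natCast, Nat.cast_mul, Nat.cast_ofNat]
  have hsq_succ : q ^ (2 * ((m : ℤ) + 1)) = (q ^ m * q) ^ 2 := by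
    rw [← pow_succ, ← hsq, Nat.cast_succ]
  simp only [aInt, qInt, inverse_sub_inv, hsq, hsq_succ, neg_add, sub_eq_add_neg (1 : ℤ), zpow_add,
    zpow_neg, zpow_natCast, zpow_one, zpow_zero, neg_zero, mul_one, Units.val_mul,
    Units.val_pow_eq_pow_val] at ht ⊢
  generalize Ring.inverse ((q : R) ^ 2 - 1) = i at *
  linear_combination
    -((q : R) ^ 2 * i ^ 2 * (((q ^ m)⁻¹ : Rˣ) : R) * a * (((q : R) ^ m) ^ 2 - 1)) * hq -
      q * i * (((q ^ m)⁻¹ : Rˣ) : R) *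
        (a * ((q⁻¹ : Rˣ) : R) - ((a⁻¹ : Rˣ) : R) * q * ((q : R) ^ m) ^ 2) * hi +
      (q : R) ^ 2 * i * ((a⁻¹ : Rˣ) : R) * (q : R) ^ m * ht

end QuantumIntegers

/-! ### The coefficients over `ℚ(q)` -/

section RationalCoefficients

theorem X_zpow_two_mul (a : ℤ) :
    (RatFunc.X : RatFunc ℚ) ^ (2 * a) = RatFunc.X ^ 2 * RatFunc.X ^ (2 * (a - 1)) := by
  rw [← zpow_natCast, ← zpow_add₀ RatFunc.X_ne_zero]
  congr 1
  push_cast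
  ring

theorem qNum_sub_one (a : ℤ) : RatFunc.X ^ 2 * qNum (a - 1) + 1 = qNum a := by
  have h : (RatFunc.X : RatFunc ℚ) ^ 2 - 1 ≠ 0 := (isUnit_qUnit_sq_sub_one (RatFunc ℚ)).ne_zero
  rw [qNum, qNum, X_zpow_two_mul a]
  field_simp
  ring

theorem qCF_head_sub_one (a b : ℤ) (t : List (ℤ × ℤ)) :
    RatFunc.X ^ 2 * qCF ((a - 1, b) :: t) + 1 = qCF ((a, b) :: t) := by
  cases t with
  | nil =>
    rw [qCF, qCF, X_zpow_two_mul a, ← qNum_sub_one a]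
    ring
  | cons p t =>
    rw [qCF.eq_3 _ _ _ (List.cons_ne_nil p t), qCF.eq_3 _ _ _ (List.cons_ne_nil p t),
      X_zpow_two_mul a, ← qNum_sub_one a]
    ring

theorem qRat_sub_one (x : ℚ) : RatFunc.X ^ 2 * qRat (x - 1) + 1 = qRat x := by
  have hceil : ⌈x - 1⌉ = ⌈x⌉ - 1 := Int.ceil_sub_one x
  have hfract : x - 1 - ((⌈x - 1⌉ - 1 : ℤ) : ℚ) = x - ((⌈x⌉ - 1 : ℤ) : ℚ) := by
    rw [hceil]
    push_cast
    ring
  rw [qRat, qRat, evenCF, evenCF.eq_1 x, hfract, hceil]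
  split_ifs <;> exact qCF_head_sub_one _ _ _

variable {K : Type v} [CommRing K] [Algebra (RatFunc ℚ) K]

theorem qUnit_val : (qUnit K : K) = algebraMap (RatFunc ℚ) K RatFunc.X := rfl

theorem sq_mul_algebraMap_qRat_sub_one (x : ℚ) :
    (qUnit K : K) ^ 2 * algebraMap (RatFunc ℚ) K (qRat (x - 1)) + 1 =
      algebraMap (RatFunc ℚ) K (qRat x) := by
  simpa only [map_add, map_mul, map_pow, map_one, ← qUnit_val] using
    congrArg (algebraMap (RatFunc ℚ) K) (qRat_sub_one x)

theorem algebraMap_qRat_sub (x : ℚ) (n : ℕ) :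
    (qUnit K : K) ^ (2 * n) * algebraMap (RatFunc ℚ) K (qRat (x - n)) * ((qUnit K : K) ^ 2 - 1) =
      algebraMap (RatFunc ℚ) K (qRat x) * ((qUnit K : K) ^ 2 - 1) -
        ((qUnit K : K) ^ (2 * n) - 1) := by
  induction n with
  | zero => simp
  | succ n ih =>
    have h := sq_mul_algebraMap_qRat_sub_one (K := K) (x - n)
    rw [sub_sub] at h
    push_cast
    rw [← h] at ih
    linear_combination ih

theorem algebraMap_qDelta (x : ℚ) :
    (qUnit K : K) ^ 2 * algebraMap (RatFunc ℚ) K (qDelta x) =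
      algebraMap (RatFunc ℚ) K (qRat x) * ((qUnit K : K) ^ 2 - 1) + 1 := by
  rw [qDelta, map_sub]
  linear_combination -sq_mul_algebraMap_qRat_sub_one (K := K) x

theorem aInt_aUnit (x : ℚ) (ν : K) (hν : ν ^ 2 * algebraMap (RatFunc ℚ) K (qDelta x) = 1)
    (n : ℕ) :
    aInt (qUnit K) (aUnit x ν hν) n =
      (qUnit K : K) ^ n * ν * algebraMap (RatFunc ℚ) K (qRat (x - n)) := by
  have hu := isUnit_qUnit_sq_sub_one K
  refine hu.mul_right_cancel ((((qUnit K).isUnit.pow n).mul_right_inj).1 ?_)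
  rw [aInt_mul_sq_sub_one _ _ hu]
  have hpos : ((aUnit x ν hν * qUnit K ^ (-(n : ℤ)) : Kˣ) : K) * (qUnit K : K) ^ n =
      (qUnit K : K) * ν * algebraMap (RatFunc ℚ) K (qDelta x) := by
    rw [← Units.val_pow_eq_pow_val, ← Units.val_mul, zpow_neg, zpow_natCast, inv_mul_cancel_right]
    rfl
  have hneg : (((aUnit x ν hν)⁻¹ * qUnit K ^ (n : ℤ) : Kˣ) : K) * qUnit K =
      ν * (qUnit K : K) ^ n := by
    rw [zpow_natCast, Units.val_mul, Units.val_pow_eq_pow_val]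
    change ((qUnit K)⁻¹ : Kˣ) * ν * _ * _ = _
    linear_combination ν * (qUnit K : K) ^ n * (qUnit K).inv_mul
  linear_combination (qUnit K : K) * hpos - (qUnit K : K) ^ n * hneg -
    ν * algebraMap_qRat_sub (K := K) x n + ν * algebraMap_qDelta (K := K) x

theorem X_pow_succ_sub_one_ne_zero (n : ℕ) : (RatFunc.X : RatFunc ℚ) ^ (n + 1) - 1 ≠ 0 := by
  have hpoly : (RatFunc.X : RatFunc ℚ) ^ (n + 1) - 1 =
      algebraMap (Polynomial ℚ) (RatFunc ℚ) (Polynomial.X ^ (n + 1) - Polynomial.C 1) := by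
    simp [RatFunc.algebraMap_X]
  rw [hpoly]
  exact RatFunc.algebraMap_ne_zero (Polynomial.X_pow_sub_C_ne_zero n.succ_pos 1)

theorem isUnit_qInt_qUnit (n : ℕ) : IsUnit (qInt (qUnit K) (n + 1)) := by
  refine isUnit_of_mul_isUnit_left (y := (qUnit K : K) ^ 2 - 1) ?_
  have h := (IsUnit.mk0 _ (X_pow_succ_sub_one_ne_zero (2 * n + 1))).map (algebraMap (RatFunc ℚ) K)
  rw [map_sub, map_pow, map_one, ← qUnit_val] at h
  rw [qInt_mul_sq_sub_one _ (isUnit_qUnit_sq_sub_one K)]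
  exact_mod_cast h

theorem algebraMap_qNum (n : ℤ) : algebraMap (RatFunc ℚ) K (qNum n) = qInt (qUnit K) n := by
  have hu := isUnit_qUnit_sq_sub_one K
  have h₀ : (RatFunc.X : RatFunc ℚ) ^ 2 - 1 ≠ 0 := (isUnit_qUnit_sq_sub_one (RatFunc ℚ)).ne_zero
  refine hu.mul_right_cancel ?_
  rw [qInt_mul_sq_sub_one _ hu, qUnit_val, ← map_one (algebraMap (RatFunc ℚ) K), ← map_pow,
    ← map_sub, ← map_mul, qNum, div_mul_cancel₀ _ h₀, map_sub]
  congr 1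
  rw [qUnit, ← map_zpow, Units.coe_map, Units.val_zpow_eq_zpow_val, Units.val_mk0]
  rfl

theorem qNum_natCast_succ_ne_zero (n : ℕ) : qNum (n + 1) ≠ 0 := by
  have h := (isUnit_qInt_qUnit (K := RatFunc ℚ) n).ne_zero
  rwa [← algebraMap_qNum] at h

theorem circleRatio_succ_mul (x : ℚ) (ν : K) (k l : ℕ) :
    circleRatio x ν k (l + 1) * qInt (qUnit K) ((k + l : ℕ) + 1) =
      (qUnit K : K) ^ (2 * (k + l)) * ν * algebraMap (RatFunc ℚ) K (qRat (x - (k + l : ℕ))) *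
        circleRatio x ν k l := by
  have hexp : (l + 1) * (2 * k + (l + 1) - 1) = 2 * (k + l) + l * (2 * k + l - 1) := by
    cases l with
    | zero => simp
    | succ l =>
      simp only [← Nat.add_assoc, Nat.add_sub_cancel]
      ring
  have hprod : algebraMap (RatFunc ℚ) K ((∏ j ∈ Finset.range (l + 1), qRat (x - (k + j : ℕ))) /
        ∏ j ∈ Finset.range (l + 1), qNum ((k + j : ℕ) + 1)) * qInt (qUnit K) ((k + l : ℕ) + 1) =
      algebraMap (RatFunc ℚ) K ((∏ j ∈ Finset.range l, qRat (x - (k + j : ℕ))) /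
        ∏ j ∈ Finset.range l, qNum ((k + j : ℕ) + 1)) *
        algebraMap (RatFunc ℚ) K (qRat (x - (k + l : ℕ))) := by
    rw [← algebraMap_qNum, ← map_mul, ← map_mul, Finset.prod_range_succ, Finset.prod_range_succ,
      mul_div_mul_comm, mul_assoc, div_mul_cancel₀ _ (qNum_natCast_succ_ne_zero _)]
  rw [circleRatio, circleRatio, hexp, pow_add, pow_succ, mul_assoc, hprod]
  ring

theorem digonValue_zero_right (x : ℚ) (ν : K) (k : ℕ) : digonValue x ν k 0 = 1 := by
  simp [digonValue, circleRatio, qBinom_self]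

theorem digonValue_zero_left (x : ℚ) (ν : K) (k : ℕ) :
    digonValue x ν 0 k = circleValue x ν k := by
  have h := circleRatio_mul_circleValue x ν 0 k
  have h₀ : circleValue x ν 0 = 1 := by simp [circleValue, qRatBinom]
  rw [h₀, mul_one, zero_add] at h
  simp [digonValue, h, qBinom]

theorem digonValue_succ (x : ℚ) (ν : K) (k l : ℕ) :
    ((qUnit K ^ (-(l : ℤ)) : Kˣ) : K) * qInt (qUnit K) (l + 1) * digonValue x ν k (l + 1) =
      (qUnit K : K) ^ (k + l) * ν * algebraMap (RatFunc ℚ) K (qRat (x - (k + l : ℕ))) *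
        digonValue x ν k l := by
  have hbinom := qBinom_succ_mul (qUnit K) isUnit_qInt_qUnit k l
  have hratio := circleRatio_succ_mul x ν k l
  have hpow : ((qUnit K ^ (-(l : ℤ)) : Kˣ) : K) *
      ((qUnit K ^ (-((k : ℤ) * (l + 1 : ℕ))) : Kˣ) : K) * (qUnit K : K) ^ (2 * (k + l)) =
      (qUnit K : K) ^ (k + l) * ((qUnit K ^ (-((k : ℤ) * l)) : Kˣ) : K) := by
    simp only [← Units.val_pow_eq_pow_val, ← Units.val_mul, ← zpow_natCast, ← zpow_add]
    congr 2
    push_cast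
    ring
  rw [digonValue, digonValue]
  linear_combination ((qUnit K ^ (-(l : ℤ)) : Kˣ) : K) *
      ((qUnit K ^ (-((k : ℤ) * (l + 1 : ℕ))) : Kˣ) : K) *
      (circleRatio x ν k (l + 1) * hbinom + qBinom (qUnit K) (k + l) k * hratio) +
    ν * algebraMap (RatFunc ℚ) K (qRat (x - (k + l : ℕ))) * qBinom (qUnit K) (k + l) k *
      circleRatio x ν k l * hpow

theorem digonValue_one (x : ℚ) (ν : K) (k : ℕ) :
    digonValue x ν k 1 = (qUnit K : K) ^ k * ν * algebraMap (RatFunc ℚ) K (qRat (x - k)) := by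
  have h := digonValue_succ x ν k 0
  have e : qInt (qUnit K) 1 = 1 := qInt_one _ (isUnit_qUnit_sq_sub_one K)
  simpa [digonValue_zero_right, e] using h

end RationalCoefficients

/-! ### Arrows of a presented category -/

section Arrows

variable {R : Type u} [CommRing R]

/-- A morphism of the category presented by `S`, packaged with its source and target, so that
horizontal composition becomes strictly associative and unital. -/
structure Mor (S : Relations R) where
  src : Word
  tgt : Word
  hom : Presented.Hom S src tgt

variable {S : Relations R}

namespace Mor

variable (S) in
/-- The morphism represented by a diagram. -/
def of {X Y : Word} (f : Diag R X Y) : Mor S := ⟨X, Y, Presented.cls S f⟩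

/-- The identity of a word. -/
def I (X : Word) : Mor S := of S (.idd X)

theorem exists_of (f : Mor S) : ∃ (X Y : Word) (f₀ : Diag R X Y), of S f₀ = f := by
  obtain ⟨X, Y, f⟩ := f
  obtain ⟨f₀, rfl⟩ := Presented.cls_surj f
  exact ⟨X, Y, f₀, rfl⟩

theorem of_eq_of {X Y : Word} {f g : Diag R X Y} (h : Equivalent S f g) : of S f = of S g := by
  rw [of, of, Presented.sound h]

theorem equivalent_of_eq {X Y : Word} {f g : Diag R X Y} (h : of S f = of S g) :
    Equivalent S f g := by
  simp only [of, Mor.mk.injEq, heq_eq_eq, true_and] at h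
  exact Quotient.exact (s := Presented.setoid S X Y) h

theorem of_eq_of_eqHom {X Y X' Y' : Word} {f : Diag R X Y} {g : Diag R X' Y'} (hX : X = X')
    (hY : Y = Y') (h : Equivalent S (.comp f (.eqHom hY)) (.comp (.eqHom hX) g)) :
    of S f = of S g := by
  subst hX hY
  exact of_eq_of (((Equivalent.comp_id f).symm.trans h).trans (.id_comp g))

theorem of_eqHom {X Y : Word} (h : X = Y) : of S (.eqHom h) = I X := by
  subst h
  rfl

theorem I_injective : Function.Injective (I : Word → Mor S) := fun _ _ h => congrArg src h

open scoped Classical in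
/-- Vertical composition, zero if the target and the source do not match. -/
def vcomp (f g : Mor S) : Mor S :=
  if h : f.tgt = g.src then ⟨f.src, g.tgt, Presented.hcomp (h ▸ f.hom) g.hom⟩
  else ⟨f.src, g.tgt, 0⟩

theorem vcomp_src (f g : Mor S) : (f.vcomp g).src = f.src := by
  unfold vcomp
  split_ifs <;> rfl

theorem vcomp_tgt (f g : Mor S) : (f.vcomp g).tgt = g.tgt := by
  unfold vcomp
  split_ifs <;> rfl

theorem vcomp_of {X Y Z : Word} (f : Diag R X Y) (g : Diag R Y Z) :
    (of S f).vcomp (of S g) = of S (.comp f g) := dif_pos rfl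

theorem vcomp_of_ne {X Y Y' Z : Word} (f : Diag R X Y) (g : Diag R Y' Z) (h : Y ≠ Y') :
    (of S f).vcomp (of S g) = of S (.zero : Diag R X Z) := dif_neg h

theorem of_zero_comp {X Y Z : Word} (g : Diag R Y Z) :
    of S (.comp (.zero : Diag R X Y) g) = of S (.zero : Diag R X Z) :=
  of_eq_of <| ((Equivalent.comp_congr (.symm (.zero_smul .zero)) (.refl g)).trans
    (.smul_comp 0 _ _)).trans (.zero_smul _)

theorem of_comp_zero {X Y Z : Word} (f : Diag R X Y) :
    of S (.comp f (.zero : Diag R Y Z)) = of S (.zero : Diag R X Z) :=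
  of_eq_of <| ((Equivalent.comp_congr (.refl f) (.symm (.zero_smul .zero))).trans
    (.comp_smul 0 _ _)).trans (.zero_smul _)

theorem vcomp_assoc (f g h : Mor S) : (f.vcomp g).vcomp h = f.vcomp (g.vcomp h) := by
  obtain ⟨X, Y, f, rfl⟩ := f.exists_of
  obtain ⟨Y', Z, g, rfl⟩ := g.exists_of
  obtain ⟨Z', W, h, rfl⟩ := h.exists_of
  rcases eq_or_ne Y Y' with rfl | hY <;> rcases eq_or_ne Z Z' with rfl | hZ
  · simp only [vcomp_of]
    exact of_eq_of (.comp_assoc f g h)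
  · rw [vcomp_of, vcomp_of_ne _ _ hZ, vcomp_of_ne _ _ hZ, vcomp_of, of_comp_zero]
  · rw [vcomp_of_ne _ _ hY, vcomp_of, vcomp_of, of_zero_comp, vcomp_of_ne _ _ hY]
  · rw [vcomp_of_ne _ _ hY, vcomp_of_ne _ _ hZ, vcomp_of_ne _ _ hZ, vcomp_of_ne _ _ hY]

instance : Mul (Mor S) :=
  ⟨fun f g => ⟨f.src ++ g.src, f.tgt ++ g.tgt, Presented.htensor f.hom g.hom⟩⟩

instance : One (Mor S) := ⟨I []⟩

theorem I_nil : (I [] : Mor S) = 1 := rfl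

theorem of_idd (X : Word) : of S (.idd X) = I X := rfl

theorem of_tensor {X Y Z W : Word} (f : Diag R X Y) (g : Diag R Z W) :
    of S (.tensor f g) = of S f * of S g := rfl

theorem of_whisk (A : Word) {X Y : Word} (f : Diag R X Y) (B : Word) :
    of S (.whisk A f B) = I A * of S f * I B := rfl

theorem I_append (X Y : Word) : (I (X ++ Y) : Mor S) = I X * I Y :=
  (of_eq_of (.tensor_id X Y)).symm

instance : Monoid (Mor S) where
  mul_assoc f g h := by
    obtain ⟨_, _, f, rfl⟩ := f.exists_of
    obtain ⟨_, _, g, rfl⟩ := g.exists_of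
    obtain ⟨_, _, h, rfl⟩ := h.exists_of
    exact of_eq_of_eqHom (List.append_assoc _ _ _) (List.append_assoc _ _ _) (.tensor_assoc f g h)
  one_mul f := by
    obtain ⟨_, _, f, rfl⟩ := f.exists_of
    exact of_eq_of (.unit_tensor f)
  mul_one f := by
    obtain ⟨_, _, f, rfl⟩ := f.exists_of
    exact of_eq_of_eqHom (List.append_nil _) (List.append_nil _) (.tensor_unit f)

instance : MonoidalArrows (Mor S) where
  dom f := I f.src
  cod f := I f.tgt
  comp := vcomp
  dom_dom _ := rfl
  cod_dom _ := rfl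
  dom_cod _ := rfl
  dom_one := rfl
  dom_mul _ _ := I_append _ _
  cod_mul _ _ := I_append _ _
  dom_comp f g := congrArg I (f.vcomp_src g)
  cod_comp f g := congrArg I (f.vcomp_tgt g)
  comp_assoc := vcomp_assoc
  dom_comp_self f := by
    obtain ⟨X, _, f, rfl⟩ := f.exists_of
    exact (vcomp_of (.idd X) f).trans (of_eq_of (.id_comp f))
  comp_cod_self f := by
    obtain ⟨_, Y, f, rfl⟩ := f.exists_of
    exact (vcomp_of f (.idd Y)).trans (of_eq_of (.comp_id f))
  mul_comp_mul f f' g g' h h' := by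
    obtain ⟨_, Y, f, rfl⟩ := f.exists_of
    obtain ⟨_, Y', f', rfl⟩ := f'.exists_of
    obtain ⟨Z, _, g, rfl⟩ := g.exists_of
    obtain ⟨Z', _, g', rfl⟩ := g'.exists_of
    obtain rfl : Y = Z := I_injective h
    obtain rfl : Y' = Z' := I_injective h'
    simp only [← of_tensor, vcomp_of]
    exact of_eq_of (.tensor_comp f g f' g')

instance (X : Word) : IsObject (I X : Mor S) := ⟨rfl⟩

@[simp] theorem dom_of {X Y : Word} (f : Diag R X Y) : dom (of S f) = I X := rfl

@[simp] theorem cod_of {X Y : Word} (f : Diag R X Y) : cod (of S f) = I Y := rfl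

theorem of_comp {X Y Z : Word} (f : Diag R X Y) (g : Diag R Y Z) :
    of S (.comp f g) = of S f ⊚ of S g := (vcomp_of f g).symm

theorem of_cast {X Y X' Y' : Word} (f : Diag R X Y) (hX : X' = X) (hY : Y = Y') :
    of S (f.cast hX hY) = of S f := by
  subst hX hY
  exact of_eq_of ((Equivalent.id_comp _).trans (.comp_id _))

theorem of_seq {X Y Y' Z : Word} (f : Diag R X Y) (g : Diag R Y' Z) (h : Y = Y') :
    of S (f.seq g h) = of S f ⊚ of S g := by
  subst h
  rw [← of_comp]
  exact of_eq_of (.comp_congr (.refl _) (.id_comp _))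

instance : MulAction R (Mor S) where
  smul r f := ⟨f.src, f.tgt, r • f.hom⟩
  one_smul f := congrArg (Mor.mk f.src f.tgt) (one_smul R f.hom)
  mul_smul r s f := congrArg (Mor.mk f.src f.tgt) (mul_smul r s f.hom)

theorem of_smul {X Y : Word} (r : R) (f : Diag R X Y) : of S (.smul r f) = r • of S f := rfl

theorem smul_of_zero (r : R) {X Y : Word} :
    r • of S (.zero : Diag R X Y) = of S (.zero : Diag R X Y) :=
  congrArg (Mor.mk X Y) (smul_zero r)

open scoped Classical in
/-- The sum of two morphisms, the first one if they are not parallel. -/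
instance : Add (Mor S) where
  add f g :=
    if h : g.src = f.src ∧ g.tgt = f.tgt then ⟨f.src, f.tgt, f.hom + h.1 ▸ h.2 ▸ g.hom⟩ else f

theorem of_add {X Y : Word} (f g : Diag R X Y) : of S (f.add g) = of S f + of S g :=
  Eq.symm (dif_pos ⟨rfl, rfl⟩)

theorem smul_comp (r : R) (f g : Mor S) : (r • f) ⊚ g = r • (f ⊚ g) := by
  obtain ⟨X, Y, f, rfl⟩ := f.exists_of
  obtain ⟨Y', Z, g, rfl⟩ := g.exists_of
  rcases eq_or_ne Y Y' with rfl | hY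
  · simp only [← of_comp, ← of_smul]
    exact of_eq_of (.smul_comp r f g)
  · exact (vcomp_of_ne _ _ hY).trans
      (((congrArg (r • ·) (vcomp_of_ne _ _ hY)).trans (smul_of_zero r)).symm)

theorem comp_smul (r : R) (f g : Mor S) : f ⊚ (r • g) = r • (f ⊚ g) := by
  obtain ⟨X, Y, f, rfl⟩ := f.exists_of
  obtain ⟨Y', Z, g, rfl⟩ := g.exists_of
  rcases eq_or_ne Y Y' with rfl | hY
  · simp only [← of_comp, ← of_smul]
    exact of_eq_of (.comp_smul r f g)
  · exact (vcomp_of_ne _ _ hY).trans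
      (((congrArg (r • ·) (vcomp_of_ne _ _ hY)).trans (smul_of_zero r)).symm)

theorem exists_of_parallel {f g : Mor S} (hd : dom f = dom g) (hc : cod f = cod g) :
    ∃ (X Y : Word) (f₀ g₀ : Diag R X Y), of S f₀ = f ∧ of S g₀ = g := by
  obtain ⟨X, Y, f, rfl⟩ := f.exists_of
  obtain ⟨_, _, g, rfl⟩ := g.exists_of
  obtain rfl := I_injective hd
  obtain rfl := I_injective hc
  exact ⟨X, Y, f, g, rfl, rfl⟩

instance : LinearArrows R (Mor S) where
  dom_smul _ _ := rfl
  cod_smul _ _ := rfl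
  smul_mul r f g := by
    obtain ⟨_, _, f, rfl⟩ := f.exists_of
    obtain ⟨_, _, g, rfl⟩ := g.exists_of
    exact of_eq_of (.smul_tensor r f g)
  mul_smul r f g := by
    obtain ⟨_, _, f, rfl⟩ := f.exists_of
    obtain ⟨_, _, g, rfl⟩ := g.exists_of
    exact of_eq_of (.tensor_smul r f g)
  smul_comp := smul_comp
  comp_smul := comp_smul
  add_smul r s f := by
    obtain ⟨_, _, f, rfl⟩ := f.exists_of
    simp only [← of_smul, ← of_add]
    exact of_eq_of (.add_smul r s f)
  add_mul f f' g hd hc := by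
    obtain ⟨_, _, f, f', rfl, rfl⟩ := exists_of_parallel hd hc
    obtain ⟨_, _, g, rfl⟩ := g.exists_of
    simp only [← of_tensor, ← of_add]
    exact of_eq_of (.add_tensor f f' g)
  mul_add f g g' hd hc := by
    obtain ⟨_, _, f, rfl⟩ := f.exists_of
    obtain ⟨_, _, g, g', rfl, rfl⟩ := exists_of_parallel hd hc
    simp only [← of_tensor, ← of_add]
    exact of_eq_of (.tensor_add f g g')
  add_comp f f' g hd hc h := by
    obtain ⟨_, Y, f, f', rfl, rfl⟩ := exists_of_parallel hd hc
    obtain ⟨Y', _, g, rfl⟩ := g.exists_of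
    obtain rfl : Y = Y' := I_injective h
    simp only [← of_comp, ← of_add]
    exact of_eq_of (.add_comp f f' g)
  comp_add f g g' hd hc h := by
    obtain ⟨_, Y, f, rfl⟩ := f.exists_of
    obtain ⟨Y', _, g, g', rfl, rfl⟩ := exists_of_parallel hd hc
    obtain rfl : Y = Y' := I_injective h
    simp only [← of_comp, ← of_add]
    exact of_eq_of (.comp_add f g g')

theorem of_eq_sub {X Y : Word} {f g h : Diag R X Y}
    (e : Equivalent S (.add f (.smul (-1) g)) h) :
    of S g = of S f + (-1 : R) • of S h := by
  have e' : Presented.cls S g = Presented.cls S (.add f (.smul (-1) h)) := by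
    simp only [Presented.cls_add, Presented.cls_smul, ← Presented.sound e, neg_one_smul]
    abel
  rw [← of_smul, ← of_add, of, e', of]

theorem of_eq_add {X Y : Word} {f g h : Diag R X Y}
    (e : Equivalent S (.add f (.smul (-1) g)) h) : of S f = of S g + of S h := by
  have e' : Presented.cls S f = Presented.cls S (.add g h) := by
    simp only [Presented.cls_add, Presented.cls_smul, ← Presented.sound e, neg_one_smul]
    abel
  rw [← of_add, of, e', of]

end Mor

end Arrows

/-! ### The web calculus of a presented category -/

section BasicRelations

variable {R : Type u} [CommRing R] {S : Relations R} {q : Rˣ}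

open Mor Diag

theorem of_rungL (b : ℕ) {k l k' l' : ℕ} (h : k' = k + b) (h' : l = b + l') :
    of S (rungL b k l k' l') =
      (I (up k) * of S (split b l')) ⊚ (of S (merge k b) * I (up l')) := by
  subst h h'
  rw [rungL, dif_pos ⟨rfl, rfl⟩]
  erw [of_seq]
  simp only [of_tensor, of_comp, of_eqHom, of_idd]
  rw [id_comp (dom_of _), comp_id (cod_of _)]

theorem of_rungR (b : ℕ) {k l k' l' : ℕ} (h : k = k' + b) (h' : l' = b + l) :
    of S (rungR b k l k' l') =
      (of S (split k' b) * I (up l)) ⊚ (I (up k') * of S (merge b l)) := by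
  subst h h'
  rw [rungR, dif_pos ⟨rfl, rfl⟩]
  erw [of_seq]
  simp only [of_tensor, of_comp, of_eqHom, of_idd]
  rw [id_comp (dom_of _), comp_id (cod_of _)]

/-- The relations `S` contain the basic ones. -/
def HasBasic (S : Relations R) (q : Rˣ) : Prop :=
  ∀ ⦃X Y : Word⦄ ⦃f g : Diag R X Y⦄, BasicRel q X Y f g → S X Y f g

namespace HasBasic

/-- The duality between the upward and the downward strand labelled `k`. -/
@[simps left right cupR capR cupL capL]
def duality (hS : HasBasic S q) (k : ℕ) : Duality (Mor S) where
  left := I (up k)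
  right := I (dn k)
  cupR := of S (cupR k)
  capR := of S (capR k)
  cupL := of S (cupL k)
  capL := of S (capL k)
  isObject_left := inferInstance
  isObject_right := inferInstance
  dom_cupR := rfl
  cod_cupR := I_append _ _
  dom_capR := I_append _ _
  cod_capR := rfl
  dom_cupL := rfl
  cod_cupL := I_append _ _
  dom_capL := I_append _ _
  cod_capL := rfl
  zigzag_left_R := by
    have h := of_eq_of (.of (hS (.zigzag_up_R k)))
    erw [of_cast, of_seq] at h
    simpa only [of_whisk, I_nil, one_mul, mul_one, of_idd] using h
  zigzag_right_R := by
    have h := of_eq_of (.of (hS (.zigzag_dn_R k)))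
    erw [of_cast, of_seq] at h
    simpa only [of_whisk, I_nil, one_mul, mul_one, of_idd] using h
  zigzag_left_L := by
    have h := of_eq_of (.of (hS (.zigzag_up_L k)))
    erw [of_cast, of_seq] at h
    simpa only [of_whisk, I_nil, one_mul, mul_one, of_idd] using h
  zigzag_right_L := by
    have h := of_eq_of (.of (hS (.zigzag_dn_L k)))
    erw [of_cast, of_seq] at h
    simpa only [of_whisk, I_nil, one_mul, mul_one, of_idd] using h

theorem duality_zero (hS : HasBasic S q) : hS.duality 0 = Duality.unit (Mor S) :=
  Duality.ext rfl rfl (of_eq_of (.of (hS .cupR_zero))) (of_eq_of (.of (hS .capR_zero)))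
    (of_eq_of (.of (hS .cupL_zero))) (of_eq_of (.of (hS .capL_zero)))

theorem merge_zero_left (hS : HasBasic S q) (l : ℕ) : of S (merge 0 l) = I (up l) :=
  (of_eq_of (.of (hS (.merge_zero_left l)))).trans (of_eqHom _)

theorem merge_zero_right (hS : HasBasic S q) (k : ℕ) : of S (merge k 0) = I (up k) :=
  ((of_eq_of (.of (hS (.merge_zero_right k)))).trans (of_eqHom _)).trans (by simp [up])

theorem split_zero_left (hS : HasBasic S q) (l : ℕ) : of S (split 0 l) = I (up l) :=
  ((of_eq_of (.of (hS (.split_zero_left l)))).trans (of_eqHom _)).trans (by simp)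

theorem split_zero_right (hS : HasBasic S q) (k : ℕ) : of S (split k 0) = I (up k) :=
  (of_eq_of (.of (hS (.split_zero_right k)))).trans (of_eqHom _)

theorem merge_rot (hS : HasBasic S q) (k l : ℕ) :
    Duality.mateR ((hS.duality k).tensor (hS.duality l)) (hS.duality (k + l)) (of S (merge k l)) =
      Duality.mateL ((hS.duality k).tensor (hS.duality l)) (hS.duality (k + l))
        (of S (merge k l)) := by
  have h := of_eq_of (.of (hS (.merge_rot k l)))
  rw [mergeRotR, mergeRotL] at h
  erw [of_cast, of_cast, of_seq, of_seq, of_seq, of_seq, of_seq, of_seq] at h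
  simp only [of_whisk, I_nil, one_mul, mul_one, I_append, mul_assoc, comp_assoc] at h
  simp only [Duality.mateR, Duality.mateL, Duality.tensor, duality_left, duality_right,
    duality_cupR, duality_capR, duality_cupL, duality_capL]
  rw [mul_comp _ (by simp [I_append, I_nil, mul_assoc]),
    comp_mul _ (by simp [I_append, I_nil, mul_assoc])]
  simpa only [mul_assoc, comp_assoc] using h

theorem merge_assoc (hS : HasBasic S q) (k l r : ℕ) :
    (of S (merge k l) * I (up r)) ⊚ of S (merge (k + l) r) =
      (I (up k) * of S (merge l r)) ⊚ of S (merge k (l + r)) := by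
  have h := of_eq_of (.of (hS (.merge_assoc k l r)))
  erw [of_cast, of_seq, of_seq] at h
  simpa only [of_tensor, of_idd] using h

theorem split_assoc (hS : HasBasic S q) (k l r : ℕ) :
    of S (split (k + l) r) ⊚ (of S (split k l) * I (up r)) =
      of S (split k (l + r)) ⊚ (I (up k) * of S (split l r)) := by
  have h := of_eq_of (.of (hS (.split_assoc k l r)))
  erw [of_cast, of_seq, of_seq] at h
  simpa only [of_tensor, of_idd] using h

theorem split_comp_merge (hS : HasBasic S q) (k l : ℕ) :
    of S (split k l) ⊚ of S (merge k l) =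
      (((q ^ (-((k : ℤ) * l)) : Rˣ) : R) * qBinom q (k + l) k) • I (up (k + l)) := by
  simpa only [of_comp, of_smul, of_idd] using of_eq_of (.of (hS (.digon k l)))

theorem merge_comp_split_one_right (hS : HasBasic S q) (m : ℕ) :
    of S (merge (m + 1) 1) ⊚ of S (split (m + 1) 1) =
      (of S (split m 1) * I (up 1)) ⊚
          (I (up m) * (of S (merge 1 1) ⊚ of S (split 1 1))) ⊚ (of S (merge m 1) * I (up 1)) +
        (-(((q ^ (1 - m : ℤ) : Rˣ) : R) * qInt q m)) • (I (up (m + 1)) * I (up 1)) := by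
  have h := of_eq_sub (.of (hS (.square_switch (m + 1) 1)))
  rw [of_smul, of_idd, of_comp, of_comp, of_rungL 1 (by omega) (by omega),
    of_rungR 1 (by omega) (by omega), of_rungR 1 (by omega) (by omega),
    of_rungL 1 (by omega) (by omega)] at h
  rw [Nat.add_sub_cancel, Nat.sub_self] at h
  rw [hS.split_zero_right, hS.merge_zero_right, show (I (up 0) : Mor S) = 1 from rfl, mul_one,
    mul_one, id_comp (f := of S (merge (m + 1) 1)) (by simp [I_append]),
    comp_id (f := of S (split (m + 1) 1)) (by simp [I_append])] at h
  have hexp : 1 - ((m + 1 : ℕ) : ℤ) + ((1 : ℕ) : ℤ) = 1 - m := by push_cast; ring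
  have hint : ((m + 1 : ℕ) : ℤ) - ((1 : ℕ) : ℤ) = m := by push_cast; ring
  rw [h, hexp, hint, mul_comp _ (by simp), I_append, smul_smul, neg_one_mul]
  simp only [comp_assoc]

theorem merge_comp_split_one_left (hS : HasBasic S q) (m : ℕ) :
    of S (merge 1 (m + 1)) ⊚ of S (split 1 (m + 1)) =
      (I (up 1) * of S (split 1 m)) ⊚
          ((of S (merge 1 1) ⊚ of S (split 1 1)) * I (up m)) ⊚ (I (up 1) * of S (merge 1 m)) +
        (-(((q ^ (1 - m : ℤ) : Rˣ) : R) * qInt q m)) • (I (up 1) * I (up (m + 1))) := by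
  have h := of_eq_add (.of (hS (.square_switch 1 (m + 1))))
  rw [of_smul, of_idd, of_comp, of_comp, of_rungL 1 (by omega) (by omega),
    of_rungR 1 (by omega) (by omega), of_rungR 1 (by omega) (by omega),
    of_rungL 1 (by omega) (by omega)] at h
  rw [Nat.add_sub_cancel, Nat.sub_self] at h
  rw [hS.split_zero_left, hS.merge_zero_left, show (I (up 0) : Mor S) = 1 from rfl, one_mul,
    one_mul, id_comp (f := of S (merge 1 (m + 1))) (by simp [I_append]),
    comp_id (f := of S (split 1 (m + 1))) (by simp [I_append])] at h
  have hexp : 1 - ((1 : ℕ) : ℤ) + ((m + 1 : ℕ) : ℤ) = 1 + m := by push_cast; ring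
  have hint : ((1 : ℕ) : ℤ) - ((m + 1 : ℕ) : ℤ) = -m := by push_cast; ring
  rw [h, hexp, hint, comp_mul _ (by simp), I_append, zpow_mul_qInt_neg]
  simp only [comp_assoc]

/-- The web calculus of a category in which the basic relations hold. -/
@[simps dual merge split]
def webCalculus (hS : HasBasic S q) (hq : IsUnit ((q : R) ^ 2 - 1)) : WebCalculus q (Mor S) where
  dual := hS.duality
  merge k l := of S (merge k l)
  split k l := of S (split k l)
  dual_zero := hS.duality_zero
  dom_merge k l := I_append _ _
  cod_merge k l := rfl
  dom_split k l := rfl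
  cod_split k l := I_append _ _
  merge_zero_left := hS.merge_zero_left
  merge_zero_right := hS.merge_zero_right
  split_zero_left := hS.split_zero_left
  split_zero_right := hS.split_zero_right
  merge_rot := hS.merge_rot
  merge_assoc := hS.merge_assoc
  split_assoc := hS.split_assoc
  split_comp_merge_one_right m := by
    rw [hS.split_comp_merge, qBinom_succ_self q hq, Nat.cast_one, mul_one]
    rfl
  split_comp_merge_one_left m := by
    rw [hS.split_comp_merge, add_comm 1 m, qBinom_succ_one q hq, Nat.cast_one, one_mul]
    rfl
  merge_comp_split_one_right := hS.merge_comp_split_one_right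
  merge_comp_split_one_left := hS.merge_comp_split_one_left

variable (hS : HasBasic S q) (hq : IsUnit ((q : R) ^ 2 - 1))

theorem of_digonR (k l : ℕ) : of S (digonR k l) = (hS.webCalculus hq).digonR k l := by
  rw [digonR]
  erw [of_cast, of_seq, of_seq, of_seq]
  rw [WebCalculus.digonR, Duality.ptrace, comp_mul _ (by simp)]
  simp only [of_whisk, I_nil, one_mul, mul_one, comp_assoc]
  rfl

theorem of_digonL (k l : ℕ) : of S (digonL k l) = (hS.webCalculus hq).digonL k l := by
  rw [digonL]
  erw [of_cast, of_seq, of_seq, of_seq]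
  rw [WebCalculus.digonL, mul_comp _ (by simp)]
  simp only [of_whisk, I_nil, one_mul, mul_one, comp_assoc]
  rfl

theorem of_circleR (k : ℕ) : of S (circleR k) = (hS.webCalculus hq).digonR 0 k := by
  rw [WebCalculus.digonR_zero_left, circleR, of_comp]
  rfl

theorem of_circleL (k : ℕ) : of S (circleL k) = (hS.webCalculus hq).digonL 0 k := by
  rw [WebCalculus.digonL_zero_left, circleL, of_comp]
  rfl

end HasBasic

end BasicRelations

/-! ### Comparison of the two sets of relations -/

namespace WebCalculus

theorem digonR_one_eq_aInt_smul {R : Type u} [CommRing R] {q a : Rˣ} {M : Type v} [Monoid M]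
    [MonoidalArrows M] [MulAction R M] [Add M] [LinearArrows R M] (W : WebCalculus q M)
    (hq : IsUnit ((q : R) ^ 2 - 1)) (hcircle : W.digonR 0 1 = aInt q a 0 • 1)
    (hdigon : W.digonR 1 1 = aInt q a 1 • W.up 1) (k : ℕ) :
    W.digonR k 1 = aInt q a k • W.up k := by
  cases k with
  | zero => rw [hcircle, W.up_zero, Nat.cast_zero]
  | succ m => rw [W.digonR_succ_one hdigon hcircle, Nat.cast_succ, aInt_succ q a hq]

end WebCalculus

/-- The relations of the universal web category, over any ring with units `q` and `a`. -/
abbrev infRel {R : Type u} [CommRing R] (q a : Rˣ) : Relations R := fun X Y f g =>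
  BasicRel q X Y f g ∨ UniversalRel q a X Y f g

/-- Every relation of `T` holds in the category presented by `S`. -/
def Relations.Entails {R : Type u} [CommRing R] (S T : Relations R) : Prop :=
  ∀ ⦃X Y : Word⦄ ⦃f g : Diag R X Y⦄, T X Y f g → Equivalent S f g

section Comparison

open Mor Diag

variable {K : Type v} [CommRing K] [Algebra (RatFunc ℚ) K]
variable (x : ℚ) (ν : K) (hν : ν ^ 2 * algebraMap (RatFunc ℚ) K (qDelta x) = 1)

theorem aInt_eq_digonValue (n : ℕ) : aInt (qUnit K) (aUnit x ν hν) n = digonValue x ν n 1 := by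
  rw [aInt_aUnit, digonValue_one]

theorem squareValue_eq_aInt : squareValue x ν = aInt (qUnit K) (aUnit x ν hν) 2 := by
  rw [squareValue]
  exact_mod_cast (aInt_aUnit x ν hν 2).symm

theorem WebCalculus.digonR_eq_digonValue_smul {M : Type w} [Monoid M] [MonoidalArrows M]
    [MulAction K M] [Add M] [LinearArrows K M] (W : WebCalculus (qUnit K) M)
    (hcircle : W.digonR 0 1 = aInt (qUnit K) (aUnit x ν hν) 0 • 1)
    (hdigon : W.digonR 1 1 = aInt (qUnit K) (aUnit x ν hν) 1 • W.up 1) (k l : ℕ) :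
    W.digonR k l = digonValue x ν k l • W.up k :=
  W.digonR_eq_smul (W.digonR_one_eq_aInt_smul (isUnit_qUnit_sq_sub_one K) hcircle hdigon)
    isUnit_qInt_qUnit (digonValue_zero_right x ν)
    (fun k l => by rw [digonValue_succ, aInt_aUnit]) k l

/-- The relations of the universal web category at `a = q ν δ_x`. -/
abbrev specRel : Relations K := infRel (qUnit K) (aUnit x ν hν)

/-- The upward relations with the evaluations of all circles and sideway digons and of the mixed
squares. -/
abbrev presRel : Relations K := fun X Y f g =>
  BasicRel (qUnit K) X Y f g ∨
    MixedRel (circleValue x ν) (digonValue x ν) (squareValue x ν) X Y f g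

theorem hasBasic_specRel : HasBasic (specRel x ν hν) (qUnit K) := fun _ _ _ _ => Or.inl

theorem of_digonR_specRel (k l : ℕ) :
    of (specRel x ν hν) (digonR k l) = digonValue x ν k l • I (up k) := by
  have hS := hasBasic_specRel x ν hν
  have hq := isUnit_qUnit_sq_sub_one K
  rw [hS.of_digonR hq]
  refine (hS.webCalculus hq).digonR_eq_digonValue_smul x ν hν ?_ ?_ k l
  · rw [← hS.of_circleR hq]
    exact of_eq_of (.of (.inr .circleR))
  · rw [← hS.of_digonR hq]
    exact of_eq_of (.of (.inr .digonR))

theorem of_digonL_specRel (k l : ℕ) :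
    of (specRel x ν hν) (digonL k l) = digonValue x ν k l • I (up k) := by
  have hS := hasBasic_specRel x ν hν
  have hq := isUnit_qUnit_sq_sub_one K
  rw [hS.of_digonL hq]
  refine MulOpposite.op_injective
    ((hS.webCalculus hq).mirror.digonR_eq_digonValue_smul x ν hν ?_ ?_ k l)
  · rw [WebCalculus.mirror_digonR, ← hS.of_circleL hq]
    exact congrArg MulOpposite.op (of_eq_of (.of (.inr .circleL)))
  · rw [WebCalculus.mirror_digonR, ← hS.of_digonL hq]
    exact congrArg MulOpposite.op (of_eq_of (.of (.inr .digonL)))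

theorem equivalent_of_mixedRel {X Y : Word} {f g : Diag K X Y}
    (h : MixedRel (circleValue x ν) (digonValue x ν) (squareValue x ν) X Y f g) :
    Equivalent (specRel x ν hν) f g := by
  have hS := hasBasic_specRel x ν hν
  have hq := isUnit_qUnit_sq_sub_one K
  cases h with
  | circleR k =>
    refine equivalent_of_eq ?_
    rw [hS.of_circleR hq, ← hS.of_digonR hq, of_digonR_specRel, digonValue_zero_left]
    rfl
  | circleL k =>
    refine equivalent_of_eq ?_
    rw [hS.of_circleL hq, ← hS.of_digonL hq, of_digonL_specRel, digonValue_zero_left]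
    rfl
  | digonR k l => exact equivalent_of_eq (of_digonR_specRel x ν hν k l)
  | digonL k l => exact equivalent_of_eq (of_digonL_specRel x ν hν k l)
  | square =>
    rw [squareValue_eq_aInt x ν hν]
    exact .of (.inr .square)
  | square_mirror =>
    rw [squareValue_eq_aInt x ν hν]
    exact .of (.inr .square_mirror)

theorem mixedRel_of_universalRel {X Y : Word} {f g : Diag K X Y}
    (h : UniversalRel (qUnit K) (aUnit x ν hν) X Y f g) :
    MixedRel (circleValue x ν) (digonValue x ν) (squareValue x ν) X Y f g := by
  have hcircle : aInt (qUnit K) (aUnit x ν hν) 0 = circleValue x ν 1 := by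
    rw [← digonValue_zero_left]
    exact_mod_cast aInt_eq_digonValue x ν hν 0
  have hdigon : aInt (qUnit K) (aUnit x ν hν) 1 = digonValue x ν 1 1 := by
    exact_mod_cast aInt_eq_digonValue x ν hν 1
  cases h with
  | circleR => exact hcircle ▸ .circleR 1
  | circleL => exact hcircle ▸ .circleL 1
  | digonR => exact hdigon ▸ .digonR 1 1
  | digonL => exact hdigon ▸ .digonL 1 1
  | square => exact squareValue_eq_aInt x ν hν ▸ .square
  | square_mirror => exact squareValue_eq_aInt x ν hν ▸ .square_mirror

theorem specRel_entails_presRel : Relations.Entails (specRel x ν hν) (presRel x ν) := by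
  rintro X Y f g (h | h)
  · exact .of (.inl h)
  · exact equivalent_of_mixedRel x ν hν h

theorem presRel_entails_specRel : Relations.Entails (presRel x ν) (specRel x ν hν) := by
  rintro X Y f g (h | h)
  · exact .of (.inl h)
  · exact .of (.inr (mixedRel_of_universalRel x ν hν h))

end Comparison

/-! ### Eliminating crossings -/

namespace Duality

variable {M : Type u} [Monoid M] [MonoidalArrows M]

theorem eq_rotate_capR (P : Duality M) {Y f g : M} [IsObject Y] (hfd : dom f = P.right * Y)
    (hfc : cod f = Y * P.right) (hg : cod g = P.left * Y)
    (h : (P.right * g) ⊚ (P.capR * Y) = (f * P.left) ⊚ (Y * P.capR)) :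
    f = (P.right * Y * P.cupR) ⊚ (P.right * g * P.right) ⊚ (P.capR * (Y * P.right)) := by
  have slide : (P.right * Y * P.cupR) ⊚ (f * (P.left * P.right)) =
      f ⊚ (Y * P.right * P.cupR) := by
    simpa using (exchange hfd hfc P.dom_cupR P.cod_cupR).symm
  have rotate : (P.right * g * P.right) ⊚ (P.capR * (Y * P.right)) =
      (f * (P.left * P.right)) ⊚ (Y * P.capR * P.right) := by
    rw [← mul_assoc, ← comp_mul _ (by simp [hg, mul_assoc]), h,
      comp_mul _ (by simp [hfc, mul_assoc]), mul_assoc f]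
  rw [rotate, comp_eq_comp slide, mul_assoc, mul_assoc, ← mul_comp _ (by simp [mul_assoc]),
    P.zigzag_right_R, comp_id hfc]

theorem eq_rotate_capL (P : Duality M) {Y f g : M} [IsObject Y] (hfd : dom f = Y * P.right)
    (hfc : cod f = P.right * Y) (hg : cod g = Y * P.left)
    (h : (g * P.right) ⊚ (Y * P.capL) = (P.left * f) ⊚ (P.capL * Y)) :
    f = (P.cupL * (Y * P.right)) ⊚ (P.right * (g * P.right)) ⊚ (P.right * Y * P.capL) :=
  MulOpposite.op_injective <| P.mirror.eq_rotate_capR (Y := MulOpposite.op Y)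
    (congrArg MulOpposite.op hfd) (congrArg MulOpposite.op hfc) (congrArg MulOpposite.op hg)
    (congrArg MulOpposite.op h)

end Duality

section IsWeb

variable {R : Type u}

open Diag

theorem isWeb_sum {X Y : Word} {n : ℕ} {f : ℕ → Diag R X Y} (h : ∀ i, (f i).IsWeb) :
    (Diag.sum n f).IsWeb := by
  induction n with
  | zero => trivial
  | succ n ih => exact ⟨ih, h n⟩

theorem isWeb_rungL (b k l k' l' : ℕ) : (rungL b k l k' l' : Diag R _ _).IsWeb := by
  rw [rungL]
  split_ifs
  · exact ⟨⟨trivial, trivial, trivial⟩, trivial, ⟨trivial, trivial⟩, trivial⟩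
  · trivial

theorem isWeb_rungR (b k l k' l' : ℕ) : (rungR b k l k' l' : Diag R _ _).IsWeb := by
  rw [rungR]
  split_ifs
  · exact ⟨⟨⟨trivial, trivial⟩, trivial⟩, trivial, trivial, trivial, trivial⟩
  · trivial

variable [CommRing R]

theorem isWeb_crossingSum (q : Rˣ) (k l : ℕ) : (crossingSum q k l).IsWeb :=
  isWeb_sum fun _ => ⟨isWeb_rungR _ _ _ _ _, isWeb_rungL _ _ _ _ _⟩

theorem isWeb_crossingInvSum (q : Rˣ) (k l : ℕ) : (crossingInvSum q k l).IsWeb :=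
  isWeb_sum fun _ => ⟨isWeb_rungL _ _ _ _ _, isWeb_rungR _ _ _ _ _⟩

end IsWeb

theorem singleton_eq_up_or_dn (a : Arrow) : [a] = up a.label ∨ [a] = dn a.label := by
  obtain ⟨b, n⟩ := a
  obtain ⟨m, rfl⟩ : ∃ m, n = Nat.succPNat m := ⟨n.natPred, (PNat.succPNat_natPred n).symm⟩
  cases b
  · exact .inr rfl
  · exact .inl rfl

section Crossings

variable {R : Type u} [CommRing R] {S : Relations R}

open Mor Diag

theorem braid_comp_braidInv (X Y : Word) :
    of S (braid X Y) ⊚ of S (braidInv X Y) = I X * I Y := by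
  rw [← of_comp, ← I_append]
  exact of_eq_of (.braid_braidInv X Y)

theorem braidInv_comp_braid (X Y : Word) :
    of S (braidInv X Y) ⊚ of S (braid X Y) = I Y * I X := by
  rw [← of_comp, ← I_append]
  exact of_eq_of (.braidInv_braid X Y)

theorem braid_naturality {X Y X' Y' : Word} (f : Diag R X Y) (g : Diag R X' Y') :
    (of S f * of S g) ⊚ of S (braid Y Y') = of S (braid X X') ⊚ (of S g * of S f) := by
  rw [← of_tensor, ← of_tensor, ← of_comp, ← of_comp]
  exact of_eq_of (.braid_naturality f g)

theorem braid_append_right (X Y Z : Word) :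
    of S (braid X (Y ++ Z)) = (of S (braid X Y) * I Z) ⊚ (I Y * of S (braid X Z)) := by
  have h := of_eq_of (S := S) (.hexagon_forward X Y Z)
  simp only [of_comp, of_eqHom, of_tensor, of_idd] at h
  rwa [comp_id (f := of S (braid X (Y ++ Z))) (by simp),
    id_comp (f := of S (braid X (Y ++ Z))) (by simp),
    id_comp (f := I Y * of S (braid X Z)) (by simp [I_append])] at h

theorem braid_append_left (X Y Z : Word) :
    of S (braid (X ++ Y) Z) = (I X * of S (braid Y Z)) ⊚ (of S (braid X Z) * I Y) := by
  have h := of_eq_of (S := S) (.hexagon_reverse X Y Z)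
  simp only [of_comp, of_eqHom, of_tensor, of_idd] at h
  rwa [comp_id (f := of S (braid (X ++ Y) Z)) (by simp),
    id_comp (f := of S (braid (X ++ Y) Z)) (by simp),
    id_comp (f := of S (braid X Z) * I Y) (by simp [I_append, mul_assoc])] at h

theorem eq_of_comp_eq_dom_cod {f g g' : Mor S} (h : g' ⊚ f = dom g) (h' : f ⊚ g = cod g') :
    g = g' := by
  rw [← dom_comp_self g, ← h, comp_assoc, h', comp_cod_self]

theorem braidInv_append_right (X Y Z : Word) :
    of S (braidInv X (Y ++ Z)) =
      (I Y * of S (braidInv X Z)) ⊚ (of S (braidInv X Y) * I Z) := by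
  refine eq_of_comp_eq_dom_cod (f := of S (braid X (Y ++ Z))) ?_ ?_
  · rw [braid_append_right, comp_assoc, ← comp_assoc (_ * I Z), ← comp_mul _ (by simp),
      braidInv_comp_braid, id_comp (f := I Y * of S (braid X Z)) (by simp [I_append, mul_assoc]),
      ← mul_comp _ (by simp), braidInv_comp_braid]
    simp [I_append]
  · rw [braid_comp_braidInv]
    simp [I_append, mul_assoc]

theorem braidInv_append_left (X Y Z : Word) :
    of S (braidInv (X ++ Y) Z) =
      (of S (braidInv X Z) * I Y) ⊚ (I X * of S (braidInv Y Z)) := by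
  refine eq_of_comp_eq_dom_cod (f := of S (braid (X ++ Y) Z)) ?_ ?_
  · rw [braid_append_left, comp_assoc, ← comp_assoc (I X * _), ← mul_comp _ (by simp),
      braidInv_comp_braid, id_comp (f := of S (braid X Z) * I Y) (by simp [I_append, mul_assoc]),
      ← comp_mul _ (by simp), braidInv_comp_braid]
    simp [I_append, mul_assoc]
  · rw [braid_comp_braidInv]
    simp [I_append, mul_assoc]

theorem eq_dom_of_comp_self {b c : Mor S} (hb : b ⊚ b = b) (hc : c ⊚ b = dom b) : b = dom b := by
  have h := congrArg (c ⊚ ·) hb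
  simpa only [← comp_assoc, hc, dom_comp_self] using h

theorem braid_nil_left (Y : Word) : of S (braid [] Y) = I Y := by
  have idem := braid_append_left (S := S) [] [] Y
  simp only [I_nil, one_mul, mul_one] at idem
  exact eq_dom_of_comp_self idem.symm ((braidInv_comp_braid [] Y).trans (mul_one _))

theorem braid_nil_right (X : Word) : of S (braid X []) = I X := by
  have idem := braid_append_right (S := S) X [] []
  simp only [I_nil, one_mul, mul_one] at idem
  have h := eq_dom_of_comp_self idem.symm
    ((braidInv_comp_braid X []).trans ((one_mul _).trans (by simp)))
  simpa using h

theorem braidInv_nil_left (Y : Word) : of S (braidInv [] Y) = I Y := by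
  have h := braid_comp_braidInv (S := S) [] Y
  rwa [braid_nil_left, I_nil, one_mul, id_comp (by simp)] at h

theorem braidInv_nil_right (X : Word) : of S (braidInv X []) = I X := by
  have h := braid_comp_braidInv (S := S) X []
  rwa [braid_nil_right, I_nil, mul_one, id_comp (by simp)] at h

/-- The morphism is represented by a diagram without crossings. -/
def Mor.HasWeb (f : Mor S) : Prop := ∃ (X Y : Word) (w : Diag R X Y), w.IsWeb ∧ of S w = f

namespace Mor.HasWeb

theorem of {X Y : Word} {w : Diag R X Y} (h : w.IsWeb) : (of S w).HasWeb := ⟨X, Y, w, h, rfl⟩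

theorem id (X : Word) : (I X : Mor S).HasWeb := .of (w := idd X) trivial

theorem comp {f g : Mor S} (hf : f.HasWeb) (hg : g.HasWeb) : (f ⊚ g).HasWeb := by
  obtain ⟨X, Y, w, hw, rfl⟩ := hf
  obtain ⟨Y', Z, w', hw', rfl⟩ := hg
  rcases eq_or_ne Y Y' with rfl | hY
  · rw [← of_comp]
    exact .of ⟨hw, hw'⟩
  · rw [show Mor.of S w ⊚ Mor.of S w' = _ from vcomp_of_ne w w' hY]
    exact .of (w := zero) trivial

theorem mul {f g : Mor S} (hf : f.HasWeb) (hg : g.HasWeb) : (f * g).HasWeb := by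
  obtain ⟨X, Y, w, hw, rfl⟩ := hf
  obtain ⟨X', Y', w', hw', rfl⟩ := hg
  exact .of (w := tensor w w') ⟨hw, hw'⟩

theorem exists_isWeb {X Y : Word} {f : Diag R X Y} (h : (Mor.of S f).HasWeb) :
    ∃ w : Diag R X Y, w.IsWeb ∧ Mor.of S w = Mor.of S f := by
  obtain ⟨X', Y', w, hw, e⟩ := h
  obtain rfl : X' = X := congrArg Mor.src e
  obtain rfl : Y' = Y := congrArg Mor.tgt e
  exact ⟨w, hw, e⟩

end Mor.HasWeb

/-- Both crossings of the words `X` and `Y` are represented by diagrams without crossings. -/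
def BraidHasWeb (S : Relations R) (X Y : Word) : Prop :=
  (of S (braid X Y)).HasWeb ∧ (of S (braidInv X Y)).HasWeb

namespace BraidHasWeb

theorem append_left {X Y Z : Word} (h : BraidHasWeb S X Z) (h' : BraidHasWeb S Y Z) :
    BraidHasWeb S (X ++ Y) Z := by
  rw [BraidHasWeb, braid_append_left, braidInv_append_left]
  exact ⟨((HasWeb.id X).mul h'.1).comp (h.1.mul (HasWeb.id Y)),
    (h.2.mul (HasWeb.id Y)).comp ((HasWeb.id X).mul h'.2)⟩

theorem append_right {X Y Z : Word} (h : BraidHasWeb S X Y) (h' : BraidHasWeb S X Z) :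
    BraidHasWeb S X (Y ++ Z) := by
  rw [BraidHasWeb, braid_append_right, braidInv_append_right]
  exact ⟨(h.1.mul (HasWeb.id Z)).comp ((HasWeb.id Y).mul h'.1),
    ((HasWeb.id Y).mul h'.2).comp (h.2.mul (HasWeb.id Z))⟩

theorem nil_left (Y : Word) : BraidHasWeb S [] Y := by
  rw [BraidHasWeb, braid_nil_left, braidInv_nil_left]
  exact ⟨HasWeb.id Y, HasWeb.id Y⟩

theorem nil_right (X : Word) : BraidHasWeb S X [] := by
  rw [BraidHasWeb, braid_nil_right, braidInv_nil_right]
  exact ⟨HasWeb.id X, HasWeb.id X⟩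

end BraidHasWeb

namespace HasBasic

variable {q : Rˣ}

theorem hasWeb_of_rotate_capR (hS : HasBasic S q) {k : ℕ} {Y : Word}
    {f : Diag R (dn k ++ Y) (Y ++ dn k)} {g : Diag R (Y ++ up k) (up k ++ Y)}
    (hg : (of S g).HasWeb)
    (h : (I (dn k) * of S g) ⊚ (of S (capR k) * I Y) =
      (of S f * I (up k)) ⊚ (I Y * of S (capR k))) :
    (of S f).HasWeb := by
  rw [(hS.duality k).eq_rotate_capR (I_append _ _) (I_append _ _) (I_append _ _) h]
  have hD := HasWeb.id (S := S) (dn k)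
  have hY := HasWeb.id (S := S) Y
  have hcup : (of S (cupR k)).HasWeb := .of (w := cupR k) trivial
  have hcap : (of S (capR k)).HasWeb := .of (w := capR k) trivial
  exact ((hD.mul hY).mul hcup).comp (((hD.mul hg).mul hD).comp (hcap.mul (hY.mul hD)))

theorem hasWeb_of_rotate_capL (hS : HasBasic S q) {k : ℕ} {Y : Word}
    {f : Diag R (Y ++ dn k) (dn k ++ Y)} {g : Diag R (up k ++ Y) (Y ++ up k)}
    (hg : (of S g).HasWeb)
    (h : (of S g * I (dn k)) ⊚ (I Y * of S (capL k)) =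
      (I (up k) * of S f) ⊚ (of S (capL k) * I Y)) :
    (of S f).HasWeb := by
  rw [(hS.duality k).eq_rotate_capL (I_append _ _) (I_append _ _) (I_append _ _) h]
  have hD := HasWeb.id (S := S) (dn k)
  have hY := HasWeb.id (S := S) Y
  have hcup : (of S (cupL k)).HasWeb := .of (w := cupL k) trivial
  have hcap : (of S (capL k)).HasWeb := .of (w := capL k) trivial
  exact (hcup.mul (hY.mul hD)).comp ((hD.mul (hg.mul hD)).comp ((hD.mul hY).mul hcap))

theorem braidHasWeb_up_up (hS : HasBasic S q) (k l : ℕ) : BraidHasWeb S (up k) (up l) := by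
  rw [BraidHasWeb, of_eq_of (.of (hS (.crossing k l))), of_eq_of (.of (hS (.crossing_inv l k)))]
  exact ⟨.of (isWeb_crossingSum q k l), .of (isWeb_crossingInvSum q l k)⟩

theorem braidHasWeb_dn_left (hS : HasBasic S q) {k : ℕ} {Y : Word} (h : BraidHasWeb S (up k) Y) :
    BraidHasWeb S (dn k) Y := by
  constructor
  · refine hS.hasWeb_of_rotate_capR h.2 ?_
    have slide := braid_naturality (S := S) (capR k) (idd Y)
    rw [of_idd, braid_nil_left, comp_id (by simp [I_nil]), braid_append_left] at slide
    rw [slide, comp_assoc, ← comp_assoc, ← mul_comp _ (by simp), braidInv_comp_braid,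
      id_comp (by simp [I_append, mul_assoc])]
  · refine hS.hasWeb_of_rotate_capL h.1 ?_
    have slide := braid_naturality (S := S) (capL k) (idd Y)
    rw [of_idd, braid_nil_left, comp_id (by simp [I_nil]), braid_append_left] at slide
    rw [slide, comp_assoc, ← comp_assoc, ← mul_comp _ (by simp), braidInv_comp_braid,
      id_comp (f := _ ⊚ (I Y * of S (capL k))) (by simp [I_append, mul_assoc])]

theorem braidHasWeb_dn_right (hS : HasBasic S q) {l : ℕ} {X : Word} (h : BraidHasWeb S X (up l)) :
    BraidHasWeb S X (dn l) := by
  constructor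
  · refine hS.hasWeb_of_rotate_capL h.2 ?_
    have slide := braid_naturality (S := S) (idd X) (capL l)
    rw [of_idd, braid_nil_right, comp_id (by simp [I_nil]), braid_append_right] at slide
    rw [slide, comp_assoc, ← comp_assoc, ← comp_mul _ (by simp), braidInv_comp_braid,
      id_comp (by simp [I_append, mul_assoc])]
  · refine hS.hasWeb_of_rotate_capR h.1 ?_
    have slide := braid_naturality (S := S) (idd X) (capR l)
    rw [of_idd, braid_nil_right, comp_id (by simp [I_nil]), braid_append_right] at slide
    rw [slide, comp_assoc, ← comp_assoc, ← comp_mul _ (by simp), braidInv_comp_braid,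
      id_comp (f := _ ⊚ (of S (capR l) * I X)) (by simp [I_append, mul_assoc])]

theorem braidHasWeb_up_right (hS : HasBasic S q) (X : Word) (l : ℕ) :
    BraidHasWeb S X (up l) := by
  induction X with
  | nil => exact .nil_left _
  | cons a X ih =>
    refine BraidHasWeb.append_left (X := [a]) ?_ ih
    rcases singleton_eq_up_or_dn a with ha | ha <;> rw [ha]
    · exact hS.braidHasWeb_up_up _ _
    · exact hS.braidHasWeb_dn_left (hS.braidHasWeb_up_up _ _)

theorem braidHasWeb (hS : HasBasic S q) (X Y : Word) : BraidHasWeb S X Y := by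
  induction Y with
  | nil => exact .nil_right _
  | cons a Y ih =>
    refine BraidHasWeb.append_right (Y := [a]) ?_ ih
    rcases singleton_eq_up_or_dn a with ha | ha <;> rw [ha]
    · exact hS.braidHasWeb_up_right _ _
    · exact hS.braidHasWeb_dn_right (hS.braidHasWeb_up_right _ _)

theorem hasWeb (hS : HasBasic S q) {X Y : Word} (f : Diag R X Y) : (of S f).HasWeb := by
  induction f with
  | comp f g hf hg =>
    rw [of_comp]
    exact hf.comp hg
  | tensor f g hf hg => exact hf.mul hg
  | add f g hf hg =>
    obtain ⟨w, hw, ew⟩ := hf.exists_isWeb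
    obtain ⟨w', hw', ew'⟩ := hg.exists_isWeb
    rw [of_add, ← ew, ← ew', ← of_add]
    exact .of ⟨hw, hw'⟩
  | smul r f hf =>
    obtain ⟨w, hw, ew⟩ := hf.exists_isWeb
    rw [of_smul, ← ew, ← of_smul]
    exact .of (w := smul r w) hw
  | braid X Y => exact (hS.braidHasWeb X Y).1
  | braidInv X Y => exact (hS.braidHasWeb X Y).2
  | _ => exact .of trivial

end HasBasic

end Crossings

/-! ### Change of coefficients -/

section ChangeOfCoefficients

variable {R : Type u} {K : Type v} [CommRing R] [CommRing K] (φ : R →+* K)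

namespace Diag

/-- The diagram obtained by applying a ring homomorphism to the coefficients. -/
def map : ∀ {X Y : Word}, Diag R X Y → Diag K X Y
  | _, _, eqHom h => eqHom h
  | _, _, comp f g => comp (map f) (map g)
  | _, _, tensor f g => tensor (map f) (map g)
  | _, _, zero => zero
  | _, _, add f g => add (map f) (map g)
  | _, _, smul r f => smul (φ r) (map f)
  | _, _, braid X Y => braid X Y
  | _, _, braidInv X Y => braidInv X Y
  | _, _, merge k l => merge k l
  | _, _, split k l => split k l
  | _, _, cupR k => cupR k
  | _, _, capR k => capR k
  | _, _, cupL k => cupL k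
  | _, _, capL k => capL k

theorem map_rungL (b k l k' l' : ℕ) :
    (rungL b k l k' l' : Diag R _ _).map φ = rungL b k l k' l' := by
  unfold rungL
  split_ifs <;> rfl

theorem map_rungR (b k l k' l' : ℕ) :
    (rungR b k l k' l' : Diag R _ _).map φ = rungR b k l k' l' := by
  unfold rungR
  split_ifs <;> rfl

theorem map_rungL12 (b k l r k' l' : ℕ) :
    (rungL12 b k l r k' l' : Diag R _ _).map φ = rungL12 b k l r k' l' :=
  congrArg (fun f => tensor f (idd (up r))) (map_rungL φ b k l k' l')

theorem map_rungR12 (b k l r k' l' : ℕ) :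
    (rungR12 b k l r k' l' : Diag R _ _).map φ = rungR12 b k l r k' l' :=
  congrArg (fun f => tensor f (idd (up r))) (map_rungR φ b k l k' l')

theorem map_rungL23 (b k l r l' r' : ℕ) :
    (rungL23 b k l r l' r' : Diag R _ _).map φ = rungL23 b k l r l' r' :=
  congrArg (fun f => Diag.cast (tensor (idd (up k)) f)) (map_rungL φ b l r l' r')

theorem map_rungR23 (b k l r l' r' : ℕ) :
    (rungR23 b k l r l' r' : Diag R _ _).map φ = rungR23 b k l r l' r' :=
  congrArg (fun f => Diag.cast (tensor (idd (up k)) f)) (map_rungR φ b l r l' r')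

theorem map_sum {X Y : Word} (n : ℕ) (f : ℕ → Diag R X Y) :
    (Diag.sum n f).map φ = Diag.sum n fun i => (f i).map φ := by
  induction n with
  | zero => rfl
  | succ n ih => exact congrArg (fun g => add g ((f n).map φ)) ih

end Diag

section Coefficients

variable (q a : Rˣ)

theorem map_units_zpow (n : ℤ) :
    φ ((q ^ n : Rˣ) : R) = ((Units.map φ.toMonoidHom q ^ n : Kˣ) : K) := by
  rw [← map_zpow]
  rfl

theorem map_neg_units_zpow (n : ℤ) :
    φ (((-q) ^ n : Rˣ) : R) = (((-Units.map φ.toMonoidHom q) ^ n : Kˣ) : K) := by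
  rw [map_units_zpow]
  congr 2
  ext
  simp

theorem map_neg_units_pow (n : ℕ) :
    φ (((-q) ^ n : Rˣ) : R) = (((-Units.map φ.toMonoidHom q) ^ n : Kˣ) : K) :=
  mod_cast map_neg_units_zpow φ q n

theorem map_qBinom : ∀ n k : ℕ, φ (qBinom q n k) = qBinom (Units.map φ.toMonoidHom q) n k
  | _, 0 => by rw [qBinom, qBinom, map_one]
  | 0, _ + 1 => by rw [qBinom, qBinom, map_zero]
  | n + 1, k + 1 => by
    rw [qBinom, qBinom, map_add, map_mul, map_pow, map_qBinom n k, map_qBinom n (k + 1)]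
    rfl

variable {q}

theorem isUnit_map_sq_sub_one (h : IsUnit ((q : R) ^ 2 - 1)) :
    IsUnit ((Units.map φ.toMonoidHom q : K) ^ 2 - 1) := by
  simpa using h.map φ

theorem map_qInt (h : IsUnit ((q : R) ^ 2 - 1)) (m : ℤ) :
    φ (qInt q m) = qInt (Units.map φ.toMonoidHom q) m := by
  have h' := isUnit_map_sq_sub_one φ h
  refine h'.mul_right_cancel ?_
  have e := congrArg φ (qInt_mul_sq_sub_one q h m)
  rw [map_mul, map_sub, map_sub, map_pow, map_one, map_units_zpow] at e
  rw [qInt_mul_sq_sub_one _ h', ← e]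
  rfl

theorem map_aInt (h : IsUnit ((q : R) ^ 2 - 1)) (m : ℤ) :
    φ (aInt q a m) = aInt (Units.map φ.toMonoidHom q) (Units.map φ.toMonoidHom a) m := by
  have h' := isUnit_map_sq_sub_one φ h
  refine h'.mul_right_cancel ?_
  have e := congrArg φ (aInt_mul_sq_sub_one q a h m)
  rw [map_mul, map_mul, map_sub, map_sub, map_pow, map_one] at e
  rw [aInt_mul_sq_sub_one _ _ h', ← map_zpow, ← map_zpow, ← map_inv, ← map_mul, ← map_mul]
  exact e

end Coefficients

theorem map_crossingSum (q : Rˣ) (k l : ℕ) :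
    (crossingSum q k l).map φ = crossingSum (Units.map φ.toMonoidHom q) k l := by
  rw [crossingSum, crossingSum, Diag.map, Diag.map_sum, map_neg_units_pow]
  simp only [Diag.map, Diag.map_rungL, Diag.map_rungR, map_neg_units_zpow]

theorem map_crossingInvSum (q : Rˣ) (k l : ℕ) :
    (crossingInvSum q k l).map φ = crossingInvSum (Units.map φ.toMonoidHom q) k l := by
  rw [crossingInvSum, crossingInvSum, Diag.map, Diag.map_sum, map_neg_units_zpow]
  simp only [Diag.map, Diag.map_rungL, Diag.map_rungR, map_neg_units_zpow]

/-- The images of the relations `S` under a change of coefficients. -/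
def Relations.map (S : Relations R) : Relations K := fun X Y f g =>
  ∃ f' g' : Diag R X Y, S X Y f' g' ∧ f'.map φ = f ∧ g'.map φ = g

variable {q a : Rˣ}

theorem BasicRel.map (h : IsUnit ((q : R) ^ 2 - 1)) {X Y : Word} {f g : Diag R X Y}
    (hfg : BasicRel q X Y f g) :
    BasicRel (Units.map φ.toMonoidHom q) X Y (f.map φ) (g.map φ) := by
  cases hfg
  case digon k l =>
    simp only [Diag.map, map_mul, map_units_zpow, map_qBinom]
    exact .digon k l
  case square_switch k l =>
    simp only [Diag.map, map_mul, map_neg, map_one, map_units_zpow, map_qInt φ h, Diag.map_rungL,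
      Diag.map_rungR]
    exact .square_switch k l
  case serre₁ | serre₂ | serre₃ | serre₄ =>
    simp only [Diag.map, map_neg, map_one, Diag.map_rungL12, Diag.map_rungL23, Diag.map_rungR12,
      Diag.map_rungR23]
    constructor
  case crossing k l => exact map_crossingSum φ q k l ▸ .crossing k l
  case crossing_inv k l => exact map_crossingInvSum φ q k l ▸ .crossing_inv k l
  all_goals constructor

theorem map_basicRel_of_basicRel (h : IsUnit ((q : R) ^ 2 - 1)) {X Y : Word} {f g : Diag K X Y}
    (hfg : BasicRel (Units.map φ.toMonoidHom q) X Y f g) :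
    Relations.map φ (BasicRel q) X Y f g := by
  cases hfg with
  | digon k l =>
    refine ⟨_, _, .digon k l, rfl, ?_⟩
    simp only [Diag.map, map_mul, map_units_zpow, map_qBinom]
    rfl
  | square_switch k l =>
    refine ⟨_, _, .square_switch k l, ?_, ?_⟩
    · simp only [Diag.map, map_neg, map_one, Diag.map_rungL, Diag.map_rungR]
    · simp only [Diag.map, map_mul, map_units_zpow, map_qInt φ h]
      rfl
  | serre₁ k l r =>
    refine ⟨_, _, .serre₁ k l r, ?_, rfl⟩
    simp only [Diag.map, map_neg, map_one, Diag.map_rungL12, Diag.map_rungL23]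
  | serre₂ k l r =>
    refine ⟨_, _, .serre₂ k l r, ?_, rfl⟩
    simp only [Diag.map, map_neg, map_one, Diag.map_rungL12, Diag.map_rungL23]
  | serre₃ k l r =>
    refine ⟨_, _, .serre₃ k l r, ?_, rfl⟩
    simp only [Diag.map, map_neg, map_one, Diag.map_rungR12, Diag.map_rungR23]
  | serre₄ k l r =>
    refine ⟨_, _, .serre₄ k l r, ?_, rfl⟩
    simp only [Diag.map, map_neg, map_one, Diag.map_rungR12, Diag.map_rungR23]
  | crossing k l => exact ⟨_, _, .crossing k l, rfl, map_crossingSum φ q k l⟩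
  | crossing_inv k l => exact ⟨_, _, .crossing_inv k l, rfl, map_crossingInvSum φ q k l⟩
  | merge_zero_left l => exact ⟨_, _, .merge_zero_left l, rfl, rfl⟩
  | merge_zero_right l => exact ⟨_, _, .merge_zero_right l, rfl, rfl⟩
  | split_zero_left l => exact ⟨_, _, .split_zero_left l, rfl, rfl⟩
  | split_zero_right l => exact ⟨_, _, .split_zero_right l, rfl, rfl⟩
  | cupR_zero => exact ⟨_, _, .cupR_zero, rfl, rfl⟩
  | capR_zero => exact ⟨_, _, .capR_zero, rfl, rfl⟩
  | cupL_zero => exact ⟨_, _, .cupL_zero, rfl, rfl⟩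
  | capL_zero => exact ⟨_, _, .capL_zero, rfl, rfl⟩
  | zigzag_up_R k => exact ⟨_, _, .zigzag_up_R k, rfl, rfl⟩
  | zigzag_dn_R k => exact ⟨_, _, .zigzag_dn_R k, rfl, rfl⟩
  | zigzag_up_L k => exact ⟨_, _, .zigzag_up_L k, rfl, rfl⟩
  | zigzag_dn_L k => exact ⟨_, _, .zigzag_dn_L k, rfl, rfl⟩
  | merge_rot k l => exact ⟨_, _, .merge_rot k l, rfl, rfl⟩
  | split_rot k l => exact ⟨_, _, .split_rot k l, rfl, rfl⟩
  | merge_assoc k l r => exact ⟨_, _, .merge_assoc k l r, rfl, rfl⟩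
  | split_assoc k l r => exact ⟨_, _, .split_assoc k l r, rfl, rfl⟩

theorem map_basicRel (h : IsUnit ((q : R) ^ 2 - 1)) :
    Relations.map φ (BasicRel q) = BasicRel (Units.map φ.toMonoidHom q) := by
  ext X Y f g
  refine ⟨?_, map_basicRel_of_basicRel φ h⟩
  rintro ⟨f, g, hfg, rfl, rfl⟩
  exact hfg.map φ h

theorem map_universalRel (h : IsUnit ((q : R) ^ 2 - 1)) :
    Relations.map φ (UniversalRel q a) =
      UniversalRel (Units.map φ.toMonoidHom q) (Units.map φ.toMonoidHom a) := by
  ext X Y f g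
  constructor
  · rintro ⟨f, g, hfg, rfl, rfl⟩
    cases hfg <;> simp only [Diag.map, map_aInt φ a h] <;> constructor
  · intro hfg
    cases hfg <;> rw [← map_aInt φ a h]
    · exact ⟨_, _, .circleR, rfl, rfl⟩
    · exact ⟨_, _, .circleL, rfl, rfl⟩
    · exact ⟨_, _, .digonR, rfl, rfl⟩
    · exact ⟨_, _, .digonL, rfl, rfl⟩
    · exact ⟨_, _, .square, rfl, rfl⟩
    · exact ⟨_, _, .square_mirror, rfl, rfl⟩

theorem map_infRel (h : IsUnit ((q : R) ^ 2 - 1)) :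
    Relations.map φ (infRel q a) =
      infRel (Units.map φ.toMonoidHom q) (Units.map φ.toMonoidHom a) := by
  unfold infRel
  rw [← map_basicRel φ h, ← map_universalRel φ h]
  ext X Y f g
  simp only [Relations.map, or_and_right, exists_or]

end ChangeOfCoefficients

/-! ### Extension of scalars -/

section BaseChange

variable {C : Type v} [Category.{w} C] [Preadditive C] [MonoidalCategory C] [MonoidalPreadditive C]
variable {R : Type u} [CommRing R] [Linear R C] [MonoidalLinear R C]

theorem smul_tensorHom {X Y X' Y' : C} (r : R) (f : X ⟶ Y) (g : X' ⟶ Y') :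
    (r • f) ⊗ₘ g = r • (f ⊗ₘ g) := by
  simp [MonoidalCategory.tensorHom_def]

theorem tensorHom_smul {X Y X' Y' : C} (r : R) (f : X ⟶ Y) (g : X' ⟶ Y') :
    f ⊗ₘ (r • g) = r • (f ⊗ₘ g) := by
  simp [MonoidalCategory.tensorHom_def]

variable {K : Type u'} [CommRing K] [Algebra R K]

instance : MonoidalPreadditive (BaseChange R K C) where
  whiskerLeft_zero := (BaseChange.btensor _ _ _ _ _).map_zero
  zero_whiskerRight := LinearMap.map_zero₂ (BaseChange.btensor _ _ _ _) _
  whiskerLeft_add f g := (BaseChange.btensor _ _ _ _ _).map_add f g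
  add_whiskerRight f g := LinearMap.map_add₂ (BaseChange.btensor _ _ _ _) f g _

instance : MonoidalLinear K (BaseChange R K C) where
  whiskerLeft_smul _ _ _ r f := BaseChange.btensor_smul_right _ _ _ _ r _ f
  smul_whiskerRight r _ _ f _ := BaseChange.btensor_smul_left _ _ _ _ r f _

theorem ofHom_tensorHom_ofHom {X Y X' Y' : C} (f : X ⟶ Y) (g : X' ⟶ Y') :
    BaseChange.ofHom (R := R) K f ⊗ₘ BaseChange.ofHom K g = BaseChange.ofHom K (f ⊗ₘ g) :=
  (BaseChange.btensor_tmul _ _ _ _ _ _ _ _).trans (by rw [one_mul]; rfl)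

theorem ofHom_comp_ofHom {D : Type v} [Category.{w} D] [Preadditive D] [Linear R D] {X Y Z : D}
    (f : X ⟶ Y) (g : Y ⟶ Z) :
    BaseChange.ofHom (R := R) K f ≫ BaseChange.ofHom K g = BaseChange.ofHom K (f ≫ g) :=
  (BaseChange.bcomp_tmul _ _ _ _ _ _ _).trans (by rw [one_mul]; rfl)

end BaseChange

section PresentedBaseChange

variable {R : Type u} {K : Type v} [CommRing R] [CommRing K] [Algebra R K]
variable (S : Relations R) {T : Relations K}

/-- A word as an object of the category with extended scalars. -/
abbrev bcObj (X : Word) : BaseChange R K (Presented S) := ⟨⟨X⟩⟩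

/-- The value of a diagram over `K` in the category with extended scalars. -/
def evalDiag : ∀ {X Y : Word}, Diag K X Y → (bcObj (K := K) S X ⟶ bcObj (K := K) S Y)
  | _, _, .eqHom h => BaseChange.ofHom K (Presented.homMk S (.eqHom h))
  | _, _, .comp f g => evalDiag f ≫ evalDiag g
  | _, _, .tensor f g => evalDiag f ⊗ₘ evalDiag g
  | _, _, .zero => 0
  | _, _, .add f g => evalDiag f + evalDiag g
  | _, _, .smul r f => r • evalDiag f
  | _, _, .braid X Y => BaseChange.ofHom K (Presented.homMk S (.braid X Y))
  | _, _, .braidInv X Y => BaseChange.ofHom K (Presented.homMk S (.braidInv X Y))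
  | _, _, .merge k l => BaseChange.ofHom K (Presented.homMk S (.merge k l))
  | _, _, .split k l => BaseChange.ofHom K (Presented.homMk S (.split k l))
  | _, _, .cupR k => BaseChange.ofHom K (Presented.homMk S (.cupR k))
  | _, _, .capR k => BaseChange.ofHom K (Presented.homMk S (.capR k))
  | _, _, .cupL k => BaseChange.ofHom K (Presented.homMk S (.cupL k))
  | _, _, .capL k => BaseChange.ofHom K (Presented.homMk S (.capL k))

theorem evalDiag_map {X Y : Word} (f : Diag R X Y) :
    evalDiag S (f.map (algebraMap R K)) = BaseChange.ofHom K (Presented.homMk S f) := by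
  induction f with
  | comp f g hf hg => rw [Diag.map, evalDiag, hf, hg]; exact ofHom_comp_ofHom _ _
  | tensor f g hf hg => rw [Diag.map, evalDiag, hf, hg]; exact ofHom_tensorHom_ofHom _ _
  | zero => exact (TensorProduct.tmul_zero _ _).symm
  | add f g hf hg =>
    rw [Diag.map, evalDiag, hf, hg]
    exact (TensorProduct.tmul_add _ _ _).symm
  | smul r f hf =>
    rw [Diag.map, evalDiag, hf]
    change algebraMap R K r • ((1 : K) ⊗ₜ[R] (Presented.homMk S f)) =
      (1 : K) ⊗ₜ[R] (r • Presented.homMk S f)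
    rw [algebraMap_smul, TensorProduct.tmul_smul]
  | _ => rfl

variable {S}

theorem evalDiag_eq_of_equivalent
    (hT : ∀ {X Y : Word} {f g : Diag K X Y}, T X Y f g → evalDiag S f = evalDiag S g)
    {X Y : Word} {f g : Diag K X Y} (h : Equivalent T f g) : evalDiag S f = evalDiag S g := by
  induction h with
  | of h => exact hT h
  | refl f => rfl
  | symm _ ih => exact ih.symm
  | trans _ _ ih ih' => exact ih.trans ih'
  | comp_congr _ _ ih ih' => rw [evalDiag, evalDiag, ih, ih']
  | tensor_congr _ _ ih ih' => rw [evalDiag, evalDiag, ih, ih']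
  | add_congr _ _ ih ih' => rw [evalDiag, evalDiag, ih, ih']
  | smul_congr r _ ih => rw [evalDiag, evalDiag, ih]
  | add_assoc f g h => exact add_assoc _ _ _
  | add_comm f g => exact add_comm _ _
  | zero_add f => exact zero_add _
  | one_smul f => exact one_smul _ _
  | zero_smul f => exact zero_smul _ _
  | mul_smul r s f => exact mul_smul _ _ _
  | add_smul r s f => exact add_smul _ _ _
  | smul_add r f g => exact smul_add _ _ _
  | id_comp f => exact Category.id_comp _
  | comp_id f => exact Category.comp_id _
  | comp_assoc f g h => exact Category.assoc _ _ _
  | tensor_id X Y => exact id_tensorHom_id (bcObj (K := K) S X) (bcObj (K := K) S Y)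
  | tensor_comp f g f' g' => exact tensorHom_comp_tensorHom _ _ _ _
  | tensor_assoc f g h => exact associator_naturality _ _ _
  | unit_tensor f =>
    have h := leftUnitor_naturality (evalDiag S f)
    rw [← id_tensorHom] at h
    exact ((Category.comp_id _).symm.trans h).trans (Category.id_comp _)
  | tensor_unit f =>
    have h := rightUnitor_naturality (evalDiag S f)
    rw [← tensorHom_id] at h
    exact h
  | add_comp f f' g => exact Preadditive.add_comp _ _ _ _ _ _
  | comp_add f g g' => exact Preadditive.comp_add _ _ _ _ _ _
  | smul_comp r f g => exact Linear.smul_comp _ _ _ _ _ _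
  | comp_smul r f g => exact Linear.comp_smul _ _ _ _ _ _
  | add_tensor f f' g => exact MonoidalPreadditive.add_tensor _ _ _
  | tensor_add f g g' => exact MonoidalPreadditive.tensor_add _ _ _
  | smul_tensor r f g => exact smul_tensorHom r _ _
  | tensor_smul r f g => exact tensorHom_smul r _ _
  | braid_braidInv X Y => exact (β_ (bcObj (K := K) S X) (bcObj (K := K) S Y)).hom_inv_id
  | braidInv_braid X Y => exact (β_ (bcObj (K := K) S X) (bcObj (K := K) S Y)).inv_hom_id
  | braid_naturality f g => exact BraidedCategory.braiding_naturality _ _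
  | hexagon_forward X Y Z =>
    have h := BraidedCategory.hexagon_forward (bcObj (K := K) S X) (bcObj S Y) (bcObj S Z)
    rw [← id_tensorHom, ← tensorHom_id] at h
    exact h
  | hexagon_reverse X Y Z =>
    have h := BraidedCategory.hexagon_reverse (bcObj (K := K) S X) (bcObj S Y) (bcObj S Z)
    rw [← id_tensorHom, ← tensorHom_id] at h
    exact h

theorem evalDiag_eq_of_map_entails (hT : (S.map (algebraMap R K)).Entails T)
    {X Y : Word} {f g : Diag K X Y} (h : Equivalent T f g) : evalDiag S f = evalDiag S g := by
  refine evalDiag_eq_of_equivalent (fun hfg => ?_) h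
  refine evalDiag_eq_of_equivalent (fun hfg => ?_) (hT hfg)
  obtain ⟨f, g, hfg, rfl, rfl⟩ := hfg
  rw [evalDiag_map, evalDiag_map]
  exact congrArg (BaseChange.ofHom K) (Presented.sound (.of hfg))

/-- The map from the presented category with relations `T` to the extension of scalars of the one
with relations `S`, when the relations of `T` follow from those of `S`. -/
def evalHom (hT : (S.map (algebraMap R K)).Entails T) (X Y : Word) :
    ((⟨X⟩ : Presented T) ⟶ ⟨Y⟩) →ₗ[K] (bcObj (K := K) S X ⟶ bcObj (K := K) S Y) where
  toFun := Quotient.lift (evalDiag S) fun _ _ h => evalDiag_eq_of_map_entails hT h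
  map_add' f g := by
    obtain ⟨f, rfl⟩ := Presented.cls_surj f
    obtain ⟨g, rfl⟩ := Presented.cls_surj g
    rfl
  map_smul' r f := by
    obtain ⟨f, rfl⟩ := Presented.cls_surj f
    rfl

theorem equivalent_map (hS : T.Entails (S.map (algebraMap R K)))
    {X Y : Word} {f g : Diag R X Y} (h : Equivalent S f g) :
    Equivalent T (f.map (algebraMap R K)) (g.map (algebraMap R K)) := by
  induction h with
  | of h => exact hS ⟨_, _, h, rfl, rfl⟩
  | refl f => exact .refl _
  | symm _ ih => exact ih.symm
  | trans _ _ ih ih' => exact ih.trans ih'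
  | comp_congr _ _ ih ih' => exact .comp_congr ih ih'
  | tensor_congr _ _ ih ih' => exact .tensor_congr ih ih'
  | add_congr _ _ ih ih' => exact .add_congr ih ih'
  | smul_congr r _ ih => exact .smul_congr _ ih
  | add_assoc f g h => exact .add_assoc _ _ _
  | add_comm f g => exact .add_comm _ _
  | zero_add f => exact .zero_add _
  | one_smul f => rw [Diag.map, map_one]; exact .one_smul _
  | zero_smul f => simp only [Diag.map, _root_.map_zero]; exact .zero_smul _
  | mul_smul r s f => rw [Diag.map, map_mul]; exact .mul_smul _ _ _
  | add_smul r s f => simp only [Diag.map, _root_.map_add]; exact .add_smul _ _ _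
  | smul_add r f g => exact .smul_add _ _ _
  | id_comp f => exact .id_comp _
  | comp_id f => exact .comp_id _
  | comp_assoc f g h => exact .comp_assoc _ _ _
  | tensor_id X Y => exact .tensor_id _ _
  | tensor_comp f g f' g' => exact .tensor_comp _ _ _ _
  | tensor_assoc f g h => exact .tensor_assoc _ _ _
  | unit_tensor f => exact .unit_tensor _
  | tensor_unit f => exact .tensor_unit _
  | add_comp f f' g => exact .add_comp _ _ _
  | comp_add f g g' => exact .comp_add _ _ _
  | smul_comp r f g => exact .smul_comp _ _ _
  | comp_smul r f g => exact .comp_smul _ _ _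
  | add_tensor f f' g => exact .add_tensor _ _ _
  | tensor_add f g g' => exact .tensor_add _ _ _
  | smul_tensor r f g => exact .smul_tensor _ _ _
  | tensor_smul r f g => exact .tensor_smul _ _ _
  | braid_braidInv X Y => exact .braid_braidInv _ _
  | braidInv_braid X Y => exact .braidInv_braid _ _
  | braid_naturality f g => exact .braid_naturality _ _
  | hexagon_forward X Y Z => exact .hexagon_forward _ _ _
  | hexagon_reverse X Y Z => exact .hexagon_reverse _ _ _

variable (hS : T.Entails (S.map (algebraMap R K)))

/-- The map on morphisms induced by the change of coefficients in diagrams. -/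
def mapHom (X Y : Word) :
    ((⟨X⟩ : Presented S) ⟶ ⟨Y⟩) →ₛₗ[algebraMap R K] ((⟨X⟩ : Presented T) ⟶ ⟨Y⟩) where
  toFun := Quotient.map (Diag.map (algebraMap R K)) fun _ _ h => equivalent_map hS h
  map_add' f g := by
    obtain ⟨f, rfl⟩ := Presented.cls_surj f
    obtain ⟨g, rfl⟩ := Presented.cls_surj g
    rfl
  map_smul' r f := by
    obtain ⟨f, rfl⟩ := Presented.cls_surj f
    rfl

/-- The additive map `s ⊗ f ↦ s • mapHom f`. -/
def baseChangeAddHom (X Y : Word) :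
    K ⊗[R] ((⟨X⟩ : Presented S) ⟶ ⟨Y⟩) →+ ((⟨X⟩ : Presented T) ⟶ ⟨Y⟩) :=
  TensorProduct.liftAddHom
    (AddMonoidHom.mk' (fun s : K => (DistribSMul.toAddMonoidHom
      ((⟨X⟩ : Presented T) ⟶ ⟨Y⟩) s).comp (mapHom hS X Y).toAddMonoidHom)
      fun s t => by ext f; exact add_smul s t _)
    fun r s f => by
      change (r • s) • mapHom hS X Y f = s • mapHom hS X Y (r • f)
      rw [map_smulₛₗ, Algebra.smul_def, mul_smul, smul_comm]

/-- The map from the extension of scalars of the presented category with relations `S` to the one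
with relations `T`, when the relations of `S` hold in the latter. -/
def baseChangeHom (X Y : Word) :
    (bcObj (K := K) S X ⟶ bcObj (K := K) S Y) →ₗ[K] ((⟨X⟩ : Presented T) ⟶ ⟨Y⟩) where
  toFun := baseChangeAddHom hS X Y
  map_add' f g := (baseChangeAddHom hS X Y).map_add f g
  map_smul' r (f : K ⊗[R] _) := by
    change baseChangeAddHom hS X Y (r • f) = r • baseChangeAddHom hS X Y f
    induction f using TensorProduct.induction_on with
    | zero => rw [smul_zero, map_zero, smul_zero]
    | add f g hf hg => rw [smul_add, map_add, map_add, hf, hg, smul_add]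
    | tmul s f => exact mul_smul r s (mapHom hS X Y f)

theorem baseChangeHom_ofHom {X Y : Word} (f : Diag R X Y) :
    baseChangeHom hS X Y (BaseChange.ofHom K (Presented.homMk S f)) =
      Presented.homMk T (f.map (algebraMap R K)) :=
  one_smul K (Presented.homMk T (f.map (algebraMap R K)))

theorem baseChange_induction {X Y : Word} {p : (bcObj (K := K) S X ⟶ bcObj (K := K) S Y) → Prop}
    (zero : p 0) (add : ∀ f g, p f → p g → p (f + g))
    (smul : ∀ (s : K) (f : Diag R X Y), p (s • BaseChange.ofHom K (Presented.homMk S f)))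
    (f : bcObj (K := K) S X ⟶ bcObj (K := K) S Y) : p f := by
  refine TensorProduct.induction_on (motive := p) f zero (fun s g => ?_) add
  obtain ⟨g, rfl⟩ := Presented.cls_surj g
  have e : s • BaseChange.ofHom K (Presented.homMk S g) =
      (s ⊗ₜ[R] Presented.cls S g : K ⊗[R] ((⟨X⟩ : Presented S) ⟶ ⟨Y⟩)) := by
    refine (TensorProduct.smul_tmul' s (1 : K) (Presented.homMk S g)).trans ?_
    rw [smul_eq_mul, mul_one]
    rfl
  exact e ▸ smul s g

theorem baseChangeHom_comp {X Y Z : Word} (f : bcObj (K := K) S X ⟶ bcObj S Y)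
    (g : bcObj (K := K) S Y ⟶ bcObj S Z) :
    baseChangeHom hS X Z (f ≫ g) = baseChangeHom hS X Y f ≫ baseChangeHom hS Y Z g := by
  induction f using baseChange_induction with
  | zero => rw [Limits.zero_comp, map_zero, map_zero, Limits.zero_comp]
  | add f f' hf hf' =>
    rw [Preadditive.add_comp, map_add, map_add, hf, hf', Preadditive.add_comp]
  | smul s f =>
    induction g using baseChange_induction with
    | zero => rw [Limits.comp_zero, map_zero, map_zero, Limits.comp_zero]
    | add g g' hg hg' =>
      rw [Preadditive.comp_add, map_add, map_add, hg, hg', Preadditive.comp_add]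
    | smul t g =>
      simp only [Linear.smul_comp, Linear.comp_smul, map_smul, baseChangeHom_ofHom,
        ofHom_comp_ofHom]
      exact congrArg (t • s • ·) (baseChangeHom_ofHom hS (Diag.comp f g))

theorem baseChangeHom_tensor {X Y X' Y' : Word} (f : bcObj (K := K) S X ⟶ bcObj S Y)
    (g : bcObj (K := K) S X' ⟶ bcObj S Y') :
    baseChangeHom hS (X ++ X') (Y ++ Y') (f ⊗ₘ g) =
      (baseChangeHom hS X Y f ⊗ₘ baseChangeHom hS X' Y' g) := by
  induction f using baseChange_induction with
  | zero =>
    rw [MonoidalPreadditive.zero_tensor, map_zero (baseChangeHom hS X Y),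
      MonoidalPreadditive.zero_tensor]
    exact map_zero (baseChangeHom hS _ _)
  | add f f' hf hf' =>
    rw [MonoidalPreadditive.add_tensor, map_add (baseChangeHom hS X Y),
      MonoidalPreadditive.add_tensor, ← hf, ← hf']
    exact map_add (baseChangeHom hS _ _) _ _
  | smul s f =>
    induction g using baseChange_induction with
    | zero =>
      rw [MonoidalPreadditive.tensor_zero, map_zero (baseChangeHom hS X' Y'),
        MonoidalPreadditive.tensor_zero]
      exact map_zero (baseChangeHom hS _ _)
    | add g g' hg hg' =>
      rw [MonoidalPreadditive.tensor_add, map_add (baseChangeHom hS X' Y'),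
        MonoidalPreadditive.tensor_add, ← hg, ← hg']
      exact map_add (baseChangeHom hS _ _) _ _
    | smul t g =>
      simp only [map_smul (baseChangeHom hS X Y), map_smul (baseChangeHom hS X' Y'),
        smul_tensorHom, tensorHom_smul, baseChangeHom_ofHom, ofHom_tensorHom_ofHom]
      refine ((baseChangeHom hS _ _).map_smul t _).trans (congrArg (t • ·) ?_)
      refine ((baseChangeHom hS _ _).map_smul s _).trans (congrArg (s • ·) ?_)
      exact baseChangeHom_ofHom hS (Diag.tensor f g)

theorem baseChangeHom_evalDiag {X Y : Word} (f : Diag K X Y) :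
    baseChangeHom hS X Y (evalDiag S f) = Presented.homMk T f := by
  induction f with
  | comp f g hf hg => rw [evalDiag, baseChangeHom_comp, hf, hg]; rfl
  | tensor f g hf hg => rw [evalDiag, baseChangeHom_tensor, hf, hg]; rfl
  | zero => exact map_zero _
  | add f g hf hg => rw [evalDiag, map_add, hf, hg]; rfl
  | smul r f hf => rw [evalDiag, map_smul, hf]; rfl
  | _ => exact baseChangeHom_ofHom hS _

theorem evalHom_baseChangeHom (hT : (S.map (algebraMap R K)).Entails T) {X Y : Word}
    (f : bcObj (K := K) S X ⟶ bcObj S Y) : evalHom hT X Y (baseChangeHom hS X Y f) = f := by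
  induction f using baseChange_induction with
  | zero => rw [map_zero, map_zero]
  | add f g hf hg => rw [map_add, map_add, hf, hg]
  | smul s f =>
    rw [map_smul, map_smul, baseChangeHom_ofHom]
    exact congrArg (s • ·) (evalDiag_map S f)

/-- Extending the scalars of a category presented by `S` amounts to presenting it by relations
equivalent to the images of those of `S`. -/
def baseChangeEquiv (hT : (S.map (algebraMap R K)).Entails T) (X Y : Word) :
    (bcObj (K := K) S X ⟶ bcObj (K := K) S Y) ≃ₗ[K] ((⟨X⟩ : Presented T) ⟶ ⟨Y⟩) where
  __ := baseChangeHom hS X Y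
  invFun := evalHom hT X Y
  left_inv := evalHom_baseChangeHom hS hT
  right_inv f := by
    obtain ⟨f, rfl⟩ := Presented.cls_surj f
    exact baseChangeHom_evalDiag hS f

end PresentedBaseChange

/-! ### Specialization of the universal category -/

theorem isUnit_univQ_sq_sub_one : IsUnit ((univQ : UnivRing) ^ 2 - 1) := by
  have h := isUnit_univ
  rw [map_mul] at h
  have h' := isUnit_of_mul_isUnit_right h
  rwa [map_sub, map_pow, map_one] at h'

theorem map_infRel_specialize {K : Type v} [CommRing K] [Algebra (RatFunc ℚ) K] (x : ℚ) (ν : K)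
    (hν : ν ^ 2 * algebraMap (RatFunc ℚ) K (qDelta x) = 1) :
    (infRel univQ univA).map (specialize x ν hν) = specRel x ν hν := by
  have hq : Units.map (specialize x ν hν).toMonoidHom univQ = qUnit K :=
    Units.ext (specialize_q x ν hν)
  have ha : Units.map (specialize x ν hν).toMonoidHom univA = aUnit x ν hν :=
    Units.ext (specialize_a x ν hν)
  rw [map_infRel _ isUnit_univQ_sq_sub_one, hq, ha]

end Web

end

theorem mainTheorem1 {K : Type*} [CommRing K] [Algebra (RatFunc ℚ) K] (x : ℚ) (ν : K)
    (hν : ν ^ 2 * algebraMap (RatFunc ℚ) K (Web.qDelta x) = 1) :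
    ∃ Φ : ∀ X Y : Web.Word,
        (Web.XWeb.of x ν hν X ⟶ Web.XWeb.of x ν hν Y) ≃ₗ[K]
          (Web.XWebPresented.of x ν X ⟶ Web.XWebPresented.of x ν Y),
      (∀ X, Φ X X (𝟙 _) = 𝟙 _) ∧
      (∀ (X Y Z : Web.Word) (f : Web.XWeb.of x ν hν X ⟶ Web.XWeb.of x ν hν Y)
        (g : Web.XWeb.of x ν hν Y ⟶ Web.XWeb.of x ν hν Z),
        Φ X Z (f ≫ g) = Φ X Y f ≫ Φ Y Z g) ∧
      (∀ (X Y X' Y' : Web.Word) (f : Web.XWeb.of x ν hν X ⟶ Web.XWeb.of x ν hν Y)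
        (g : Web.XWeb.of x ν hν X' ⟶ Web.XWeb.of x ν hν Y'),
        Φ (X ++ X') (Y ++ Y') (f ⊗ₘ g) = Φ X Y f ⊗ₘ Φ X' Y' g) ∧
      (∀ X Y : Web.Word,
        Φ (X ++ Y) (Y ++ X) (β_ (Web.XWeb.of x ν hν X) (Web.XWeb.of x ν hν Y)).hom =
          (β_ (Web.XWebPresented.of x ν X) (Web.XWebPresented.of x ν Y)).hom) ∧
      (∀ k l : ℕ,
        Φ _ _ (Web.XWeb.ofDiag x ν hν (.merge k l)) = Web.XWebPresented.ofDiag x ν (.merge k l) ∧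
        Φ _ _ (Web.XWeb.ofDiag x ν hν (.split k l)) = Web.XWebPresented.ofDiag x ν (.split k l)) ∧
      (∀ k : ℕ,
        Φ _ _ (Web.XWeb.ofDiag x ν hν (.cupR k)) = Web.XWebPresented.ofDiag x ν (.cupR k) ∧
        Φ _ _ (Web.XWeb.ofDiag x ν hν (.capR k)) = Web.XWebPresented.ofDiag x ν (.capR k) ∧
        Φ _ _ (Web.XWeb.ofDiag x ν hν (.cupL k)) = Web.XWebPresented.ofDiag x ν (.cupL k) ∧
        Φ _ _ (Web.XWeb.ofDiag x ν hν (.capL k)) = Web.XWebPresented.ofDiag x ν (.capL k)) ∧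
      (∀ k l : ℕ,
        (β_ (Web.XWebPresented.of x ν (Web.up k)) (Web.XWebPresented.of x ν (Web.up l))).hom =
            Web.XWebPresented.ofDiag x ν (Web.crossingSum (Web.qUnit K) k l) ∧
          (β_ (Web.XWebPresented.of x ν (Web.up l)) (Web.XWebPresented.of x ν (Web.up k))).inv =
            Web.XWebPresented.ofDiag x ν (Web.crossingInvSum (Web.qUnit K) k l)) ∧
      (∀ (X Y : Web.Word) (f : Web.XWebPresented.of x ν X ⟶ Web.XWebPresented.of x ν Y),
        ∃ w : Web.Diag K X Y, w.IsWeb ∧ Web.XWebPresented.ofDiag x ν w = f) := by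
  let _ := Web.specAlgebra x ν hν
  have hS : (Web.presRel x ν).Entails ((Web.infRel Web.univQ Web.univA).map (algebraMap _ K)) :=
    Web.map_infRel_specialize x ν hν ▸ Web.presRel_entails_specRel x ν hν
  have hT : ((Web.infRel Web.univQ Web.univA).map (algebraMap _ K)).Entails (Web.presRel x ν) :=
    Web.map_infRel_specialize x ν hν ▸ Web.specRel_entails_presRel x ν hν
  have hB : Web.HasBasic (Web.presRel x ν) (Web.qUnit K) := fun _ _ _ _ => .inl
  refine ⟨Web.baseChangeEquiv hS hT, fun X => Web.baseChangeHom_ofHom hS (Web.Diag.idd X),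
    fun _ _ _ => Web.baseChangeHom_comp hS, fun _ _ _ _ => Web.baseChangeHom_tensor hS,
    fun X Y => Web.baseChangeHom_ofHom hS (.braid X Y),
    fun k l => ⟨Web.baseChangeHom_ofHom hS (.merge k l), Web.baseChangeHom_ofHom hS (.split k l)⟩,
    fun k => ⟨Web.baseChangeHom_ofHom hS (.cupR k), Web.baseChangeHom_ofHom hS (.capR k),
      Web.baseChangeHom_ofHom hS (.cupL k), Web.baseChangeHom_ofHom hS (.capL k)⟩,
    fun k l => ⟨Web.Presented.sound (.of (.inl (.crossing k l))),
      Web.Presented.sound (.of (.inl (.crossing_inv k l)))⟩, fun X Y f => ?_⟩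
  obtain ⟨f, rfl⟩ := Web.Presented.cls_surj f
  obtain ⟨w, hw, e⟩ := (hB.hasWeb f).exists_isWeb
  exact ⟨w, hw, Web.Presented.sound (Web.Mor.equivalent_of_eq e)⟩
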